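/- Let $n\ge 1$ and let $s_1,\dots,s_{n-1}$ be the simple reflections of the symmetric group $S_n$, with simple roots $\alpha_k$ (so $\sigma\alpha_k<0$ iff $\sigma(k+1)<\sigma(k)$). For a word $\mathbf v=\mathbf s_{k_1}\cdots\mathbf s_{k_L}$ write $\pi(\mathbf v)=s_{k_1}\cdots s_{k_L}$; a $\mathbf v$-mask is an $x\in\{0,1\}^L$, $\mathbf v^{(i)}[x]$ is the subword of the letters $\mathbf s_{k_r}$ with $r\le i$ and $x_r=1$, $\mathbf v[x]=\mathbf v^{(L)}[x]$, $\operatorname{sgn}x=\prod_r(-1)^{x_r}$, and $\mathfrak d_{\mathbf v}(x)$ is the number of $i$ with $\pi(\mathbf v^{(i-1)}[x])\,\alpha_{k_i}<0$. Deodhar's polynomials are $P^{\mathbf v}_u=\sum_{x:\,\pi(\mathbf v[x])=u}q^{\mathfrak d_{\mathbf v}(x)}$. Let $w\in S_n$ be Boolean, i.e. a product of distinct simple reflections, and let $\mathbf w=\mathbf s_{j_1}\cdots\mathbf s_{j_l}$ be a reduced decomposition of $w$. For $v\in S_n$ let $\tilde v\in S_{2n}$ be given by $\tilde v(2i)=2v(i)$,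 $\tilde v(2i-1)=2v(i)-1$. Let $\tilde{\mathbf s}_k=\mathbf s_{2k}\mathbf s_{2k-1}\mathbf s_{2k+1}\mathbf s_{2k}$ and $\tilde{\mathbf w}=\tilde{\mathbf s}_{j_1}\cdots\tilde{\mathbf s}_{j_l}$. Let $H\le S_{2n}$ be the subgroup preserving each set $\{2i-1,2i\}$, and let $\le$ be the Bruhat order. For $A\subset B\subset\{1,\dots,l\}$ let $\overrightarrow N{}_A^B$ (resp. $\overleftarrow N{}_A^B$) be the set of $i\in B\setminus A$ for which there are $t>0$ and (necessarily unique) $i<i_1<\dots<i_t$ (resp. $i>i_1>\dots>i_t$) with $i_1,\dots,i_{t-1}\in A$, $i_t\in B\setminus A$ and $j_{i_k}=j_i+k$ for $k=1,\dots,t$; put $\nu_A^B(i)=i_t$ and $N_A^B=\overrightarrow N{}_A^B\cup\overleftarrow N{}_A^B$. The superscript is dropped when $B=\{1,\dots,l\}$. Let $\mathcal T$ be the set of triplets $Q=(I_e,I,I_f)$ of subsets of $\{1,\dots,l\}$ with $I_f\subset I_e$ and $I\subset N_{I_f}^{I_e}$. For $u\le\tilde w$ put $\mathbf p(u)=(I_e,I,I_f)$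 with $I_e=\{i:s_{2j_i}\le u\}$, $I_f=\{i:\tilde s_{j_i}\le u\}$, and $I$ the set of those $i\in N_{I_f}$ such that, with $i'=\nu_{I_f}(i)$, $$s_{2j_i}s_{2j_i+1}\,\tilde s_{j_i+1}\cdots\tilde s_{j_{i'}-1}\,s_{2j_{i'}}\le u\ \text{ if } i\in\overrightarrow N_{I_f},\qquad s_{2j_{i'}}\,\tilde s_{j_{i'}-1}\cdots\tilde s_{j_i+1}\,s_{2j_i+1}s_{2j_i}\le u\ \text{ if } i\in\overleftarrow N_{I_f}.$$ For $Q=(I_e,I,I_f)\in\mathcal T$ put $\mathbf q(Q)=\pi(\mathbf y_1\cdots\mathbf y_l)$, where $\mathbf y_i$ is empty if $i\notin I_e$, $\tilde{\mathbf s}_{j_i}$ if $i\in I_f$, $\mathbf s_{2j_i}\mathbf s_{2j_i+1}$ if $i\in I\cap\overrightarrow N_{I_f}$, $\mathbf s_{2j_i+1}\mathbf s_{2j_i}$ if $i\in I\cap\overleftarrow N_{I_f}$, and $\mathbf s_{2j_i}$ otherwise. **Proposition.** For every $Q=(I_e,I,I_f)\in\mathcal T$, with $N=N_{I_f}^{I_e}$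 and $I_e^c=\{1,\dots,l\}\setminus I_e$, $$\sum_{u\in H\mathbf q(Q)H}\operatorname{sgn}u\;P_u^{\tilde{\mathbf w}}=\sum_{x\in\{0,1\}^{4l}:\ \mathbf p(\pi(\tilde{\mathbf w}[x]))=Q}\operatorname{sgn}x\;q^{\mathfrak d_{\tilde{\mathbf w}}(x)}=(-1)^{|I_e\setminus I_f|}\,q^{|I_e^c|+|N\setminus I|}\,(q+1)^{|I_e\setminus(I_f\cup N)|}.$$ In particular, $$\sum_{x\in\{0,1\}^{4l}:\ \mathbf p(\pi(\tilde{\mathbf w}[x]))=Q}\operatorname{sgn}x=2^{|I_e\setminus(I_f\cup N)|}\,(-1)^{|I_e\setminus I_f|}.$$ -/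

import Mathlib

open scoped Polynomial

namespace BooleanWord

noncomputable section

/-! Permutations of `n` letters act on `Fin n = {0, …, n-1}`. The letter `k` (with `k + 1 < n`)
stands for the simple reflection exchanging `k` and `k + 1`, so that letters and points are the
usual ones lowered by one. -/

/-- The simple reflection exchanging `k` and `k + 1` (the identity when `k` is not a letter). -/
def simpleRefl (n k : ℕ) : Equiv.Perm (Fin n) :=
  if h : k + 1 < n then Equiv.swap ⟨k, Nat.lt_of_succ_lt h⟩ ⟨k + 1, h⟩ else 1

/-- The permutation `s_{k₁} ⋯ s_{k_r}` represented by the word `k₁ ⋯ k_r`. -/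
def wordProd (n : ℕ) (L : List ℕ) : Equiv.Perm (Fin n) :=
  (L.map (simpleRefl n)).prod

/-- `w` is Boolean: a product of distinct simple reflections, i.e. a Coxeter element of a
parabolic subgroup. -/
def IsBoolean {n : ℕ} (w : Equiv.Perm (Fin n)) : Prop :=
  ∃ L : List ℕ, L.Nodup ∧ (∀ k ∈ L, k + 1 < n) ∧ wordProd n L = w

/-- The word `j` is a reduced decomposition of `w`: it represents `w`, and no shorter word does. -/
def IsReducedWord {n l : ℕ} (j : Fin l → ℕ) (w : Equiv.Perm (Fin n)) : Prop :=
  (∀ i, j i + 1 < n) ∧ wordProd n (List.ofFn j) = w ∧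
    ∀ L : List ℕ, (∀ k ∈ L, k + 1 < n) → wordProd n L = w → l ≤ L.length

/-- Multiplication by a transposition that increases the length: `v = u (a b)` with `a < b` and
`u a < u b`. -/
def BruhatStep {N : ℕ} (u v : Equiv.Perm (Fin N)) : Prop :=
  ∃ a b : Fin N, a < b ∧ u a < u b ∧ v = u * Equiv.swap a b

/-- The Bruhat order. -/
def BruhatLE {N : ℕ} (u v : Equiv.Perm (Fin N)) : Prop :=
  Relation.ReflTransGen BruhatStep u v

/-! ### Masks, defects and Deodhar's polynomials -/

/-- `π(w^{(i)}[x])`: the product of the first `i` letters of the word, keeping only those with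
`x k = 1`. -/
def partialProd (N : ℕ) {L : ℕ} (word : Fin L → ℕ) (x : Fin L → Bool) (i : ℕ) :
    Equiv.Perm (Fin N) :=
  ((List.ofFn fun k => if x k then simpleRefl N (word k) else 1).take i).prod

/-- `π(w[x])`. -/
def maskProd (N : ℕ) {L : ℕ} (word : Fin L → ℕ) (x : Fin L → Bool) : Equiv.Perm (Fin N) :=
  partialProd N word x L

/-- `σ α_k < 0`, where `α_k` is the simple root of the letter `k`. -/
def SendsToNegative {N : ℕ} (σ : Equiv.Perm (Fin N)) (k : ℕ) : Prop :=
  ∃ h : k + 1 < N, σ ⟨k + 1, h⟩ < σ ⟨k, Nat.lt_of_succ_lt h⟩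

open Classical in
/-- The defect set of a mask: the positions `i` such that the product of the chosen letters
strictly before `i` sends the simple root of the letter at `i` to a negative root. -/
def defectSet (N : ℕ) {L : ℕ} (word : Fin L → ℕ) (x : Fin L → Bool) : Finset (Fin L) :=
  Finset.univ.filter fun i => SendsToNegative (partialProd N word x i) (word i)

/-- The defect statistic. -/
def defect (N : ℕ) {L : ℕ} (word : Fin L → ℕ) (x : Fin L → Bool) : ℕ :=
  (defectSet N word x).card

/-- The sign of a mask. -/
def maskSign {L : ℕ} (x : Fin L → Bool) : ℤ :=
  ∏ i, if x i then -1 else 1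

/-- Deodhar's polynomial `P_u^word`. -/
def deodharPoly (N : ℕ) {L : ℕ} (word : Fin L → ℕ) (u : Equiv.Perm (Fin N)) : ℤ[X] :=
  ∑ x : Fin L → Bool with maskProd N word x = u, Polynomial.X ^ defect N word x

/-! ### Doubling -/

/-- The doubling `S_n → S_{2n}`: the permutation of `Fin (n * 2)` with `2 i + r ↦ 2 w(i) + r`
for `r = 0, 1`. -/
def double {n : ℕ} (w : Equiv.Perm (Fin n)) : Equiv.Perm (Fin (n * 2)) :=
  finProdFinEquiv.symm.trans ((w.prodCongr (Equiv.refl (Fin 2))).trans finProdFinEquiv)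

/-- The word of length four for the double of the simple reflection of the letter `k`. -/
def doubleLetter (k : ℕ) : Fin 4 → ℕ :=
  ![2 * k + 1, 2 * k, 2 * k + 2, 2 * k + 1]

/-- The doubled word: every letter is replaced, in order, by its word of length four. The
position `4 i + r` carries the `r`-th letter of the `i`-th block. -/
def doubleWord {l : ℕ} (j : Fin l → ℕ) : Fin (l * 4) → ℕ :=
  fun p => doubleLetter (j (finProdFinEquiv.symm p).1) (finProdFinEquiv.symm p).2

/-- The parabolic subgroup `H` of `S_{2n}` of the permutations that preserve each of the blocks
`{2 i, 2 i + 1}`. -/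
def blockSubgroup (n : ℕ) : Subgroup (Equiv.Perm (Fin (n * 2))) where
  carrier := {u | ∀ p, (u p).val / 2 = p.val / 2}
  mul_mem' := fun {a b} ha hb p => (ha (b p)).trans (hb p)
  one_mem' := fun _ => rfl
  inv_mem' := fun {a} ha p => by
    have h : (a (a.symm p)).val / 2 = (a.symm p).val / 2 := ha (a.symm p)
    rw [Equiv.apply_symm_apply] at h
    exact h.symm

/-! ### Neighbors -/

/-- `i' = ν_A^B(i)` where `i` is a right neighbor: there are `i = c 0 < c 1 < ⋯ < c t = i'`,
`t > 0`, with `i, i' ∈ B \ A`, all intermediate indices in `A`, and `j (c k) = j i + k`. -/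
def IsRightNeighbor {l : ℕ} (j : Fin l → ℕ) (A B : Finset (Fin l)) (i i' : Fin l) : Prop :=
  i ∈ B \ A ∧ i' ∈ B \ A ∧ ∃ (t : ℕ) (c : ℕ → Fin l), 0 < t ∧ c 0 = i ∧ c t = i' ∧
    (∀ k < t, c k < c (k + 1)) ∧ (∀ k, 0 < k → k < t → c k ∈ A) ∧ ∀ k ≤ t, j (c k) = j i + k

/-- `i' = ν_A^B(i)` where `i` is a left neighbor: the same with decreasing indices. -/
def IsLeftNeighbor {l : ℕ} (j : Fin l → ℕ) (A B : Finset (Fin l)) (i i' : Fin l) : Prop :=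
  i ∈ B \ A ∧ i' ∈ B \ A ∧ ∃ (t : ℕ) (c : ℕ → Fin l), 0 < t ∧ c 0 = i ∧ c t = i' ∧
    (∀ k < t, c (k + 1) < c k) ∧ (∀ k, 0 < k → k < t → c k ∈ A) ∧ ∀ k ≤ t, j (c k) = j i + k

open Classical in
/-- The right neighbor set of `A` in `B`. -/
def rightNbrs {l : ℕ} (j : Fin l → ℕ) (A B : Finset (Fin l)) : Finset (Fin l) :=
  Finset.univ.filter fun i => ∃ i', IsRightNeighbor j A B i i'

open Classical in
/-- The left neighbor set of `A` in `B`. -/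
def leftNbrs {l : ℕ} (j : Fin l → ℕ) (A B : Finset (Fin l)) : Finset (Fin l) :=
  Finset.univ.filter fun i => ∃ i', IsLeftNeighbor j A B i i'

/-- The neighbor set of `A` in `B`. -/
def nbrs {l : ℕ} (j : Fin l → ℕ) (A B : Finset (Fin l)) : Finset (Fin l) :=
  rightNbrs j A B ∪ leftNbrs j A B

/-! ### Parameters of double cosets -/

/-- A triplet `(I_e, I, I_f)` of sets of indices. -/
@[ext] structure Triplet (l : ℕ) where
  /-- the set `I_e` -/
  Ie : Finset (Fin l)
  /-- the set `I` -/
  I : Finset (Fin l)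
  /-- the set `I_f` -/
  If : Finset (Fin l)

/-- The set `𝒯` of the triplets with `I_f ⊆ I_e` and `I ⊆ N_{I_f}^{I_e}`. -/
def triplets {l : ℕ} (j : Fin l → ℕ) : Set (Triplet l) :=
  {Q | Q.If ⊆ Q.Ie ∧ Q.I ⊆ nbrs j Q.If Q.Ie}

/-- The product, in increasing order, of the doubles of the simple reflections of the letters
`k` with `a < k < b`. -/
def doubleAscending (n a b : ℕ) : Equiv.Perm (Fin (n * 2)) :=
  ((List.range' (a + 1) (b - (a + 1))).map fun k => double (simpleRefl n k)).prod

/-- The product of the same factors in decreasing order. -/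
def doubleDescending (n a b : ℕ) : Equiv.Perm (Fin (n * 2)) :=
  ((List.range' (a + 1) (b - (a + 1))).reverse.map fun k => double (simpleRefl n k)).prod

open Classical in
/-- The map `p`. With `I_f = {i : double s_{j i} ≤ u}`, its middle component consists of the right
and of the left neighbors `i` of `I_f` (in the set of all indices) that satisfy a Bruhat
inequality attached to `i` and `i' = ν_{I_f}(i)`. -/
def cosetParam (n : ℕ) {l : ℕ} (j : Fin l → ℕ) (u : Equiv.Perm (Fin (n * 2))) : Triplet l :=
  let F : Finset (Fin l) := Finset.univ.filter fun i => BruhatLE (double (simpleRefl n (j i))) u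
  { Ie := Finset.univ.filter fun i => BruhatLE (simpleRefl (n * 2) (2 * j i + 1)) u
    I := (Finset.univ.filter fun i => ∃ i', IsRightNeighbor j F Finset.univ i i' ∧
          BruhatLE (simpleRefl (n * 2) (2 * j i + 1) * simpleRefl (n * 2) (2 * j i + 2) *
            doubleAscending n (j i) (j i') * simpleRefl (n * 2) (2 * j i' + 1)) u) ∪
        (Finset.univ.filter fun i => ∃ i', IsLeftNeighbor j F Finset.univ i i' ∧
          BruhatLE (simpleRefl (n * 2) (2 * j i' + 1) * doubleDescending n (j i) (j i') *
            simpleRefl (n * 2) (2 * j i + 2) * simpleRefl (n * 2) (2 * j i + 1)) u)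
    If := F }

/-- The `i`-th factor of the word `ω_Q`. -/
def omegaFactor {l : ℕ} (j : Fin l → ℕ) (Q : Triplet l) (i : Fin l) : List ℕ :=
  if i ∉ Q.Ie then []
  else if i ∈ Q.If then List.ofFn (doubleLetter (j i))
  else if i ∈ Q.I ∩ rightNbrs j Q.If Finset.univ then [2 * j i + 1, 2 * j i + 2]
  else if i ∈ Q.I ∩ leftNbrs j Q.If Finset.univ then [2 * j i + 2, 2 * j i + 1]
  else [2 * j i + 1]

/-- The representative `q(Q) = π(ω_Q)`. -/
def cosetRep (n : ℕ) {l : ℕ} (j : Fin l → ℕ) (Q : Triplet l) : Equiv.Perm (Fin (n * 2)) :=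
  wordProd (n * 2) (List.ofFn (omegaFactor j Q)).flatten

open Classical in
/-- The double coset `H q(Q) H`. -/
def cosetOf (n : ℕ) {l : ℕ} (j : Fin l → ℕ) (Q : Triplet l) :
    Finset (Equiv.Perm (Fin (n * 2))) :=
  Finset.univ.filter fun u =>
    u ∈ DoubleCoset.doubleCoset (cosetRep n j Q) (blockSubgroup n) (blockSubgroup n)

open Classical in
/-- The masks `x` of the doubled word with `p(π(x)) = Q`. -/
def masksOver (n : ℕ) {l : ℕ} (j : Fin l → ℕ) (Q : Triplet l) :
    Finset (Fin (l * 4) → Bool) :=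
  Finset.univ.filter fun x => cosetParam n j (maskProd (n * 2) (doubleWord j) x) = Q

end

end BooleanWord

open BooleanWord

/-! The letters of a reduced word of a Boolean permutation are distinct (`IsReducedWord.injective`),
and a mask of the doubled word is a family of masks of blocks of four letters. The block of the
letter `k` acts on the points `2k, …, 2k+3`, that is, on the consecutive pairs `k` and `k+1`. No
other block moves a point across the cut `2k+2`. So when the block of `k` is reached, the values on
the pair `k` are all smaller than those on the pair `k+1`, and the relative order of the four values
is known from two bits: whether each pair has a descent. The defects of the block and the new bits
are functions of its mask and of these two bits, and the sum over all masks is a composition of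
transfer operators, one for each letter (`transferWord_eq_sum`, `defect_doubleWord`).

The condition `p = Q` is local too. By the rank criterion, restricted to descents
(`bruhatLE_of_descents`), each Bruhat inequality in `p` says that enough points cross certain even
cuts. Hence `I_e` and `I_f` prescribe whether a block moves 0, 1 or 2 points across its cut. For a
link between neighbors, membership in `I` says, at the letter of the link that occurs last, whether
the smallest of the four values moves right (right link) or the largest moves left (left link). This
is `goodRun_iff_hasParam` with `cosetParam_eq_iff`.

The transfer operators are evaluated by increasing letters, not by positions: operators of
nonadjacent letters commute, so only the relative order of `M-1` and `M` matters. Summed with signs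
over the sixteen masks, a block gives `q` if no point crosses, `1` if two cross, and `-(q+1)` if one
crosses. For a linked letter the last factor splits into `-1` and `-q`, according to membership in
`I`. The delicate case is a chain of letters occurring in increasing order: the factor of its first
letter is unknown until the chain ends. Meanwhile the partial sum has the shape `-A (q [no descent]
+ [descent])`, which is preserved by letters of class two, and for which the conditions from the
right and from the left become independent (`localSum_low_high`). The induction is `sumBelow_eval`,
the result `transferWord_constraint`; multiplying the factors gives the formula.

It remains to identify the fibre of `p` over `Q`, among products of masks, with the products in `H
q(Q) H`. Multiplication by `H` does not affect crossings of even cuts, so `p` is constant on double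
cosets. Conversely, the constraints determine from which pairs the two values on each pair come
(`labels_eq`), and this determines the double coset (`mem_doubleCoset_of_labels`). The word of
`q(Q)` is itself given by a mask that satisfies the constraints (`goodRun_canonicalMask`). -/

namespace BooleanWord

/-! ### The rank criterion for the Bruhat order -/

/-- The number of points `p < a` with `u p < b`. -/
def lowCount {N : ℕ} (u : Equiv.Perm (Fin N)) (a b : ℕ) : ℕ :=
  ∑ p : Fin N, if p.val < a ∧ (u p).val < b then 1 else 0

theorem lowCount_mul_swap {N : ℕ} (u : Equiv.Perm (Fin N)) {a b : Fin N} (hab : a < b)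
    (hu : u a < u b) (x y : ℕ) :
    lowCount (u * Equiv.swap a b) x y +
      (if (a.val < x ∧ x ≤ b.val) ∧ (u a).val < y ∧ y ≤ (u b).val then 1 else 0) =
    lowCount u x y := by
  classical
  unfold lowCount
  have hba : b ∈ (Finset.univ.erase a : Finset (Fin N)) := by simp [hab.ne']
  rw [← Finset.add_sum_erase _ _ (Finset.mem_univ a), ← Finset.add_sum_erase _ _ hba,
    ← Finset.add_sum_erase (Finset.univ) (fun p : Fin N => if p.val < x ∧ (u p).val < y then 1 else 0)
      (Finset.mem_univ a), ← Finset.add_sum_erase (Finset.univ.erase a)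
      (fun p : Fin N => if p.val < x ∧ (u p).val < y then 1 else 0) hba]
  have hrest : ∑ p ∈ (Finset.univ.erase a).erase b,
      (if p.val < x ∧ ((u * Equiv.swap a b) p).val < y then 1 else 0) =
      ∑ p ∈ (Finset.univ.erase a).erase b, (if p.val < x ∧ (u p).val < y then 1 else 0) := by
    refine Finset.sum_congr rfl fun p hp => ?_
    simp only [Finset.mem_erase, Finset.mem_univ, and_true] at hp
    rw [Equiv.Perm.mul_apply, Equiv.swap_apply_of_ne_of_ne hp.2 hp.1]
  rw [hrest]
  simp only [Equiv.Perm.mul_apply, Equiv.swap_apply_left, Equiv.swap_apply_right]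
  have h1 : a.val < b.val := hab
  have h2 : (u a).val < (u b).val := hu
  split_ifs <;> omega

theorem lowCount_anti_of_bruhatLE {N : ℕ} {u v : Equiv.Perm (Fin N)} (h : BruhatLE u v)
    (x y : ℕ) : lowCount v x y ≤ lowCount u x y := by
  induction h with
  | refl => exact le_rfl
  | tail _ hs ih =>
    obtain ⟨a, b, hab, hu, rfl⟩ := hs
    have := lowCount_mul_swap _ hab hu x y
    omega

/-- Induction on the sum of all counts of `v`. At the first position `a` where `v` and `u` differ,
the hypothesis forces `v a < u a`. If `b` is the first later position whose value lies in `(v a, u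
a]`, exchanging `a` and `b` is a step upwards that keeps the hypothesis. -/
theorem bruhatLE_of_lowCount_le {N : ℕ} {u v : Equiv.Perm (Fin N)}
    (h : ∀ x y, lowCount u x y ≤ lowCount v x y) : BruhatLE v u := by
  classical
  obtain ⟨s, hs⟩ : ∃ s, s = ∑ x ∈ Finset.range (N + 1), ∑ y ∈ Finset.range (N + 1),
    lowCount v x y := ⟨_, rfl⟩
  induction s using Nat.strong_induction_on generalizing v with
  | _ s ih =>
  by_cases huv : v = u
  · rw [huv]; exact Relation.ReflTransGen.refl
  obtain ⟨a, ha, hmin⟩ : ∃ a, v a ≠ u a ∧ ∀ p < a, v p = u p := by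
    have hne : ((Finset.univ : Finset (Fin N)).filter fun p => v p ≠ u p).Nonempty := by
      by_contra hc
      rw [Finset.not_nonempty_iff_eq_empty, Finset.filter_eq_empty_iff] at hc
      exact huv (Equiv.ext fun p => by simpa using hc (Finset.mem_univ p))
    refine ⟨_, (Finset.mem_filter.1 (Finset.min'_mem _ hne)).2, fun p hp => ?_⟩
    by_contra hc
    exact absurd (Finset.min'_le _ p (Finset.mem_filter.2 ⟨Finset.mem_univ _, hc⟩)) (not_le.2 hp)
  have key : ∀ (w : Equiv.Perm (Fin N)) (x y y' : ℕ), y ≤ y' → lowCount w x y' = lowCount w x y +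
      ∑ p : Fin N, if p.val < x ∧ y ≤ (w p).val ∧ (w p).val < y' then 1 else 0 := by
    intro w x y y' hy
    unfold lowCount
    rw [← Finset.sum_add_distrib]
    refine Finset.sum_congr rfl fun p _ => ?_
    split_ifs <;> omega
  have hva : v a < u a := by
    by_contra hc
    have hlt : u a < v a := lt_of_le_of_ne (not_lt.1 hc) (Ne.symm ha)
    refine absurd (h (a + 1) (u a + 1)) (not_le.2 ?_)
    unfold lowCount
    refine Finset.sum_lt_sum (fun p _ => ?_) ⟨a, Finset.mem_univ _, ?_⟩
    · rcases lt_trichotomy p a with hp | hp | hp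
      · rw [hmin p hp]
      · subst hp
        have : (u p).val < (v p).val := hlt
        split_ifs <;> omega
      · have : a.val < p.val := hp
        split_ifs <;> omega
    · have : (u a).val < (v a).val := hlt
      split_ifs <;> omega
  obtain ⟨b, ⟨hab, hvb, hbu⟩, hbmin⟩ : ∃ b, (a < b ∧ v a < v b ∧ v b ≤ u a) ∧
      ∀ p < b, ¬ (a < p ∧ v a < v p ∧ v p ≤ u a) := by
    have hne : ((Finset.univ : Finset (Fin N)).filter
        fun p => a < p ∧ v a < v p ∧ v p ≤ u a).Nonempty := by
      refine ⟨v.symm (u a), Finset.mem_filter.2 ⟨Finset.mem_univ _, ?_⟩⟩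
      rw [Equiv.apply_symm_apply]
      refine ⟨?_, hva, le_rfl⟩
      rcases lt_trichotomy (v.symm (u a)) a with hp | hp | hp
      · have h1 := hmin _ hp
        rw [Equiv.apply_symm_apply] at h1
        exact absurd (u.injective h1) hp.ne'
      · rw [Equiv.symm_apply_eq] at hp
        exact absurd hp.symm ha
      · exact hp
    refine ⟨_, (Finset.mem_filter.1 (Finset.min'_mem _ hne)).2, fun p hp hc => ?_⟩
    exact absurd (Finset.min'_le _ p (Finset.mem_filter.2 ⟨Finset.mem_univ _, hc⟩)) (not_le.2 hp)
  have hab' : a.val < b.val := hab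
  have hva' : (v a).val < (u a).val := hva
  have hvb' : (v a).val < (v b).val := hvb
  have hbu' : (v b).val ≤ (u a).val := hbu
  -- The count drops only for `a < x ≤ b` and `v a < y ≤ v b`, where a strict inequality is needed.
  -- It comes from the hypothesis at height `u a + 1`: before `x`, only positions preceding `a` have
  -- `v`-values in `[y, u a]`, and there `u` agrees with `v`, while `u` has the further value `u a`.
  have hdom : ∀ x y, lowCount u x y ≤ lowCount (v * Equiv.swap a b) x y := by
    intro x y
    have h1 := lowCount_mul_swap v hab hvb x y
    have h2 := h x y
    split_ifs at h1 with hc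
    swap
    · omega
    obtain ⟨⟨hx1, hx2⟩, hy1, hy2⟩ := hc
    have hy : y ≤ (u a).val + 1 := by omega
    have h3 := h x ((u a).val + 1)
    rw [key u x y _ hy, key v x y _ hy] at h3
    have h4 : ∑ p : Fin N, (if p.val < x ∧ y ≤ (v p).val ∧ (v p).val < (u a).val + 1 then 1 else 0) <
        ∑ p : Fin N, (if p.val < x ∧ y ≤ (u p).val ∧ (u p).val < (u a).val + 1 then 1 else 0) := by
      refine Finset.sum_lt_sum (fun p _ => ?_) ⟨a, Finset.mem_univ _, ?_⟩
      · rcases lt_trichotomy p a with hp | hp | hp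
        · rw [hmin p hp]
        · subst hp
          split_ifs <;> omega
        · have hp' : a.val < p.val := hp
          by_cases hpx : p.val < x
          · have := hbmin p (show p.val < b.val by omega)
            rw [if_neg]
            · exact Nat.zero_le _
            · rintro ⟨-, h5, h6⟩
              exact this ⟨hp, show (v a).val < (v p).val by omega,
                show (v p).val ≤ (u a).val by omega⟩
          · rw [if_neg fun hh => hpx hh.1]
            exact Nat.zero_le _
      · rw [if_neg (by omega), if_pos (by omega)]
        exact Nat.zero_lt_one
    omega
  refine Relation.ReflTransGen.head ⟨a, b, hab, hvb, rfl⟩ (ih _ ?_ hdom rfl)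
  rw [hs]
  have hle : ∀ x y, lowCount (v * Equiv.swap a b) x y ≤ lowCount v x y := fun x y => by
    have := lowCount_mul_swap v hab hvb x y
    omega
  refine Finset.sum_lt_sum (fun x _ => Finset.sum_le_sum fun y _ => hle x y)
    ⟨a.val + 1, Finset.mem_range.2 (by omega), ?_⟩
  refine Finset.sum_lt_sum (fun y _ => hle _ y)
    ⟨(v a).val + 1, Finset.mem_range.2 (by omega), ?_⟩
  have := lowCount_mul_swap v hab hvb (a.val + 1) ((v a).val + 1)
  rw [if_pos (by omega)] at this
  omega

/-! ### Reduction of the rank criterion to descents, and crossing counts -/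

theorem lowCount_succ {N : ℕ} (u : Equiv.Perm (Fin N)) {a : ℕ} (ha : a < N) (b : ℕ) :
    lowCount u (a + 1) b = lowCount u a b + if (u ⟨a, ha⟩).val < b then 1 else 0 := by
  unfold lowCount
  rw [← Finset.add_sum_erase _ _ (Finset.mem_univ (⟨a, ha⟩ : Fin N)),
    ← Finset.add_sum_erase Finset.univ (fun p : Fin N => if p.val < a ∧ (u p).val < b then 1 else 0)
      (Finset.mem_univ (⟨a, ha⟩ : Fin N))]
  have : ∑ p ∈ Finset.univ.erase (⟨a, ha⟩ : Fin N),
      (if p.val < a + 1 ∧ (u p).val < b then 1 else 0) =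
      ∑ p ∈ Finset.univ.erase (⟨a, ha⟩ : Fin N), (if p.val < a ∧ (u p).val < b then 1 else 0) := by
    refine Finset.sum_congr rfl fun p hp => ?_
    have h1 : p.val ≠ a := fun h => (Finset.mem_erase.1 hp).1 (Fin.ext h)
    split_ifs <;> omega
  rw [this]
  dsimp only
  split_ifs <;> omega

theorem lowCount_zero {N : ℕ} (u : Equiv.Perm (Fin N)) (b : ℕ) : lowCount u 0 b = 0 := by
  simp [lowCount]

theorem lowCount_inv {N : ℕ} (u : Equiv.Perm (Fin N)) (a b : ℕ) :
    lowCount u⁻¹ b a = lowCount u a b := by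
  unfold lowCount
  rw [← Equiv.sum_comp u]
  refine Finset.sum_congr rfl fun p _ => ?_
  rw [Equiv.Perm.inv_def, Equiv.symm_apply_apply]
  simp only [and_comm]

theorem lowCount_of_le {N : ℕ} (u v : Equiv.Perm (Fin N)) {a : ℕ} (ha : N ≤ a) (b : ℕ) :
    lowCount u a b = lowCount v a b := by
  have h : ∀ w : Equiv.Perm (Fin N), lowCount w a b = ∑ p : Fin N, if p.val < b then 1 else 0 := by
    intro w
    unfold lowCount
    rw [← Equiv.sum_comp w fun p : Fin N => if p.val < b then 1 else 0]
    refine Finset.sum_congr rfl fun p _ => ?_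
    have := p.isLt
    split_ifs <;> omega
  rw [h, h]

/-- If `v a < b`, walk left while `v` ascends: each step removes one from the count of `v` and at
most one from that of `u`. If `v a ≥ b`, walk right while `v` ascends: the count of `v` stays and
that of `u` can only grow. Both walks stop at a descent or at an end, where the inequality is known.
-/
theorem lowCount_le_of_descents {N : ℕ} {u v : Equiv.Perm (Fin N)} (b : ℕ)
    (h : ∀ p q : Fin N, q.val = p.val + 1 → v q < v p → lowCount u q b ≤ lowCount v q b) (a : ℕ) :
    lowCount u a b ≤ lowCount v a b := by
  have hdown : ∀ a (ha : a < N), (v ⟨a, ha⟩).val < b → lowCount u a b ≤ lowCount v a b := by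
    intro a
    induction a with
    | zero => intro _ _; rw [lowCount_zero, lowCount_zero]
    | succ a ih =>
      intro ha hb
      have ha' : a < N := by omega
      by_cases hd : v ⟨a + 1, ha⟩ < v ⟨a, ha'⟩
      · exact h ⟨a, ha'⟩ ⟨a + 1, ha⟩ rfl hd
      · have hd' : (v ⟨a, ha'⟩).val ≤ (v ⟨a + 1, ha⟩).val := not_lt.1 hd
        have := ih ha' (by omega)
        rw [lowCount_succ u ha', lowCount_succ v ha', if_pos (show (v ⟨a, ha'⟩).val < b by omega)]
        split_ifs <;> omega
  have hup : ∀ d a (ha : a < N), N - a = d → b ≤ (v ⟨a, ha⟩).val →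
      lowCount u a b ≤ lowCount v a b := by
    intro d
    induction d with
    | zero => intro a ha hd; omega
    | succ d ih =>
      intro a ha hd hb
      have h1 := lowCount_succ u ha b
      have h2 := lowCount_succ v ha b
      rw [if_neg (by omega)] at h2
      have h3 : lowCount u (a + 1) b ≤ lowCount v (a + 1) b := by
        by_cases ha' : a + 1 < N
        · by_cases hd : v ⟨a + 1, ha'⟩ < v ⟨a, ha⟩
          · exact h ⟨a, ha⟩ ⟨a + 1, ha'⟩ rfl hd
          · have hd' : (v ⟨a, ha⟩).val ≤ (v ⟨a + 1, ha'⟩).val := not_lt.1 hd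
            exact ih _ ha' (by omega) (by omega)
        · exact (lowCount_of_le u v (by omega) b).le
      omega
  by_cases ha : a < N
  · by_cases hb : (v ⟨a, ha⟩).val < b
    · exact hdown a ha hb
    · exact hup _ a ha rfl (by omega)
  · exact (lowCount_of_le u v (by omega) b).le

/-- The number of points `p ≥ a` with `u p < b`. -/
def crossCount {N : ℕ} (u : Equiv.Perm (Fin N)) (a b : ℕ) : ℕ :=
  ∑ p : Fin N, if a ≤ p.val ∧ (u p).val < b then 1 else 0

theorem lowCount_add_crossCount {N : ℕ} (u : Equiv.Perm (Fin N)) (a b : ℕ) :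
    lowCount u a b + crossCount u a b = ∑ p : Fin N, if p.val < b then 1 else 0 := by
  unfold lowCount crossCount
  rw [← Finset.sum_add_distrib, ← Equiv.sum_comp u fun p : Fin N => if p.val < b then 1 else 0]
  refine Finset.sum_congr rfl fun p _ => ?_
  split_ifs <;> omega

theorem crossCount_le_of_bruhatLE {N : ℕ} {u v : Equiv.Perm (Fin N)} (h : BruhatLE v u)
    (a b : ℕ) : crossCount v a b ≤ crossCount u a b := by
  have h1 := lowCount_anti_of_bruhatLE h a b
  have h2 := lowCount_add_crossCount u a b
  have h3 := lowCount_add_crossCount v a b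
  omega

/-- For `v ≤ u` it is enough to compare the counts at the descents of `v` and of `v⁻¹`. -/
theorem bruhatLE_of_descents {N : ℕ} {u v : Equiv.Perm (Fin N)}
    (h : ∀ p q r s : Fin N, q.val = p.val + 1 → v q < v p → (v r).val = (v s).val + 1 → r < s →
      crossCount v q (v r) ≤ crossCount u q (v r)) : BruhatLE v u := by
  refine bruhatLE_of_lowCount_le fun x y => ?_
  -- The bound on the values is moved to a descent first, by passing to the inverses; the bound on
  -- the positions follows.
  rw [← lowCount_inv u, ← lowCount_inv v]
  refine lowCount_le_of_descents x (fun s r hrs hd => ?_) y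
  rw [lowCount_inv, lowCount_inv]
  refine lowCount_le_of_descents _ (fun p q hpq hd' => ?_) x
  have h1 := h p q (v⁻¹ r) (v⁻¹ s) hpq hd' (by simpa using hrs) hd
  have h2 := lowCount_add_crossCount u q r
  have h3 := lowCount_add_crossCount v q r
  rw [Equiv.Perm.inv_def, Equiv.apply_symm_apply] at h1
  omega

theorem one_le_crossCount {N : ℕ} {u : Equiv.Perm (Fin N)} {a b : ℕ} :
    1 ≤ crossCount u a b ↔ ∃ p : Fin N, a ≤ p.val ∧ (u p).val < b := by
  rw [Nat.one_le_iff_ne_zero, Ne, crossCount, Finset.sum_eq_zero_iff]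
  simp

theorem two_le_crossCount {N : ℕ} {u : Equiv.Perm (Fin N)} {a b : ℕ} :
    2 ≤ crossCount u a b ↔ ∃ p q : Fin N, p < q ∧ a ≤ p.val ∧ (u p).val < b ∧ (u q).val < b := by
  rw [crossCount, ← Finset.card_filter]
  rw [← Nat.lt_iff_add_one_le, Finset.one_lt_card]
  constructor
  · rintro ⟨p, hp, q, hq, hpq⟩
    simp only [Finset.mem_filter, Finset.mem_univ, true_and] at hp hq
    rcases lt_or_gt_of_ne hpq with h | h
    · exact ⟨p, q, h, hp.1, hp.2, hq.2⟩
    · exact ⟨q, p, h, hq.1, hq.2, hp.2⟩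
  · rintro ⟨p, q, hpq, h1, h2, h3⟩
    have : p.val < q.val := hpq
    exact ⟨p, by simp [h1, h2], q, by simp only [Finset.mem_filter, Finset.mem_univ, true_and]; omega, hpq.ne⟩

theorem crossCount_le_one {N : ℕ} {u : Equiv.Perm (Fin N)} {a b : ℕ} (p₀ : ℕ)
    (h : ∀ p : Fin N, a ≤ p.val → (u p).val < b → p.val = p₀) : crossCount u a b ≤ 1 := by
  by_contra hc
  obtain ⟨p, q, hpq, h1, h2, h3⟩ := two_le_crossCount.1 (show 2 ≤ crossCount u a b by omega)
  have h4 : p.val < q.val := hpq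
  have := h p h1 h2
  have := h q (by omega) h3
  omega

theorem crossCount_le_two {N : ℕ} {u : Equiv.Perm (Fin N)} {a b : ℕ} (p₀ q₀ : ℕ)
    (h : ∀ p : Fin N, a ≤ p.val → (u p).val < b → p.val = p₀ ∨ p.val = q₀) :
    crossCount u a b ≤ 2 := by
  rw [crossCount, ← Finset.card_filter]
  rw [← Finset.card_map Fin.valEmbedding]
  refine (Finset.card_le_card (t := {p₀, q₀}) fun x hx => ?_).trans Finset.card_le_two
  simp only [Finset.mem_map, Finset.mem_filter, Finset.mem_univ, true_and] at hx
  obtain ⟨p, hp, rfl⟩ := hx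
  simpa using h p hp.1 hp.2

/-! ### The elements that bound a permutation from below -/

theorem simpleRefl_val {N k : ℕ} (hk : k + 1 < N) (p : Fin N) :
    (simpleRefl N k p).val = if p.val = k then k + 1 else if p.val = k + 1 then k else p.val := by
  rw [simpleRefl, dif_pos hk, Equiv.swap_apply_def]
  simp only [Fin.ext_iff]
  split_ifs <;> rfl

theorem double_val {n : ℕ} (w : Equiv.Perm (Fin n)) (p : Fin (n * 2)) :
    (double w p).val = p.val % 2 + 2 * (w ⟨p.val / 2, by omega⟩).val := rfl

theorem double_simpleRefl_val {n k : ℕ} (hk : k + 1 < n) (p : Fin (n * 2)) :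
    (double (simpleRefl n k) p).val =
      if 2 * k ≤ p.val ∧ p.val < 2 * k + 2 then p.val + 2
      else if 2 * k + 2 ≤ p.val ∧ p.val < 2 * k + 4 then p.val - 2 else p.val := by
  rw [double_val, simpleRefl_val hk]
  dsimp only
  split_ifs <;> omega

theorem doubleAscending_val {n a b : ℕ} (hab : a < b) (hb : b < n) (p : Fin (n * 2)) :
    (doubleAscending n a b p).val =
      if 2 * a + 2 ≤ p.val ∧ p.val < 2 * b then p.val + 2
      else if 2 * b ≤ p.val ∧ p.val < 2 * b + 2 then p.val - 2 * (b - (a + 1)) else p.val := by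
  obtain ⟨d, rfl⟩ := Nat.exists_eq_add_of_lt hab
  induction d generalizing p with
  | zero =>
    have : doubleAscending n a (a + 0 + 1) = 1 := by simp [doubleAscending]
    rw [this]
    dsimp only [Equiv.Perm.one_apply]
    split_ifs <;> omega
  | succ d ih =>
    have : doubleAscending n a (a + (d + 1) + 1) =
        doubleAscending n a (a + d + 1) * double (simpleRefl n (a + d + 1)) := by
      unfold doubleAscending
      rw [show a + (d + 1) + 1 - (a + 1) = d + 1 by omega, show a + d + 1 - (a + 1) = d by omega,
        List.range'_concat, List.map_append, List.prod_append]
      simp [show a + 1 + d = a + d + 1 by omega]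
    rw [this, Equiv.Perm.mul_apply, ih _ (by omega) (by omega), double_simpleRefl_val (by omega)]
    split_ifs <;> omega

/-- The element attached to a right neighbor. -/
abbrev ascendingChain (n k m : ℕ) : Equiv.Perm (Fin (n * 2)) :=
  simpleRefl (n * 2) (2 * k + 1) * simpleRefl (n * 2) (2 * k + 2) *
    doubleAscending n k m * simpleRefl (n * 2) (2 * m + 1)

theorem ascendingChain_val {n k m : ℕ} (hkm : k < m) (hm : m + 1 < n) (p : Fin (n * 2)) :
    (ascendingChain n k m p).val =
      if p.val = 2 * k + 1 then 2 * k + 2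
      else if 2 * k + 2 ≤ p.val ∧ p.val < 2 * m then p.val + 2
      else if p.val = 2 * m then 2 * k + 3
      else if p.val = 2 * m + 1 then 2 * m + 2
      else if p.val = 2 * m + 2 then 2 * k + 1 else p.val := by
  have h1 : ∀ q : Fin (n * 2), ((simpleRefl (n * 2) (2 * k + 1) *
      simpleRefl (n * 2) (2 * k + 2)) q).val = if q.val = 2 * k + 1 then 2 * k + 2
        else if q.val = 2 * k + 2 then 2 * k + 3 else if q.val = 2 * k + 3 then 2 * k + 1
        else q.val := fun q => by
    rw [Equiv.Perm.mul_apply, simpleRefl_val (by omega), simpleRefl_val (by omega)]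
    split_ifs <;> omega
  have h2 : ((doubleAscending n k m * simpleRefl (n * 2) (2 * m + 1)) p).val =
      if 2 * k + 2 ≤ p.val ∧ p.val < 2 * m then p.val + 2 else if p.val = 2 * m then 2 * k + 2
        else if p.val = 2 * m + 1 then 2 * m + 2 else if p.val = 2 * m + 2 then 2 * k + 3
        else p.val := by
    rw [Equiv.Perm.mul_apply, doubleAscending_val hkm (by omega), simpleRefl_val (by omega)]
    split_ifs <;> omega
  rw [ascendingChain, mul_assoc (_ * _), Equiv.Perm.mul_apply, h1, h2]
  split_ifs <;> omega

/-- The chain descends only into the positions `2m+2` and, if `k+1 < m`, `2m`; its inverse only into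
`2k+2` and, if `k+1 < m`, `2k+4`. Of the four corners the two mixed ones require a single crossing,
which the corner `(2m+2, 2k+2)` already provides. -/
theorem ascendingChain_bruhatLE_iff {n k m : ℕ} (hkm : k < m) (hm : m + 1 < n)
    (u : Equiv.Perm (Fin (n * 2))) :
    BruhatLE (ascendingChain n k m) u ↔ 1 ≤ crossCount u (2 * m + 2) (2 * k + 2) ∧
      (k + 1 < m → 2 ≤ crossCount u (2 * m) (2 * k + 4)) := by
  have hv := ascendingChain_val (n := n) hkm hm
  constructor
  · intro h
    refine ⟨le_trans ?_ (crossCount_le_of_bruhatLE h _ _), fun hk =>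
      le_trans ?_ (crossCount_le_of_bruhatLE h _ _)⟩
    · refine one_le_crossCount.2 ⟨⟨2 * m + 2, by omega⟩, le_rfl, ?_⟩
      rw [hv]
      dsimp only
      split_ifs <;> omega
    · refine two_le_crossCount.2 ⟨⟨2 * m, by omega⟩, ⟨2 * m + 2, by omega⟩, ?_, le_rfl, ?_, ?_⟩
      · exact Nat.lt_add_of_pos_right two_pos
      · rw [hv]
        dsimp only
        split_ifs <;> omega
      · rw [hv]
        dsimp only
        split_ifs <;> omega
  · rintro ⟨h1, h2⟩
    refine bruhatLE_of_descents fun p q r s hpq hd hrs hlt => ?_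
    have hq := hv q
    have hp := hv p
    have hr := hv r
    have hs := hv s
    have hd' : (ascendingChain n k m q).val < (ascendingChain n k m p).val := hd
    have hlt' : r.val < s.val := hlt
    have hqm : q.val = 2 * m ∧ k + 1 < m ∨ q.val = 2 * m + 2 := by
      split_ifs at hp hq <;> omega
    have hrm : (ascendingChain n k m r).val = 2 * k + 4 ∧ k + 1 < m ∨
        (ascendingChain n k m r).val = 2 * k + 2 := by
      split_ifs at hr hs <;> omega
    have hmono : ∀ a b, a ≤ 2 * m + 2 → 2 * k + 2 ≤ b → 1 ≤ crossCount u a b := by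
      intro a b ha hb
      obtain ⟨p, hp1, hp2⟩ := one_le_crossCount.1 h1
      exact one_le_crossCount.2 ⟨p, by omega, by omega⟩
    rcases hqm with ⟨hq', hk⟩ | hq' <;> rcases hrm with ⟨hr', -⟩ | hr' <;> rw [hq', hr']
    · refine le_trans (crossCount_le_two (2 * m) (2 * m + 2) fun x h3 h4 => ?_) (h2 hk)
      rw [hv] at h4
      split_ifs at h4 <;> omega
    · refine le_trans (crossCount_le_one (2 * m + 2) fun x h3 h4 => ?_) (hmono _ _ (by omega) le_rfl)
      rw [hv] at h4
      split_ifs at h4 <;> omega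
    · refine le_trans (crossCount_le_one (2 * m + 2) fun x h3 h4 => ?_) (hmono _ _ le_rfl (by omega))
      rw [hv] at h4
      split_ifs at h4 <;> omega
    · refine le_trans (crossCount_le_one (2 * m + 2) fun x h3 h4 => ?_) (hmono _ _ le_rfl le_rfl)
      rw [hv] at h4
      split_ifs at h4 <;> omega

/-- The reflection and its inverse have one descent each, so a single corner decides. The double of
a reflection has the same corner, with count two. -/
theorem simpleRefl_bruhatLE_iff {n k : ℕ} (hk : k + 1 < n) (u : Equiv.Perm (Fin (n * 2))) :
    BruhatLE (simpleRefl (n * 2) (2 * k + 1)) u ↔ 1 ≤ crossCount u (2 * k + 2) (2 * k + 2) := by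
  have hv := simpleRefl_val (N := n * 2) (k := 2 * k + 1) (by omega)
  constructor
  · intro h
    refine le_trans ?_ (crossCount_le_of_bruhatLE h _ _)
    refine one_le_crossCount.2 ⟨⟨2 * k + 2, by omega⟩, le_rfl, ?_⟩
    rw [hv]
    dsimp only
    split_ifs <;> omega
  · intro h1
    refine bruhatLE_of_descents fun p q r s hpq hd hrs hlt => ?_
    have hq := hv q
    have hp := hv p
    have hr := hv r
    have hs := hv s
    have hd' : (simpleRefl (n * 2) (2 * k + 1) q).val < (simpleRefl (n * 2) (2 * k + 1) p).val := hd
    have hlt' : r.val < s.val := hlt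
    have hqm : q.val = 2 * k + 2 := by split_ifs at hp hq <;> omega
    have hrm : (simpleRefl (n * 2) (2 * k + 1) r).val = 2 * k + 2 := by
      split_ifs at hr hs <;> omega
    rw [hqm, hrm]
    refine le_trans (crossCount_le_one (2 * k + 2) fun x h3 h4 => ?_) h1
    rw [hv] at h4
    split_ifs at h4 <;> omega

theorem double_bruhatLE_iff {n k : ℕ} (hk : k + 1 < n) (u : Equiv.Perm (Fin (n * 2))) :
    BruhatLE (double (simpleRefl n k)) u ↔ 2 ≤ crossCount u (2 * k + 2) (2 * k + 2) := by
  have hv := double_simpleRefl_val hk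
  constructor
  · intro h
    refine le_trans ?_ (crossCount_le_of_bruhatLE h _ _)
    refine two_le_crossCount.2 ⟨⟨2 * k + 2, by omega⟩, ⟨2 * k + 3, by omega⟩, Nat.lt_succ_self _,
      le_rfl, ?_, ?_⟩
    all_goals
      rw [hv]
      dsimp only
      split_ifs <;> omega
  · intro h1
    refine bruhatLE_of_descents fun p q r s hpq hd hrs hlt => ?_
    have hq := hv q
    have hp := hv p
    have hr := hv r
    have hs := hv s
    have hd' : (double (simpleRefl n k) q).val < (double (simpleRefl n k) p).val := hd
    have hlt' : r.val < s.val := hlt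
    have hqm : q.val = 2 * k + 2 := by split_ifs at hp hq <;> omega
    have hrm : (double (simpleRefl n k) r).val = 2 * k + 2 := by
      split_ifs at hr hs <;> omega
    rw [hqm, hrm]
    refine le_trans (crossCount_le_two (2 * k + 2) (2 * k + 3) fun x h3 h4 => ?_) h1
    rw [hv] at h4
    split_ifs at h4 <;> omega

/-! ### Inversion -/

theorem bruhatLE_inv {N : ℕ} {u v : Equiv.Perm (Fin N)} (h : BruhatLE v u) :
    BruhatLE v⁻¹ u⁻¹ :=
  bruhatLE_of_lowCount_le fun x y => by
    rw [lowCount_inv, lowCount_inv]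
    exact lowCount_anti_of_bruhatLE h y x

theorem simpleRefl_inv (N k : ℕ) : (simpleRefl N k)⁻¹ = simpleRefl N k := by
  unfold simpleRefl
  split_ifs <;> simp

theorem double_mul {n : ℕ} (v w : Equiv.Perm (Fin n)) : double (v * w) = double v * double w := by
  ext p
  simp [double]

theorem double_simpleRefl_inv (n k : ℕ) :
    (double (simpleRefl n k))⁻¹ = double (simpleRefl n k) := by
  have h1 : double (1 : Equiv.Perm (Fin n)) = 1 := by ext p; simp [double, Nat.mod_add_div]
  rw [inv_eq_iff_mul_eq_one, ← double_mul, ← h1]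
  congr 1
  nth_rewrite 1 [← simpleRefl_inv]
  exact inv_mul_cancel _

theorem doubleDescending_eq_inv (n a b : ℕ) :
    doubleDescending n a b = (doubleAscending n a b)⁻¹ := by
  unfold doubleDescending doubleAscending
  rw [List.prod_inv_reverse, List.map_map, List.map_reverse]
  simp only [Function.comp_def, double_simpleRefl_inv]

/-- The element attached to a left neighbor. -/
abbrev descendingChain (n k m : ℕ) : Equiv.Perm (Fin (n * 2)) :=
  simpleRefl (n * 2) (2 * m + 1) * doubleDescending n k m *
    simpleRefl (n * 2) (2 * k + 2) * simpleRefl (n * 2) (2 * k + 1)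

theorem descendingChain_eq_inv (n k m : ℕ) :
    descendingChain n k m = (ascendingChain n k m)⁻¹ := by
  simp [descendingChain, ascendingChain, mul_inv_rev, simpleRefl_inv, doubleDescending_eq_inv,
    mul_assoc]

theorem descendingChain_bruhatLE_iff {n k m : ℕ} (hkm : k < m) (hm : m + 1 < n)
    (u : Equiv.Perm (Fin (n * 2))) :
    BruhatLE (descendingChain n k m) u ↔ 1 ≤ crossCount u⁻¹ (2 * m + 2) (2 * k + 2) ∧
      (k + 1 < m → 2 ≤ crossCount u⁻¹ (2 * m) (2 * k + 4)) := by
  rw [← ascendingChain_bruhatLE_iff hkm hm, descendingChain_eq_inv]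
  exact ⟨fun h => by simpa using bruhatLE_inv h, fun h => by simpa using bruhatLE_inv h⟩

/-! ### A single block of four letters -/

/-- A mask of the double of a simple reflection. -/
abbrev Mask := Fin 4 → Bool

/-- The product of the first `r` chosen letters of a block, on the four points of the block. -/
def localPerm (m : Mask) (r : ℕ) : Equiv.Perm (Fin 4) :=
  partialProd 4 (doubleLetter 0) m r

/-- Four values in the order in which they occur on two consecutive blocks, of which the first
is exchanged if `a`, the second if `b`. -/
def blockPattern (a b : Bool) : Fin 4 → ℕ :=
  ![if a then 1 else 0, if a then 0 else 1, if b then 3 else 2, if b then 2 else 3]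

/-- The number of defects at the four letters of a block. -/
def localDefect (m : Mask) (a b : Bool) : ℕ :=
  -- The two vectors list the upper and the lower points exchanged by the letters `1, 0, 2, 1`.
  ∑ r : Fin 4, if blockPattern a b (localPerm m r (![2, 1, 3, 2] r)) <
    blockPattern a b (localPerm m r (![1, 0, 2, 1] r)) then 1 else 0

/-- The number of points that a mask moves from the first block to the second. -/
def maskClass (m : Mask) : ℕ :=
  (if (localPerm m 4 2).val < 2 then 1 else 0) + if (localPerm m 4 3).val < 2 then 1 else 0

/-- Whether the first of the two blocks has a descent after the four letters. -/
def outLeft (m : Mask) (a b : Bool) : Bool :=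
  decide (blockPattern a b (localPerm m 4 1) < blockPattern a b (localPerm m 4 0))

/-- Whether the second of the two blocks has a descent after the four letters. -/
def outRight (m : Mask) (a b : Bool) : Bool :=
  decide (blockPattern a b (localPerm m 4 3) < blockPattern a b (localPerm m 4 2))

/-- Whether the smallest of the four values ends in the second block. -/
def lowMoves (m : Mask) (a b : Bool) : Bool :=
  decide (blockPattern a b (localPerm m 4 2) = 0 ∨ blockPattern a b (localPerm m 4 3) = 0)

/-- Whether the largest of the four values ends in the first block. -/
def highMoves (m : Mask) (a b : Bool) : Bool :=
  decide (blockPattern a b (localPerm m 4 0) = 3 ∨ blockPattern a b (localPerm m 4 1) = 3)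

/-- The signed generating function of the defects of the masks with a given property. -/
noncomputable def localSum (P : Mask → Prop) [DecidablePred P] (a b : Bool) : ℤ[X] :=
  ∑ m : Mask, if P m then Polynomial.C (maskSign m) * Polynomial.X ^ localDefect m a b else 0

/-! ### Signed sums over the sixteen masks of a block -/

theorem localDefect_le_two : ∀ m a b, localDefect m a b ≤ 2 := by decide +kernel

/-- With at most two defects, a polynomial identity amounts to three integer sums over sixteen
masks, which can be decided by evaluation. -/
theorem localSum_eq (P : Mask → Prop) [DecidablePred P] (a b : Bool) :
    localSum P a b =
      Polynomial.C (∑ m : Mask, if P m ∧ localDefect m a b = 0 then maskSign m else 0) +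
      Polynomial.C (∑ m : Mask, if P m ∧ localDefect m a b = 1 then maskSign m else 0) *
        Polynomial.X +
      Polynomial.C (∑ m : Mask, if P m ∧ localDefect m a b = 2 then maskSign m else 0) *
        Polynomial.X ^ 2 := by
  simp only [localSum, map_sum, Finset.sum_mul, ← Finset.sum_add_distrib]
  refine Finset.sum_congr rfl fun m _ => ?_
  have h := localDefect_le_two m a b
  by_cases hP : P m
  · interval_cases hd : localDefect m a b <;> simp [hP]
  · simp [hP]

theorem localSum_eq_of {P : Mask → Prop} [DecidablePred P] {a b : Bool} (c₀ c₁ c₂ : ℤ)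
    (h : (∑ m : Mask, if P m ∧ localDefect m a b = 0 then maskSign m else 0) = c₀ ∧
      (∑ m : Mask, if P m ∧ localDefect m a b = 1 then maskSign m else 0) = c₁ ∧
      (∑ m : Mask, if P m ∧ localDefect m a b = 2 then maskSign m else 0) = c₂) :
    localSum P a b =
      Polynomial.C c₀ + Polynomial.C c₁ * Polynomial.X + Polynomial.C c₂ * Polynomial.X ^ 2 := by
  rw [localSum_eq, h.1, h.2.1, h.2.2]

/-- The independence of the incoming descents, here and for classes one and two, is what lets the
contributions of the letters factor. -/
theorem localSum_zero (a b : Bool) : localSum (fun m => maskClass m = 0) a b = Polynomial.X := by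
  rw [localSum_eq_of 0 1 0 (by revert a b; decide +kernel)]
  simp

/-- The masks that leave a descent on the right cancel, so nothing is transmitted through a letter
of class zero. -/
theorem localSum_zero_right (a : Bool) :
    localSum (fun m => maskClass m = 0 ∧ outRight m a false = false) a false = Polynomial.X ∧
    localSum (fun m => maskClass m = 0 ∧ outRight m a false = true) a false = 0 := by
  rw [localSum_eq_of 0 1 0 (by revert a; decide +kernel),
    localSum_eq_of 0 0 0 (by revert a; decide +kernel)]
  simp

theorem localSum_two (a b : Bool) : localSum (fun m => maskClass m = 2) a b = 1 := by
  rw [localSum_eq_of 1 0 0 (by revert a b; decide +kernel)]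
  simp

/-- After cancellation a letter of class two hands the descent of its left block over to the right
block. -/
theorem localSum_two_right (a d : Bool) :
    localSum (fun m => maskClass m = 2 ∧ outRight m a false = d) a false =
      if a = d then 1 else 0 := by
  rw [localSum_eq_of (if a = d then 1 else 0) 0 0 (by revert a d; decide +kernel)]
  split_ifs <;> simp

theorem localSum_one (a b : Bool) :
    localSum (fun m => maskClass m = 1) a b = -(Polynomial.X + 1) := by
  rw [localSum_eq_of (-1) (-1) 0 (by revert a b; decide +kernel)]
  simp

/-- A letter of class one starts a chain: it produces the combination `-(q [no descent] +
[descent])`. -/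
theorem localSum_one_right (a : Bool) :
    localSum (fun m => maskClass m = 1 ∧ outRight m a false = false) a false = -Polynomial.X ∧
    localSum (fun m => maskClass m = 1 ∧ outRight m a false = true) a false = -1 := by
  rw [localSum_eq_of 0 (-1) 0 (by revert a; decide +kernel),
    localSum_eq_of (-1) 0 0 (by revert a; decide +kernel)]
  simp

/-- The weight of a link. -/
noncomputable def linkWeight (t : Bool) : ℤ[X] := if t then -1 else -Polynomial.X

theorem localSum_low (t a b : Bool) :
    localSum (fun m => maskClass m = 1 ∧ lowMoves m a b = t) a b = linkWeight t := by
  rw [localSum_eq_of (if t then -1 else 0) (if t then 0 else -1) 0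
    (by revert t a b; decide +kernel)]
  cases t <;> simp [linkWeight]

theorem localSum_high (t a b : Bool) :
    localSum (fun m => maskClass m = 1 ∧ highMoves m a b = t) a b = linkWeight t := by
  rw [localSum_eq_of (if t then -1 else 0) (if t then 0 else -1) 0
    (by revert t a b; decide +kernel)]
  cases t <;> simp [linkWeight]

/-- Neither incoming bit alone makes the two conditions independent. The combination `q [no descent]
+ [descent]`, which is the state of an open chain, does. -/
theorem localSum_low_high (s t b : Bool) :
    Polynomial.X * localSum (fun m => maskClass m = 1 ∧ lowMoves m false b = s ∧
        highMoves m false b = t) false b +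
      localSum (fun m => maskClass m = 1 ∧ lowMoves m true b = s ∧ highMoves m true b = t) true b =
    -(linkWeight t * linkWeight s) := by
  cases s <;> cases t <;> cases b
  · rw [localSum_eq_of 0 (-1) 0 (by decide +kernel), localSum_eq_of 0 0 0 (by decide +kernel)]
    simp [linkWeight]
  · rw [localSum_eq_of 0 0 0 (by decide +kernel), localSum_eq_of 0 0 (-1) (by decide +kernel)]
    simp [linkWeight]; ring
  · rw [localSum_eq_of 0 0 0 (by decide +kernel), localSum_eq_of 0 (-1) 0 (by decide +kernel)]
    simp [linkWeight]
  · rw [localSum_eq_of 0 (-1) 0 (by decide +kernel), localSum_eq_of 0 (-1) 1 (by decide +kernel)]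
    simp [linkWeight]; ring
  · rw [localSum_eq_of 0 0 0 (by decide +kernel), localSum_eq_of 0 (-1) 0 (by decide +kernel)]
    simp [linkWeight]
  · rw [localSum_eq_of 0 (-1) 0 (by decide +kernel), localSum_eq_of 0 (-1) 1 (by decide +kernel)]
    simp [linkWeight]; ring
  · rw [localSum_eq_of (-1) 0 0 (by decide +kernel), localSum_eq_of (-1) 1 0 (by decide +kernel)]
    simp [linkWeight]
  · rw [localSum_eq_of (-1) 1 0 (by decide +kernel), localSum_eq_of (-1) 1 (-1) (by decide +kernel)]
    simp [linkWeight]; ring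

/-- A letter that ends one chain and starts the next reproduces the combination `q [no descent] +
[descent]`, multiplied by the weight of the link just closed. -/
theorem localSum_low_right (s : Bool) :
    Polynomial.X * localSum (fun m => maskClass m = 1 ∧ lowMoves m false false = s ∧
        outRight m false false = false) false false +
      localSum (fun m => maskClass m = 1 ∧ lowMoves m true false = s ∧
        outRight m true false = false) true false = linkWeight s * Polynomial.X ∧
    Polynomial.X * localSum (fun m => maskClass m = 1 ∧ lowMoves m false false = s ∧
        outRight m false false = true) false false +
      localSum (fun m => maskClass m = 1 ∧ lowMoves m true false = s ∧
        outRight m true false = true) true false = linkWeight s := by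
  cases s
  · rw [localSum_eq_of 1 (-1) 0 (by decide +kernel), localSum_eq_of 0 (-1) 0 (by decide +kernel),
      localSum_eq_of (-1) 0 0 (by decide +kernel), localSum_eq_of 0 0 0 (by decide +kernel)]
    simp [linkWeight]; ring
  · rw [localSum_eq_of (-1) 0 0 (by decide +kernel), localSum_eq_of 0 0 0 (by decide +kernel),
      localSum_eq_of 0 0 0 (by decide +kernel), localSum_eq_of (-1) 0 0 (by decide +kernel)]
    simp [linkWeight]

theorem localSum_congr {P P' : Mask → Prop} [DecidablePred P] [DecidablePred P'] (a b : Bool)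
    (h : ∀ m, P m ↔ P' m) : localSum P a b = localSum P' a b := by
  unfold localSum
  exact Finset.sum_congr rfl fun m _ => by simp only [h m]

/-! ### Transfer operators -/

/-- The effect of a block of letters on the descents `β` of the blocks of positions. -/
def stepBits (k : ℕ) (m : Mask) (β : ℕ → Bool) : ℕ → Bool :=
  Function.update (Function.update β k (outLeft m (β k) (β (k + 1)))) (k + 1)
    (outRight m (β k) (β (k + 1)))

theorem stepBits_of_ne {k r : ℕ} (m : Mask) (β : ℕ → Bool) (h1 : r ≠ k) (h2 : r ≠ k + 1) :
    stepBits k m β r = β r := by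
  simp [stepBits, h1, h2]

theorem stepBits_left (k : ℕ) (m : Mask) (β : ℕ → Bool) :
    stepBits k m β k = outLeft m (β k) (β (k + 1)) := by
  simp [stepBits]

theorem stepBits_right (k : ℕ) (m : Mask) (β : ℕ → Bool) :
    stepBits k m β (k + 1) = outRight m (β k) (β (k + 1)) := by
  simp [stepBits]

open Classical in
/-- The weight of a mask of one block, subject to a constraint. -/
noncomputable def blockWeight (C : ℕ → Mask → Bool → Bool → Prop) (k : ℕ) (m : Mask)
    (a b : Bool) : ℤ[X] :=
  if C k m a b then Polynomial.C (maskSign m) * Polynomial.X ^ localDefect m a b else 0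

/-- The operator that sums over the masks of one block. -/
noncomputable def transfer (C : ℕ → Mask → Bool → Bool → Prop) (k : ℕ)
    (F : (ℕ → Bool) → ℤ[X]) (β : ℕ → Bool) : ℤ[X] :=
  ∑ m : Mask, blockWeight C k m (β k) (β (k + 1)) * F (stepBits k m β)

/-- The operator that sums over the masks of a word. -/
noncomputable def transferWord (C : ℕ → Mask → Bool → Bool → Prop) (ks : List ℕ)
    (F : (ℕ → Bool) → ℤ[X]) : (ℕ → Bool) → ℤ[X] :=
  ks.foldr (transfer C) F

theorem stepBits_comm {k k' : ℕ} (h : k + 1 < k') (m m' : Mask) (β : ℕ → Bool) :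
    stepBits k m (stepBits k' m' β) = stepBits k' m' (stepBits k m β) := by
  have e1 := stepBits_of_ne m' β (show k ≠ k' by omega) (show k ≠ k' + 1 by omega)
  have e2 := stepBits_of_ne m' β (show k + 1 ≠ k' by omega) (show k + 1 ≠ k' + 1 by omega)
  have e3 := stepBits_of_ne m β (show k' ≠ k by omega) (show k' ≠ k + 1 by omega)
  have e4 := stepBits_of_ne m β (show k' + 1 ≠ k by omega) (show k' + 1 ≠ k + 1 by omega)
  funext r
  by_cases h1 : r = k
  · subst h1
    rw [stepBits_left, e1, e2, stepBits_of_ne _ _ (by omega) (by omega), stepBits_left]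
  by_cases h2 : r = k + 1
  · subst h2
    rw [stepBits_right, e1, e2, stepBits_of_ne _ _ (by omega) (by omega), stepBits_right]
  rw [stepBits_of_ne _ _ h1 h2]
  by_cases h3 : r = k'
  · subst h3
    rw [stepBits_left, stepBits_left, e3, e4]
  by_cases h4 : r = k' + 1
  · subst h4
    rw [stepBits_right, stepBits_right, e3, e4]
  rw [stepBits_of_ne _ _ h3 h4, stepBits_of_ne _ _ h3 h4, stepBits_of_ne _ _ h1 h2]

/-- Nonadjacent letters read and write disjoint pairs of bits. -/
theorem transfer_comm (C : ℕ → Mask → Bool → Bool → Prop) {k k' : ℕ} (h : k + 1 < k')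
    (F : (ℕ → Bool) → ℤ[X]) : transfer C k (transfer C k' F) = transfer C k' (transfer C k F) := by
  funext β
  unfold transfer
  simp only [Finset.mul_sum]
  rw [Finset.sum_comm]
  refine Finset.sum_congr rfl fun m' _ => Finset.sum_congr rfl fun m _ => ?_
  rw [stepBits_comm h, stepBits_of_ne m β (show k' ≠ k by omega) (show k' ≠ k + 1 by omega),
    stepBits_of_ne m β (show k' + 1 ≠ k by omega) (show k' + 1 ≠ k + 1 by omega),
    stepBits_of_ne m' β (show k ≠ k' by omega) (show k ≠ k' + 1 by omega),
    stepBits_of_ne m' β (show k + 1 ≠ k' by omega) (show k + 1 ≠ k' + 1 by omega)]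
  ring

theorem transferWord_transfer_comm (C : ℕ → Mask → Bool → Bool → Prop) {ks : List ℕ} {M : ℕ}
    (h : ∀ k ∈ ks, k + 1 < M) (F : (ℕ → Bool) → ℤ[X]) :
    transferWord C ks (transfer C M F) = transfer C M (transferWord C ks F) := by
  induction ks with
  | nil => rfl
  | cons k t ih =>
    simp only [transferWord, List.foldr_cons] at ih ⊢
    rw [ih fun r hr => h r (List.mem_cons_of_mem _ hr), transfer_comm C (h k List.mem_cons_self)]

/-! ### Chains -/

/-- The letter `r` occurs before the letter `s`. -/
def Before (ks : List ℕ) (r s : ℕ) : Prop := List.Sublist [r, s] ks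

theorem Before.left_mem {ks : List ℕ} {r s : ℕ} (h : Before ks r s) : r ∈ ks :=
  h.subset (by simp)

theorem Before.right_mem {ks : List ℕ} {r s : ℕ} (h : Before ks r s) : s ∈ ks :=
  h.subset (by simp)

theorem before_append_cons {A B : List ℕ} {s : ℕ} (hnd : (A ++ s :: B).Nodup) (r : ℕ) :
    Before (A ++ s :: B) r s ↔ r ∈ A := by
  constructor
  · intro h
    obtain ⟨l₁, l₂, h1, h2, h3⟩ := List.sublist_append_iff.1 h
    have hsA : s ∉ A := fun hs => (List.nodup_append.1 hnd).2.2 s hs s (by simp) rfl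
    have hsB : s ∉ B := (List.nodup_cons.1 (List.nodup_append.1 hnd).2.1).1
    rcases l₁ with _ | ⟨x, _ | ⟨y, l₁⟩⟩
    · simp only [List.nil_append] at h1
      subst h1
      exfalso
      rcases List.sublist_cons_iff.1 h3 with h4 | ⟨t, h4, h5⟩
      · exact hsB (h4.subset (by simp))
      · simp only [List.cons.injEq] at h4
        exact hsB (h5.subset (by simp [← h4.2]))
    · simp only [List.cons_append, List.nil_append, List.cons.injEq] at h1
      rw [h1.1]
      exact h2.subset (by simp)
    · simp only [List.cons_append, List.cons.injEq] at h1
      exact absurd (h2.subset (by simp [h1.2.1])) hsA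
  · intro h
    have h1 : List.Sublist [r] A := List.singleton_sublist.2 h
    exact h1.append (List.singleton_sublist.2 List.mem_cons_self)

theorem Before.asymm {ks : List ℕ} (hnd : ks.Nodup) {r s : ℕ} (h : Before ks r s) :
    ¬ Before ks s r := by
  obtain ⟨A, B, rfl⟩ := List.append_of_mem h.right_mem
  have hr := (before_append_cons hnd r).1 h
  intro h'
  obtain ⟨A', B', rfl⟩ := List.append_of_mem hr
  have e : A' ++ r :: B' ++ s :: B = A' ++ r :: (B' ++ s :: B) := by simp
  rw [e] at hnd h'
  have := (before_append_cons hnd s).1 h'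
  exact (List.nodup_append.1 hnd).2.2 s this s (by simp) rfl

theorem Before.ne {ks : List ℕ} (hnd : ks.Nodup) {r s : ℕ} (h : Before ks r s) : r ≠ s := by
  rintro rfl
  exact h.asymm hnd h

/-- The letters `k, …, b - 1` occur in increasing order, `k` has class one and the others have
class two. -/
structure RightChain (ks : List ℕ) (c : ℕ → ℕ) (k b : ℕ) : Prop where
  lt : k < b
  source : c k = 1
  mid : ∀ r, k < r → r < b → c r = 2
  before : ∀ r, k ≤ r → r + 1 < b → Before ks r (r + 1)

/-- The letters `s, …, b` occur in decreasing order, `s` has class one and the others have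
class two. -/
structure LeftChain (ks : List ℕ) (c : ℕ → ℕ) (b s : ℕ) : Prop where
  le : b ≤ s
  source : c s = 1
  mid : ∀ r, b ≤ r → r < s → c r = 2
  before : ∀ r, b ≤ r → r < s → Before ks (r + 1) r

/-- A chain of increasing letters that ends in a letter `b` of class one. -/
structure RightLink (ks : List ℕ) (c : ℕ → ℕ) (k b : ℕ) : Prop where
  chain : RightChain ks c k b
  before : Before ks (b - 1) b
  target : c b = 1

/-- A chain of decreasing letters that ends in a letter `k` of class one. -/
structure LeftLink (ks : List ℕ) (c : ℕ → ℕ) (k s : ℕ) : Prop where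
  chain : LeftChain ks c (k + 1) s
  before : Before ks (k + 1) k
  target : c k = 1

/-- The letter `k` has a neighbor. -/
def Linked (ks : List ℕ) (c : ℕ → ℕ) (k : ℕ) : Prop :=
  (∃ b, RightLink ks c k b) ∨ ∃ s, LeftLink ks c k s

/-- The conditions on the mask of the letter `k`. -/
structure Constraint (ks : List ℕ) (c : ℕ → ℕ) (I : ℕ → Prop) (k : ℕ) (m : Mask)
    (a b : Bool) : Prop where
  cls : maskClass m = c k
  -- Either condition is imposed at the letter of the link that occurs last, which is the larger one
  -- for a right link and the smaller one for a left link. The flag always belongs to the smaller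
  -- letter.
  low : ∀ k', RightLink ks c k' k → (lowMoves m a b = true ↔ I k')
  high : ∀ s, LeftLink ks c k s → (highMoves m a b = true ↔ I k)

open Classical in
/-- The contribution of the letter `k` to the sum over all masks. -/
noncomputable def letterWeight (ks : List ℕ) (c : ℕ → ℕ) (I : ℕ → Prop) (k : ℕ) : ℤ[X] :=
  if c k = 0 then Polynomial.X else if c k = 2 then 1
  else if Linked ks c k then linkWeight (decide (I k)) else -(Polynomial.X + 1)

section Chains

variable {ks : List ℕ} {c : ℕ → ℕ}

theorem RightChain.source_unique {k k' b : ℕ} (h : RightChain ks c k b)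
    (h' : RightChain ks c k' b) : k = k' := by
  rcases lt_trichotomy k k' with hlt | heq | hlt
  · have := h.mid k' hlt h'.lt
    have := h'.source
    omega
  · exact heq
  · have := h'.mid k hlt h.lt
    have := h.source
    omega

theorem LeftChain.source_unique {b s s' : ℕ} (h : LeftChain ks c b s)
    (h' : LeftChain ks c b s') : s = s' := by
  rcases lt_trichotomy s s' with hlt | heq | hlt
  · have := h'.mid s h.le hlt
    have := h.source
    omega
  · exact heq
  · have := h.mid s' h'.le hlt
    have := h'.source
    omega

theorem rightChain_succ_iff {k M : ℕ} :
    RightChain ks c k (M + 1) ↔ (k = M ∧ c M = 1) ∨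
      (c M = 2 ∧ RightChain ks c k M ∧ Before ks (M - 1) M) := by
  constructor
  · intro h
    have h1 := h.lt
    by_cases hk : k = M
    · left
      exact ⟨hk, hk ▸ h.source⟩
    · right
      refine ⟨h.mid M (by omega) (by omega), ⟨by omega, h.source,
        fun r h2 h3 => h.mid r h2 (by omega), fun r h2 h3 => h.before r h2 (by omega)⟩, ?_⟩
      have := h.before (M - 1) (by omega) (by omega)
      rwa [show M - 1 + 1 = M by omega] at this
  · rintro (⟨rfl, h⟩ | ⟨h, h1, h2⟩)
    · exact ⟨by omega, h, fun r _ _ => by omega, fun r _ _ => by omega⟩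
    · refine ⟨by have := h1.lt; omega, h1.source, fun r h3 h4 => ?_, fun r h3 h4 => ?_⟩
      · by_cases hr : r = M
        · rw [hr, h]
        · exact h1.mid r h3 (by omega)
      · by_cases hr : r + 1 = M
        · subst hr
          exact h2
        · exact h1.before r h3 (by omega)

theorem leftChain_iff {b s : ℕ} :
    LeftChain ks c b s ↔ (s = b ∧ c b = 1) ∨
      (c b = 2 ∧ LeftChain ks c (b + 1) s ∧ Before ks (b + 1) b) := by
  constructor
  · intro h
    have h1 := h.le
    by_cases hk : s = b
    · left
      exact ⟨hk, hk ▸ h.source⟩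
    · right
      exact ⟨h.mid b le_rfl (by omega), ⟨by omega, h.source,
        fun r h2 h3 => h.mid r (by omega) h3, fun r h2 h3 => h.before r (by omega) h3⟩,
        h.before b le_rfl (by omega)⟩
  · rintro (⟨rfl, h⟩ | ⟨h, h1, h2⟩)
    · exact ⟨le_rfl, h, fun r _ _ => by omega, fun r _ _ => by omega⟩
    · refine ⟨by have := h1.le; omega, h1.source, fun r h3 h4 => ?_, fun r h3 h4 => ?_⟩
      · by_cases hr : r = b
        · rw [hr, h]
        · exact h1.mid r (by omega) h4
      · by_cases hr : r = b
        · rw [hr]; exact h2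
        · exact h1.before r (by omega) h4

/-- Whether a letter that sends a chain to the right is linked is decided by the letter at the
end of the chain. -/
theorem RightChain.linked_iff (hnd : ks.Nodup) {k M : ℕ} (h : RightChain ks c k M)
    (hM : Before ks (M - 1) M) (hMM : ¬ Before ks M (M + 1) ∨ c M ≠ 2) :
    Linked ks c k ↔ c M = 1 := by
  have hlt := h.lt
  constructor
  · rintro (⟨b, hb⟩ | ⟨s, hs⟩)
    · have hb1 := hb.chain.lt
      rcases lt_trichotomy b M with hlt' | rfl | hlt'
      · have := h.mid b hb1 hlt'
        have := hb.target
        omega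
      · exact hb.target
      · have h2 := hb.chain.mid M hlt hlt'
        have h3 : Before ks M (M + 1) := by
          by_cases hbM : b = M + 1
          · subst hbM
            exact hb.before
          · exact hb.chain.before M hlt.le (by omega)
        tauto
    · exfalso
      have h1 : Before ks k (k + 1) := by
        by_cases hkM : M = k + 1
        · subst hkM
          exact hM
        · exact h.before k le_rfl (by omega)
      exact h1.asymm hnd hs.before
  · exact fun h1 => Or.inl ⟨M, h, hM, h1⟩

end Chains

/-! ### Evaluation of the local sums under the constraints -/

section Values

variable {ks : List ℕ} {c : ℕ → ℕ} {I : ℕ → Prop}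

/-- The local sum attached to a letter and to an outgoing descent on the right. -/
noncomputable def rightSum (C : ℕ → Mask → Bool → Bool → Prop) (M : ℕ) (a b d : Bool) : ℤ[X] :=
  open Classical in localSum (fun m => C M m a b ∧ outRight m a b = d) a b

/-- The local sum attached to a letter. -/
noncomputable def fullSum (C : ℕ → Mask → Bool → Bool → Prop) (M : ℕ) (a b : Bool) : ℤ[X] :=
  open Classical in localSum (fun m => C M m a b) a b

theorem constraint_iff_of_ne_one {M : ℕ} (hc : c M ≠ 1) (m : Mask) (a b : Bool) :
    Constraint ks c I M m a b ↔ maskClass m = c M :=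
  ⟨fun h => h.cls, fun h => ⟨h, fun _ h' => absurd h'.target hc, fun _ h' => absurd h'.target hc⟩⟩

theorem constraint_iff_of_not_linked {M : ℕ} (hR : ∀ k, ¬ RightLink ks c k M)
    (hL : ∀ s, ¬ LeftLink ks c M s) (m : Mask) (a b : Bool) :
    Constraint ks c I M m a b ↔ maskClass m = c M :=
  ⟨fun h => h.cls, fun h => ⟨h, fun _ h' => absurd h' (hR _), fun _ h' => absurd h' (hL _)⟩⟩

theorem bool_eq_decide_iff {b : Bool} {p : Prop} [Decidable p] :
    b = decide p ↔ (b = true ↔ p) := by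
  rw [Bool.eq_iff_iff, decide_eq_true_iff]

open Classical in
theorem constraint_iff_of_right {M k : ℕ} (hR : RightLink ks c k M)
    (hL : ∀ s, ¬ LeftLink ks c M s) (m : Mask) (a b : Bool) :
    Constraint ks c I M m a b ↔ maskClass m = 1 ∧ lowMoves m a b = decide (I k) := by
  rw [bool_eq_decide_iff]
  constructor
  · exact fun h => ⟨h.cls.trans hR.target, h.low k hR⟩
  · rintro ⟨h1, h2⟩
    refine ⟨h1.trans hR.target.symm, fun k' hk' => ?_, fun _ h' => absurd h' (hL _)⟩
    rw [← hR.chain.source_unique hk'.chain]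
    exact h2

open Classical in
theorem constraint_iff_of_left {M s : ℕ} (hR : ∀ k, ¬ RightLink ks c k M)
    (hL : LeftLink ks c M s) (m : Mask) (a b : Bool) :
    Constraint ks c I M m a b ↔ maskClass m = 1 ∧ highMoves m a b = decide (I M) := by
  rw [bool_eq_decide_iff]
  exact ⟨fun h => ⟨h.cls.trans hL.target, h.high s hL⟩, fun ⟨h1, h2⟩ =>
    ⟨h1.trans hL.target.symm, fun _ h' => absurd h' (hR _), fun _ _ => h2⟩⟩

open Classical in
theorem constraint_iff_of_both {M k s : ℕ} (hR : RightLink ks c k M)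
    (hL : LeftLink ks c M s) (m : Mask) (a b : Bool) :
    Constraint ks c I M m a b ↔ maskClass m = 1 ∧ lowMoves m a b = decide (I k) ∧
      highMoves m a b = decide (I M) := by
  rw [bool_eq_decide_iff, bool_eq_decide_iff]
  constructor
  · exact fun h => ⟨h.cls.trans hR.target, h.low k hR, h.high s hL⟩
  · rintro ⟨h1, h2, h3⟩
    refine ⟨h1.trans hR.target.symm, fun k' hk' => ?_, fun _ _ => h3⟩
    rw [← hR.chain.source_unique hk'.chain]
    exact h2

theorem not_leftLink_of_before (hnd : ks.Nodup) {M : ℕ} (h : Before ks M (M + 1)) (s : ℕ) :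
    ¬ LeftLink ks c M s := fun h' => h.asymm hnd h'.before

theorem linked_iff_of_not_before {M : ℕ} (h : ¬ Before ks M (M + 1)) :
    Linked ks c M ↔ ∃ s, LeftLink ks c M s := by
  refine ⟨?_, Or.inr⟩
  rintro (⟨b, hb⟩ | h')
  · exfalso
    apply h
    have := hb.chain.lt
    by_cases hbM : b = M + 1
    · subst hbM
      exact hb.before
    · exact hb.chain.before M le_rfl (by omega)
  · exact h'

/-- Since `M` does not precede `M+1`, it can only be linked by a left link, whose condition is
imposed at `M` itself. Hence its contribution is settled at once, whatever the incoming bits are. -/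
theorem fullSum_constraint (hc : ∀ k, c k ≤ 2) {M : ℕ}
    (hR : ∀ k, ¬ RightLink ks c k M) (hM : ¬ Before ks M (M + 1)) (a b : Bool) :
    fullSum (Constraint ks c I) M a b = letterWeight ks c I M := by
  classical
  unfold fullSum letterWeight
  have hcM := hc M
  by_cases h1 : c M = 1
  · rw [if_neg (by omega), if_neg (by omega), linked_iff_of_not_before hM]
    split_ifs with hL
    · obtain ⟨s, hs⟩ := hL
      rw [localSum_congr _ _ fun m => constraint_iff_of_left hR hs m a b, localSum_high]
    · rw [localSum_congr _ _ fun m => constraint_iff_of_not_linked hR (not_exists.1 hL) m a b, h1,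
        localSum_one]
  · rw [localSum_congr _ _ fun m => constraint_iff_of_ne_one h1 m a b]
    split_ifs with h2 h3
    · rw [h2, localSum_zero]
    · rw [h3, localSum_two]
    · omega
    · omega

/-- Since `M` precedes `M+1`, no left link is possible, and whether a letter `M` of class one is
linked depends on larger letters. Its contribution stays in the form of a combination of the two
outgoing bits. -/
theorem rightSum_constraint (hnd : ks.Nodup) {M : ℕ}
    (hR : ∀ k, ¬ RightLink ks c k M) (hM : Before ks M (M + 1)) :
    (c M = 0 → rightSum (Constraint ks c I) M false false false = Polynomial.X ∧
      rightSum (Constraint ks c I) M false false true = 0) ∧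
    (c M = 1 → rightSum (Constraint ks c I) M false false false = -Polynomial.X ∧
      rightSum (Constraint ks c I) M false false true = -1) ∧
    (c M = 2 → rightSum (Constraint ks c I) M false false false = 1 ∧
      rightSum (Constraint ks c I) M false false true = 0) := by
  classical
  unfold rightSum
  have h := fun (m : Mask) a b => constraint_iff_of_not_linked (I := I) hR
    (not_leftLink_of_before hnd hM) m a b
  have h' := fun d => localSum_congr (P := fun m => Constraint ks c I M m false false ∧
    outRight m false false = d) (P' := fun m => maskClass m = c M ∧ outRight m false false = d)
    false false fun m => and_congr_left' (h m _ _)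
  rw [h', h']
  refine ⟨fun h0 => ?_, fun h1 => ?_, fun h2 => ?_⟩
  · rw [h0]; exact localSum_zero_right _
  · rw [h1]; exact localSum_one_right _
  · rw [h2, localSum_two_right, localSum_two_right]; simp

/-- The open chain from `k` ends at `M` and no new one starts: the contributions of `k` and of `M`
are settled together. The minus sign offsets the one in the state of an open chain. -/
theorem fullSum_constraint_of_chain (hnd : ks.Nodup) (hc : ∀ k, c k ≤ 2) {M k : ℕ}
    (hR : RightChain ks c k M) (hb : Before ks (M - 1) M) (hM : ¬ Before ks M (M + 1)) (b : Bool) :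
    Polynomial.X * fullSum (Constraint ks c I) M false b + fullSum (Constraint ks c I) M true b =
      -(letterWeight ks c I M * letterWeight ks c I k) := by
  classical
  unfold fullSum
  have hcM := hc M
  have hk : letterWeight ks c I k = if c M = 1 then linkWeight (decide (I k))
      else -(Polynomial.X + 1) := by
    unfold letterWeight
    rw [if_neg (by rw [hR.source]; omega), if_neg (by rw [hR.source]; omega)]
    exact if_congr (hR.linked_iff hnd hb (Or.inl hM)) rfl rfl
  rw [hk]
  unfold letterWeight
  by_cases h1 : c M = 1
  · rw [if_neg (by omega), if_neg (by omega), linked_iff_of_not_before hM, if_pos h1]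
    have hR' : RightLink ks c k M := ⟨hR, hb, h1⟩
    split_ifs with hL
    · obtain ⟨s, hs⟩ := hL
      rw [localSum_congr _ _ fun m => constraint_iff_of_both hR' hs m false b,
        localSum_congr _ _ fun m => constraint_iff_of_both hR' hs m true b, localSum_low_high]
    · rw [localSum_congr _ _ fun m => constraint_iff_of_right hR' (not_exists.1 hL) m false b,
        localSum_congr _ _ fun m => constraint_iff_of_right hR' (not_exists.1 hL) m true b,
        localSum_low, localSum_low]
      ring
  · rw [localSum_congr _ _ fun m => constraint_iff_of_ne_one h1 m false b,
      localSum_congr _ _ fun m => constraint_iff_of_ne_one h1 m true b]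
    split_ifs with h2 h3
    · rw [h2, localSum_zero, localSum_zero]; ring
    · rw [h3, localSum_two, localSum_two]; ring
    · omega
    · omega

/-- Class zero breaks the chain and leaves no descent; class one closes the link and opens a new
chain; class two passes the state of the chain on unchanged. -/
theorem rightSum_constraint_of_chain (hnd : ks.Nodup) {M k : ℕ}
    (hR : RightChain ks c k M) (hb : Before ks (M - 1) M) (hM : Before ks M (M + 1)) :
    (c M = 0 → Polynomial.X * rightSum (Constraint ks c I) M false false false +
        rightSum (Constraint ks c I) M true false false =
          -(letterWeight ks c I M * letterWeight ks c I k) ∧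
      Polynomial.X * rightSum (Constraint ks c I) M false false true +
        rightSum (Constraint ks c I) M true false true = 0) ∧
    (c M = 1 → Polynomial.X * rightSum (Constraint ks c I) M false false false +
        rightSum (Constraint ks c I) M true false false = letterWeight ks c I k * Polynomial.X ∧
      Polynomial.X * rightSum (Constraint ks c I) M false false true +
        rightSum (Constraint ks c I) M true false true = letterWeight ks c I k) ∧
    (c M = 2 → Polynomial.X * rightSum (Constraint ks c I) M false false false +
        rightSum (Constraint ks c I) M true false false = Polynomial.X ∧
      Polynomial.X * rightSum (Constraint ks c I) M false false true +
        rightSum (Constraint ks c I) M true false true = 1) := by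
  classical
  have hk : c M ≠ 2 → letterWeight ks c I k = if c M = 1 then linkWeight (decide (I k))
      else -(Polynomial.X + 1) := by
    intro h2
    unfold letterWeight
    rw [if_neg (by rw [hR.source]; omega), if_neg (by rw [hR.source]; omega)]
    exact if_congr (hR.linked_iff hnd hb (Or.inr h2)) rfl rfl
  unfold rightSum
  have h' := fun (h1 : c M ≠ 1) a d => localSum_congr (P := fun m => Constraint ks c I M m a false ∧
    outRight m a false = d) (P' := fun m => maskClass m = c M ∧ outRight m a false = d)
    a false fun m => and_congr_left' (constraint_iff_of_ne_one h1 m _ _)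
  refine ⟨fun h0 => ?_, fun h1 => ?_, fun h2 => ?_⟩
  · have h1 : c M ≠ 1 := by omega
    rw [h' h1, h' h1, h' h1, h' h1, hk (by omega), if_neg h1, h0, letterWeight, if_pos h0,
      (localSum_zero_right _).1, (localSum_zero_right _).2, (localSum_zero_right _).1,
      (localSum_zero_right _).2]
    constructor <;> ring
  · have hR' : RightLink ks c k M := ⟨hR, hb, h1⟩
    have h'' := fun a d => localSum_congr (P := fun m => Constraint ks c I M m a false ∧
      outRight m a false = d) (P' := fun m => maskClass m = 1 ∧ lowMoves m a false = decide (I k) ∧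
        outRight m a false = d) a false fun m => by
          rw [constraint_iff_of_right hR' (not_leftLink_of_before hnd hM) m _ _, and_assoc]
    rw [h'', h'', h'', h'', hk (by omega), if_pos h1]
    exact localSum_low_right _
  · have h1 : c M ≠ 1 := by omega
    rw [h' h1, h' h1, h' h1, h' h1, h2, localSum_two_right, localSum_two_right,
      localSum_two_right, localSum_two_right]
    simp

end Values

/-! ### Evaluation of the sum over all masks, letter by letter -/

/-- `F β` depends only on the `β r` with `r ≥ M`. -/
def DependsAbove (M : ℕ) (F : (ℕ → Bool) → ℤ[X]) : Prop :=
  ∀ β β' : ℕ → Bool, (∀ r, M ≤ r → β r = β' r) → F β = F β'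

theorem DependsAbove.mono {M M' : ℕ} (h : M ≤ M') {F : (ℕ → Bool) → ℤ[X]}
    (hF : DependsAbove M' F) : DependsAbove M F :=
  fun β β' hβ => hF β β' fun r hr => hβ r (h.trans hr)

theorem DependsAbove.transfer {C : ℕ → Mask → Bool → Bool → Prop} {M : ℕ}
    {F : (ℕ → Bool) → ℤ[X]} (hF : DependsAbove (M + 1) F) : DependsAbove M (transfer C M F) := by
  intro β β' hβ
  unfold BooleanWord.transfer
  refine Finset.sum_congr rfl fun m _ => ?_
  rw [hβ M le_rfl, hβ (M + 1) (by omega)]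
  congr 1
  refine hF _ _ fun r hr => ?_
  by_cases h : r = M + 1
  · subst h
    rw [stepBits_right, stepBits_right, hβ M le_rfl, hβ (M + 1) (by omega)]
  · rw [stepBits_of_ne _ _ (by omega) h, stepBits_of_ne _ _ (by omega) h, hβ r (by omega)]

theorem transfer_of_dependsAbove_two {C : ℕ → Mask → Bool → Bool → Prop} {M : ℕ}
    {F : (ℕ → Bool) → ℤ[X]} (hF : DependsAbove (M + 2) F) (β : ℕ → Bool) :
    transfer C M F β = fullSum C M (β M) (β (M + 1)) * F β := by
  classical
  unfold transfer fullSum localSum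
  rw [Finset.sum_mul]
  refine Finset.sum_congr rfl fun m _ => ?_
  rw [hF (stepBits M m β) β fun r hr => stepBits_of_ne _ _ (by omega) (by omega)]
  congr 1

/-- Of the bits written by the letter, `F` sees only the right one, so the masks are sorted by its
value. -/
theorem transfer_of_dependsAbove_one {C : ℕ → Mask → Bool → Bool → Prop} {M : ℕ}
    {F : (ℕ → Bool) → ℤ[X]} (hF : DependsAbove (M + 1) F) (β : ℕ → Bool)
    (hβ : β (M + 1) = false) :
    transfer C M F β = rightSum C M (β M) false false * F β +
      rightSum C M (β M) false true * F (Function.update β (M + 1) true) := by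
  classical
  unfold transfer rightSum localSum
  rw [Finset.sum_mul, Finset.sum_mul, ← Finset.sum_add_distrib, hβ]
  refine Finset.sum_congr rfl fun m _ => ?_
  have h : F (stepBits M m β) = if outRight m (β M) false = true
      then F (Function.update β (M + 1) true) else F β := by
    rw [← hβ]
    split_ifs with ho
    · refine hF _ _ fun r hr => ?_
      by_cases h : r = M + 1
      · subst h
        rw [stepBits_right, ho]; simp
      · rw [stepBits_of_ne _ _ (by omega) h, Function.update_of_ne h]
    · refine hF _ _ fun r hr => ?_
      by_cases h : r = M + 1
      · subst h
        rw [stepBits_right]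
        simp only [Bool.not_eq_true] at ho
        rw [ho, hβ]
      · rw [stepBits_of_ne _ _ (by omega) h]
  rw [h]
  unfold blockWeight
  cases hd : outRight m (β M) false <;> by_cases hC : C M m (β M) false <;> simp [hC, hd]

section Line

variable {ks : List ℕ} {c : ℕ → ℕ} {I : ℕ → Prop}

/-- The product of the contributions of the letters below `M`. -/
noncomputable def weightBelow (ks : List ℕ) (c : ℕ → ℕ) (I : ℕ → Prop) (M : ℕ) : ℤ[X] :=
  ∏ k ∈ ks.toFinset with k < M, letterWeight ks c I k

theorem weightBelow_succ_of_mem {M : ℕ} (h : M ∈ ks) :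
    weightBelow ks c I (M + 1) = letterWeight ks c I M * weightBelow ks c I M := by
  unfold weightBelow
  have : (ks.toFinset.filter fun k => k < M + 1) = insert M (ks.toFinset.filter fun k => k < M) := by
    ext k
    simp only [Finset.mem_filter, List.mem_toFinset, Finset.mem_insert]
    constructor
    · rintro ⟨h1, h2⟩
      by_cases hk : k = M
      · exact Or.inl hk
      · exact Or.inr ⟨h1, by omega⟩
    · rintro (rfl | ⟨h1, h2⟩)
      · exact ⟨h, by omega⟩
      · exact ⟨h1, by omega⟩
  rw [this, Finset.prod_insert (by simp)]

theorem filter_lt_succ_of_notMem {M : ℕ} (h : M ∉ ks) :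
    (ks.filter fun k => k < M + 1) = ks.filter fun k => k < M := by
  refine List.filter_congr fun k hk => ?_
  have : k ≠ M := fun h' => h (h' ▸ hk)
  simp only [decide_eq_decide]
  omega

theorem weightBelow_succ_of_notMem {M : ℕ} (h : M ∉ ks) :
    weightBelow ks c I (M + 1) = weightBelow ks c I M := by
  unfold weightBelow
  congr 1
  refine Finset.filter_congr fun k hk => ?_
  have : k ≠ M := fun h' => h (h' ▸ List.mem_toFinset.1 hk)
  omega

/-- The operator that sums over the masks of the letters below `M`. -/
noncomputable def sumBelow (C : ℕ → Mask → Bool → Bool → Prop) (ks : List ℕ) (M : ℕ)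
    (F : (ℕ → Bool) → ℤ[X]) : (ℕ → Bool) → ℤ[X] :=
  transferWord C (ks.filter fun k => k < M) F

theorem transferWord_append (C : ℕ → Mask → Bool → Bool → Prop) (A B : List ℕ)
    (F : (ℕ → Bool) → ℤ[X]) :
    transferWord C (A ++ B) F = transferWord C A (transferWord C B F) := by
  simp [transferWord]

theorem filter_lt_succ_of_notMem_append {A B : List ℕ} {M : ℕ}
    (hnd : (A ++ M :: B).Nodup) :
    ((A ++ M :: B).filter fun k => k < M + 1) =
      (A.filter fun k => k < M) ++ M :: (B.filter fun k => k < M) := by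
  have hA : M ∉ A := fun h => (List.nodup_append.1 hnd).2.2 M h M (by simp) rfl
  have hB : M ∉ B := (List.nodup_cons.1 (List.nodup_append.1 hnd).2.1).1
  rw [List.filter_append, List.filter_cons, filter_lt_succ_of_notMem hA,
    filter_lt_succ_of_notMem hB]
  simp

/-- The smaller letters that follow `M` are different from `M-1`, hence commute with `M`, which can
be moved to the end. -/
theorem sumBelow_succ_of_before (C : ℕ → Mask → Bool → Bool → Prop) (hnd : ks.Nodup) {M : ℕ}
    (h : Before ks (M - 1) M) (F : (ℕ → Bool) → ℤ[X]) :
    sumBelow C ks (M + 1) F = sumBelow C ks M (transfer C M F) := by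
  obtain ⟨A, B, rfl⟩ := List.append_of_mem h.right_mem
  have hA := (before_append_cons hnd (M - 1)).1 h
  unfold sumBelow
  rw [filter_lt_succ_of_notMem_append hnd, List.filter_append, List.filter_cons]
  rw [transferWord_append, if_neg (by simp), transferWord_append, transferWord_transfer_comm]
  · rfl
  · intro k hk
    simp only [List.mem_filter, decide_eq_true_eq] at hk
    have : k ≠ M - 1 := fun hk' =>
      (List.nodup_append.1 hnd).2.2 (M - 1) hA k (List.mem_cons_of_mem _ hk.1) hk'.symm
    omega

/-- The smaller letters that precede `M` are different from `M-1`, hence commute with `M`, which can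
be moved to the front. -/
theorem sumBelow_succ_of_not_before (C : ℕ → Mask → Bool → Bool → Prop) (hnd : ks.Nodup) {M : ℕ}
    (hM : M ∈ ks) (h : ¬ Before ks (M - 1) M) (F : (ℕ → Bool) → ℤ[X]) :
    sumBelow C ks (M + 1) F = transfer C M (sumBelow C ks M F) := by
  obtain ⟨A, B, rfl⟩ := List.append_of_mem hM
  have hA : M - 1 ∉ A := fun h' => h ((before_append_cons hnd (M - 1)).2 h')
  unfold sumBelow
  rw [filter_lt_succ_of_notMem_append hnd, List.filter_append, List.filter_cons]
  rw [transferWord_append, if_neg (by simp), transferWord_append, ← transferWord_transfer_comm]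
  · rfl
  · intro k hk
    simp only [List.mem_filter, decide_eq_true_eq] at hk
    have : k ≠ M - 1 := fun hk' => hA (hk' ▸ hk.1)
    omega

/-- The letters below `M` interact with the others only through the bit of the block `M`. If `M-1`
does not precede `M`, that bit is an input of arbitrary value, later ignored by `F`, and the sum
factors. If `M-1` precedes `M`, the bit starts as `false` and is an output. Without an open chain
the outcomes with a descent cancel. With an open chain from `k` the state is `-A (q [no descent] +
[descent])`, where `A` omits the factor of `k`: that factor is not determined before the chain ends.
-/
theorem sumBelow_eval (hnd : ks.Nodup) (hc : ∀ k, c k ≤ 2) (M : ℕ) :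
    (¬ Before ks (M - 1) M → ∀ F, DependsAbove (M + 1) F → ∀ β : ℕ → Bool,
      (∀ r < M, β r = false) →
      sumBelow (Constraint ks c I) ks M F β = weightBelow ks c I M * F β) ∧
    (Before ks (M - 1) M → ∀ F, DependsAbove M F → ∀ β : ℕ → Bool, (∀ r ≤ M, β r = false) →
      ((∀ k, ¬ RightChain ks c k M) →
        sumBelow (Constraint ks c I) ks M F β = weightBelow ks c I M * F β) ∧
      ∀ k, RightChain ks c k M → ∃ A, weightBelow ks c I M = A * letterWeight ks c I k ∧
        sumBelow (Constraint ks c I) ks M F β =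
          -A * (Polynomial.X * F β + F (Function.update β M true))) := by
  induction M with
  | zero =>
    refine ⟨fun _ F _ β _ => ?_, fun h => absurd rfl (h.ne hnd)⟩
    simp [sumBelow, transferWord, weightBelow]
  | succ M ih =>
    rw [Nat.add_sub_cancel]
    by_cases hM : M ∈ ks
    swap
    · have h1 : ¬ Before ks M (M + 1) := fun h => hM h.left_mem
      have h2 : ¬ Before ks (M - 1) M := fun h => hM h.right_mem
      refine ⟨fun _ F hF β hβ => ?_, fun h => absurd h h1⟩
      have := ih.1 h2 F (hF.mono (by omega)) β fun r hr => hβ r (by omega)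
      unfold sumBelow at this ⊢
      rw [filter_lt_succ_of_notMem hM, weightBelow_succ_of_notMem hM, this]
    by_cases hb : Before ks (M - 1) M
    · have ih := ih.2 hb
      have hS := fun F => sumBelow_succ_of_before (Constraint ks c I) hnd hb F
      rw [weightBelow_succ_of_mem hM]
      refine ⟨fun hMM F hF β hβ => ?_, fun hMM F hF β hβ => ?_⟩
      · have h1 := ih (transfer (Constraint ks c I) M F) (hF.mono (by omega)).transfer β
          fun r hr => hβ r (by omega)
        rw [hS]
        by_cases hch : ∃ k, RightChain ks c k M
        · obtain ⟨k, hk⟩ := hch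
          obtain ⟨A, hA, hsum⟩ := h1.2 k hk
          rw [hsum, transfer_of_dependsAbove_two hF, transfer_of_dependsAbove_two hF,
            hβ M (by omega), Function.update_self, Function.update_of_ne (by omega),
            hF (Function.update β M true) β fun r hr => Function.update_of_ne (by omega) _ _, hA]
          have := fullSum_constraint_of_chain (I := I) hnd hc hk hb hMM (β (M + 1))
          linear_combination (-A * F β) * this
        · rw [h1.1 (not_exists.1 hch), transfer_of_dependsAbove_two hF, hβ M (by omega),
            fullSum_constraint hc (fun k hk => hch ⟨k, hk.chain⟩) hMM]
          ring
      · have h1 := ih (transfer (Constraint ks c I) M F) hF.transfer β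
          fun r hr => hβ r (by omega)
        rw [hS]
        have hcM := hc M
        by_cases hch : ∃ k, RightChain ks c k M
        · obtain ⟨k, hk⟩ := hch
          obtain ⟨A, hA, hsum⟩ := h1.2 k hk
          have hup : F (Function.update (Function.update β M true) (M + 1) true) =
              F (Function.update β (M + 1) true) := hF _ _ fun r hr => by
            by_cases hr' : r = M + 1
            · subst hr'; simp
            · rw [Function.update_of_ne hr', Function.update_of_ne hr',
                Function.update_of_ne (by omega)]
          rw [transfer_of_dependsAbove_one hF _ (hβ _ le_rfl), transfer_of_dependsAbove_one hF _
            (by rw [Function.update_of_ne (by omega)]; exact hβ _ le_rfl), hβ M (by omega),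
            Function.update_self, hup,
            hF (Function.update β M true) β fun r hr => Function.update_of_ne (by omega) _ _]
            at hsum
          obtain ⟨v0, v1, v2⟩ := rightSum_constraint_of_chain (I := I) hnd hk hb hMM
          rw [hsum, hA]
          by_cases h0 : c M = 0
          · obtain ⟨e1, e2⟩ := v0 h0
            have hnone : ∀ k, ¬ RightChain ks c k (M + 1) := fun k' hk' => by
              rcases rightChain_succ_iff.1 hk' with h | h <;> omega
            refine ⟨fun _ => ?_, fun k' hk' => absurd hk' (hnone k')⟩
            linear_combination (-A * F β) * e1 - A * F (Function.update β (M + 1) true) * e2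
          by_cases h1 : c M = 1
          · obtain ⟨e1, e2⟩ := v1 h1
            have hchM : RightChain ks c M (M + 1) := rightChain_succ_iff.2 (Or.inl ⟨rfl, h1⟩)
            refine ⟨fun hno => absurd hchM (hno M), fun k' hk' => ?_⟩
            obtain rfl := hchM.source_unique hk'
            -- The link from `k` to `M` is closed and its weight joins `A`; the factor of the new
            -- source `M` is now the pending one.
            refine ⟨A * letterWeight ks c I k, by ring, ?_⟩
            linear_combination (-A * F β) * e1 - A * F (Function.update β (M + 1) true) * e2
          · have h2 : c M = 2 := by omega
            obtain ⟨e1, e2⟩ := v2 h2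
            have hchk : RightChain ks c k (M + 1) := rightChain_succ_iff.2 (Or.inr ⟨h2, hk, hb⟩)
            refine ⟨fun hno => absurd hchk (hno k), fun k' hk' => ?_⟩
            obtain rfl := hchk.source_unique hk'
            -- The letter `M` has class two and contribution one; the chain from `k` remains open
            -- with the same `A`.
            refine ⟨A, by rw [letterWeight, if_neg h0, if_pos h2]; ring, ?_⟩
            linear_combination (-A * F β) * e1 - A * F (Function.update β (M + 1) true) * e2
        · rw [h1.1 (not_exists.1 hch), transfer_of_dependsAbove_one hF _ (hβ _ le_rfl),
            hβ M (by omega)]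
          obtain ⟨v0, v1, v2⟩ := rightSum_constraint (I := I) hnd
            (fun k hk => hch ⟨k, hk.chain⟩) hMM
          by_cases h0 : c M = 0
          · obtain ⟨e1, e2⟩ := v0 h0
            have hnone : ∀ k, ¬ RightChain ks c k (M + 1) := fun k' hk' => by
              rcases rightChain_succ_iff.1 hk' with h | h <;> omega
            refine ⟨fun _ => ?_, fun k' hk' => absurd hk' (hnone k')⟩
            rw [e1, e2, letterWeight, if_pos h0]
            ring
          by_cases h1 : c M = 1
          · obtain ⟨e1, e2⟩ := v1 h1
            have hchM : RightChain ks c M (M + 1) := rightChain_succ_iff.2 (Or.inl ⟨rfl, h1⟩)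
            refine ⟨fun hno => absurd hchM (hno M), fun k' hk' => ?_⟩
            obtain rfl := hchM.source_unique hk'
            refine ⟨weightBelow ks c I M, by ring, ?_⟩
            rw [e1, e2]
            ring
          · have h2 : c M = 2 := by omega
            obtain ⟨e1, e2⟩ := v2 h2
            have hnone : ∀ k, ¬ RightChain ks c k (M + 1) := fun k' hk' => by
              rcases rightChain_succ_iff.1 hk' with h | h
              · omega
              · exact hch ⟨k', h.2.1⟩
            refine ⟨fun _ => ?_, fun k' hk' => absurd hk' (hnone k')⟩
            rw [e1, e2, letterWeight, if_neg h0, if_pos h2]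
            ring
    · have ih := ih.1 hb
      have hS := fun F => sumBelow_succ_of_not_before (Constraint ks c I) hnd hM hb F
      rw [weightBelow_succ_of_mem hM]
      have hnoR : ∀ k, ¬ RightLink ks c k M := fun k hk => hb hk.before
      -- Here `M` acts before the smaller letters and may leave any bit on the block `M`. The
      -- induction hypothesis only asks for the bits below `M` to vanish, so every mask of `M` meets
      -- the same weight.
      have hT : ∀ F, DependsAbove (M + 1) F → ∀ β : ℕ → Bool, (∀ r < M, β r = false) →
          transfer (Constraint ks c I) M (sumBelow (Constraint ks c I) ks M F) β =
            weightBelow ks c I M * transfer (Constraint ks c I) M F β := by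
        intro F hF β hβ
        unfold transfer
        rw [Finset.mul_sum]
        refine Finset.sum_congr rfl fun m _ => ?_
        rw [ih F hF (stepBits M m β) fun r hr => by
          rw [stepBits_of_ne _ _ (by omega) (by omega)]; exact hβ r hr]
        ring
      refine ⟨fun hMM F hF β hβ => ?_, fun hMM F hF β hβ => ?_⟩
      · rw [hS, hT F (hF.mono (by omega)) β fun r hr => hβ r (by omega),
          transfer_of_dependsAbove_two hF, fullSum_constraint hc hnoR hMM]
        ring
      · rw [hS, hT F hF β fun r hr => hβ r (by omega),
          transfer_of_dependsAbove_one hF _ (hβ _ le_rfl), hβ M (by omega)]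
        have hcM := hc M
        obtain ⟨v0, v1, v2⟩ := rightSum_constraint (I := I) hnd hnoR hMM
        by_cases h0 : c M = 0
        · obtain ⟨e1, e2⟩ := v0 h0
          have hnone : ∀ k, ¬ RightChain ks c k (M + 1) := fun k' hk' => by
            rcases rightChain_succ_iff.1 hk' with h | h <;> omega
          refine ⟨fun _ => ?_, fun k' hk' => absurd hk' (hnone k')⟩
          rw [e1, e2, letterWeight, if_pos h0]
          ring
        by_cases h1 : c M = 1
        · obtain ⟨e1, e2⟩ := v1 h1
          have hchM : RightChain ks c M (M + 1) := rightChain_succ_iff.2 (Or.inl ⟨rfl, h1⟩)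
          refine ⟨fun hno => absurd hchM (hno M), fun k' hk' => ?_⟩
          obtain rfl := hchM.source_unique hk'
          refine ⟨weightBelow ks c I M, by ring, ?_⟩
          rw [e1, e2]
          ring
        · have h2 : c M = 2 := by omega
          obtain ⟨e1, e2⟩ := v2 h2
          have hnone : ∀ k, ¬ RightChain ks c k (M + 1) := fun k' hk' => by
            rcases rightChain_succ_iff.1 hk' with h | h
            · omega
            · exact hb h.2.2
          refine ⟨fun _ => ?_, fun k' hk' => absurd hk' (hnone k')⟩
          rw [e1, e2, letterWeight, if_neg h0, if_pos h2]
          ring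

/-- The sum over all masks of a word with distinct letters is the product of the contributions
of the letters. -/
theorem transferWord_constraint (hnd : ks.Nodup) (hc : ∀ k, c k ≤ 2) :
    transferWord (Constraint ks c I) ks (fun _ => 1) (fun _ => false) =
      ∏ k ∈ ks.toFinset, letterWeight ks c I k := by
  obtain ⟨M, hM⟩ : ∃ M, ∀ k ∈ ks, k < M :=
    ⟨ks.toFinset.sup id + 1, fun k hk =>
      Nat.lt_succ_of_le (Finset.le_sup (f := id) (List.mem_toFinset.2 hk))⟩
  have h := (sumBelow_eval (I := I) hnd hc M).1 (fun h => lt_irrefl M (hM M h.right_mem))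
    (fun _ => 1) (fun _ _ _ => rfl) (fun _ => false) fun _ _ => rfl
  rw [mul_one] at h
  unfold sumBelow weightBelow at h
  rwa [List.filter_eq_self.2 fun k hk => decide_eq_true (hM k hk),
    Finset.filter_true_of_mem fun k hk => hM k (List.mem_toFinset.1 hk)] at h

end Line

/-! ### Permutations of the natural numbers -/

/-- The interval of `N` numbers that begins with `a`. -/
def intervalEquiv (a N : ℕ) : Fin N ≃ {p : ℕ // a ≤ p ∧ p < a + N} where
  toFun i := ⟨a + i.val, by omega⟩
  invFun p := ⟨p.1 - a, by have := p.2; omega⟩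
  left_inv i := by ext; simp
  right_inv p := by ext; have := p.2; simp; omega

/-- A permutation of `N` points, acting on the interval of `N` numbers that begins with `a`. -/
def shiftPerm (a N : ℕ) : Equiv.Perm (Fin N) →* Equiv.Perm ℕ :=
  Equiv.Perm.extendDomainHom (intervalEquiv a N)

theorem shiftPerm_apply {a N : ℕ} (u : Equiv.Perm (Fin N)) (i : Fin N) :
    shiftPerm a N u (a + i.val) = a + (u i).val :=
  Equiv.Perm.extendDomain_apply_image u (intervalEquiv a N) i

theorem shiftPerm_apply_of_not {a N : ℕ} (u : Equiv.Perm (Fin N)) {p : ℕ}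
    (h : p < a ∨ a + N ≤ p) : shiftPerm a N u p = p :=
  Equiv.Perm.extendDomain_apply_not_subtype u (intervalEquiv a N) (by omega)

theorem shiftPerm_zero_apply {N : ℕ} (u : Equiv.Perm (Fin N)) (i : Fin N) :
    shiftPerm 0 N u i.val = (u i).val := by
  have := shiftPerm_apply (a := 0) u i
  simpa using this

theorem shiftPerm_simpleRefl (a : ℕ) {N k : ℕ} (hk : k + 1 < N) :
    shiftPerm a N (simpleRefl N k) = Equiv.swap (a + k) (a + k + 1) := by
  ext p
  by_cases hp : p < a ∨ a + N ≤ p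
  · rw [shiftPerm_apply_of_not _ hp, Equiv.swap_apply_of_ne_of_ne (by omega) (by omega)]
  · obtain ⟨i, rfl⟩ : ∃ i : Fin N, p = a + i.val := ⟨⟨p - a, by omega⟩, by simp; omega⟩
    rw [shiftPerm_apply, simpleRefl_val hk, Equiv.swap_apply_def]
    split_ifs <;> omega

/-- The product of the chosen letters of the block of the letter `k`. -/
def blockPerm (k : ℕ) (m : Mask) : Equiv.Perm ℕ := shiftPerm (2 * k) 4 (localPerm m 4)

/-- The product of the chosen letters of a word of blocks. -/
def wordPerm (L : List (ℕ × Mask)) : Equiv.Perm ℕ := (L.map fun x => blockPerm x.1 x.2).prod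

theorem wordPerm_append (A B : List (ℕ × Mask)) :
    wordPerm (A ++ B) = wordPerm A * wordPerm B := by
  simp [wordPerm]

theorem wordPerm_cons (x : ℕ × Mask) (B : List (ℕ × Mask)) :
    wordPerm (x :: B) = blockPerm x.1 x.2 * wordPerm B := by
  simp [wordPerm]

theorem wordPerm_concat (A : List (ℕ × Mask)) (k : ℕ) (m : Mask) :
    wordPerm (A ++ [(k, m)]) = wordPerm A * blockPerm k m := by
  simp [wordPerm]

theorem blockPerm_apply (k : ℕ) (m : Mask) (r : Fin 4) :
    blockPerm k m (2 * k + r.val) = 2 * k + (localPerm m 4 r).val :=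
  shiftPerm_apply _ r

theorem blockPerm_apply_of_not (k : ℕ) (m : Mask) {p : ℕ} (h : p < 2 * k ∨ 2 * k + 4 ≤ p) :
    blockPerm k m p = p :=
  shiftPerm_apply_of_not _ h

/-- The permutation preserves the set of the numbers below `a`. -/
def PreservesBelow (a : ℕ) (g : Equiv.Perm ℕ) : Prop := ∀ p, g p < a ↔ p < a

theorem PreservesBelow.mul {a : ℕ} {g h : Equiv.Perm ℕ} (hg : PreservesBelow a g)
    (hh : PreservesBelow a h) : PreservesBelow a (g * h) :=
  fun p => (hg (h p)).trans (hh p)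

theorem preservesBelow_blockPerm {k r : ℕ} (m : Mask) (h : k + 1 ≠ r) :
    PreservesBelow (2 * r) (blockPerm k m) := by
  intro p
  by_cases hp : p < 2 * k ∨ 2 * k + 4 ≤ p
  · rw [blockPerm_apply_of_not _ _ hp]
  · obtain ⟨i, rfl⟩ : ∃ i : Fin 4, p = 2 * k + i.val := ⟨⟨p - 2 * k, by omega⟩, by simp; omega⟩
    rw [blockPerm_apply]
    omega

theorem preservesBelow_wordPerm {r : ℕ} {L : List (ℕ × Mask)} (h : ∀ x ∈ L, x.1 + 1 ≠ r) :
    PreservesBelow (2 * r) (wordPerm L) := by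
  induction L with
  | nil => exact fun p => Iff.rfl
  | cons x t ih =>
    rw [wordPerm_cons]
    exact (preservesBelow_blockPerm _ (h x List.mem_cons_self)).mul
      (ih fun y hy => h y (List.mem_cons_of_mem _ hy))

theorem wordPerm_apply_of_untouched {r : ℕ} {L : List (ℕ × Mask)}
    (h : ∀ x ∈ L, x.1 + 1 ≠ r ∧ x.1 ≠ r) {p : ℕ} (hp : p / 2 = r) : wordPerm L p = p := by
  induction L with
  | nil => rfl
  | cons x t ih =>
    rw [wordPerm_cons, Equiv.Perm.mul_apply, ih fun y hy => h y (List.mem_cons_of_mem _ hy)]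
    have := h x List.mem_cons_self
    exact blockPerm_apply_of_not _ _ (by omega)

/-! ### The effect of one block -/

/-- The two values on the block `b`. -/
def blockValues (u : Equiv.Perm ℕ) (b : ℕ) : Sym2 ℕ := s(u (2 * b), u (2 * b + 1))

/-- Whether the block `b` has a descent. -/
def blockDescent (u : Equiv.Perm ℕ) (b : ℕ) : Bool := decide (u (2 * b + 1) < u (2 * b))

/-- When the first two values lie below the last two, only the order within each pair is left to
know. This is why two bits describe the state of a block. -/
theorem blockPattern_lt_iff (f : Fin 4 → ℕ) (hf : Function.Injective f) {t : ℕ}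
    (h0 : f 0 < t) (h1 : f 1 < t) (h2 : t ≤ f 2) (h3 : t ≤ f 3) (r r' : Fin 4) :
    f r < f r' ↔ blockPattern (decide (f 1 < f 0)) (decide (f 3 < f 2)) r <
      blockPattern (decide (f 1 < f 0)) (decide (f 3 < f 2)) r' := by
  have h01 : f 0 ≠ f 1 := hf.ne (by decide)
  have h23 : f 2 ≠ f 3 := hf.ne (by decide)
  by_cases ha : f 1 < f 0 <;> by_cases hb : f 3 < f 2 <;>
    fin_cases r <;> fin_cases r' <;> simp [blockPattern, ha, hb] <;> omega

/-- The permutation separates the two blocks at the letter `k`. -/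
def Separates (u : Equiv.Perm ℕ) (k : ℕ) : Prop := PreservesBelow (2 * k + 2) u

theorem Separates.pattern {u : Equiv.Perm ℕ} {k : ℕ} (h : Separates u k) (r r' : Fin 4) :
    u (2 * k + r.val) < u (2 * k + r'.val) ↔
      blockPattern (blockDescent u k) (blockDescent u (k + 1)) r <
      blockPattern (blockDescent u k) (blockDescent u (k + 1)) r' := by
  have := blockPattern_lt_iff (fun r : Fin 4 => u (2 * k + r.val))
    (fun r r' hr => Fin.ext (by simpa using u.injective hr))
    (t := 2 * k + 2) ((h _).2 (by simp)) ((h _).2 (by simp))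
    (not_lt.1 fun h' => by simpa using (h _).1 h')
    (not_lt.1 fun h' => by simpa using (h _).1 h') r r'
  exact this

theorem mul_blockPerm_apply (u : Equiv.Perm ℕ) (k : ℕ) (m : Mask) (r : Fin 4) :
    (u * blockPerm k m) (2 * k + r.val) = u (2 * k + (localPerm m 4 r).val) := by
  rw [Equiv.Perm.mul_apply, blockPerm_apply]

theorem blockDescent_mul_blockPerm {u : Equiv.Perm ℕ} {k : ℕ} (h : Separates u k) (m : Mask)
    (b : ℕ) : blockDescent (u * blockPerm k m) b = stepBits k m (blockDescent u) b := by
  by_cases hb : b = k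
  · subst hb
    rw [stepBits_left, outLeft, blockDescent]
    refine decide_eq_decide.2 ?_
    rw [← h.pattern]
    exact (by rw [← mul_blockPerm_apply, ← mul_blockPerm_apply]; rfl)
  by_cases hb' : b = k + 1
  · subst hb'
    rw [stepBits_right, outRight, blockDescent]
    refine decide_eq_decide.2 ?_
    rw [← h.pattern]
    exact (by rw [← mul_blockPerm_apply, ← mul_blockPerm_apply]; rfl)
  rw [stepBits_of_ne _ _ hb hb', blockDescent, blockDescent, Equiv.Perm.mul_apply,
    Equiv.Perm.mul_apply, blockPerm_apply_of_not _ _ (by omega),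
    blockPerm_apply_of_not _ _ (by omega)]

theorem blockValues_mul_of_ne (u : Equiv.Perm ℕ) {k b : ℕ} (m : Mask) (h1 : b ≠ k)
    (h2 : b ≠ k + 1) : blockValues (u * blockPerm k m) b = blockValues u b := by
  rw [blockValues, blockValues, Equiv.Perm.mul_apply,
    Equiv.Perm.mul_apply, blockPerm_apply_of_not _ _ (by omega),
    blockPerm_apply_of_not _ _ (by omega)]

theorem blockValues_mul_left (u : Equiv.Perm ℕ) (k : ℕ) (m : Mask) :
    blockValues (u * blockPerm k m) k =
      s(u (2 * k + (localPerm m 4 0).val), u (2 * k + (localPerm m 4 1).val)) := by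
  rw [← mul_blockPerm_apply, ← mul_blockPerm_apply]; rfl

theorem blockValues_mul_right (u : Equiv.Perm ℕ) (k : ℕ) (m : Mask) :
    blockValues (u * blockPerm k m) (k + 1) =
      s(u (2 * k + (localPerm m 4 2).val), u (2 * k + (localPerm m 4 3).val)) := by
  rw [← mul_blockPerm_apply, ← mul_blockPerm_apply]; rfl

theorem localPerm_of_class_zero : ∀ m : Mask, maskClass m = 0 →
    s(localPerm m 4 0, localPerm m 4 1) = s(0, 1) ∧
    s(localPerm m 4 2, localPerm m 4 3) = s(2, 3) := by decide +kernel

theorem localPerm_of_class_two : ∀ m : Mask, maskClass m = 2 →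
    s(localPerm m 4 0, localPerm m 4 1) = s(2, 3) ∧
    s(localPerm m 4 2, localPerm m 4 3) = s(0, 1) := by decide +kernel

/-- The points `x` and `y` are the ones exchanged between the two blocks, `x'` and `y'` those that
keep their block. So the smallest value moves if it sits at `x`, and the largest if it sits at `y`.
-/
theorem localPerm_of_class_one : ∀ m : Mask, maskClass m = 1 →
    ∃ x x' y y' : Fin 4, s(x, x') = s(0, 1) ∧ s(y, y') = s(2, 3) ∧
      s(localPerm m 4 0, localPerm m 4 1) = s(x', y) ∧
      s(localPerm m 4 2, localPerm m 4 3) = s(x, y') ∧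
      ∀ a b, (lowMoves m a b = true ↔ blockPattern a b x < blockPattern a b x') ∧
        (highMoves m a b = true ↔ blockPattern a b y' < blockPattern a b y) := by decide +kernel

theorem blockValues_eq_map (u : Equiv.Perm ℕ) (k : ℕ) :
    blockValues u k = Sym2.map (fun r : Fin 4 => u (2 * k + r.val)) s(0, 1) := rfl

theorem blockValues_succ_eq_map (u : Equiv.Perm ℕ) (k : ℕ) :
    blockValues u (k + 1) = Sym2.map (fun r : Fin 4 => u (2 * k + r.val)) s(2, 3) := rfl

theorem blockValues_mul_of_class_zero (u : Equiv.Perm ℕ) (k : ℕ) {m : Mask}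
    (h : maskClass m = 0) :
    blockValues (u * blockPerm k m) k = blockValues u k ∧
    blockValues (u * blockPerm k m) (k + 1) = blockValues u (k + 1) := by
  obtain ⟨h1, h2⟩ := localPerm_of_class_zero m h
  rw [blockValues_mul_left, blockValues_mul_right, blockValues_succ_eq_map u k, blockValues_eq_map u k,
    ← h1, ← h2]
  exact ⟨rfl, rfl⟩

theorem blockValues_mul_of_class_two (u : Equiv.Perm ℕ) (k : ℕ) {m : Mask}
    (h : maskClass m = 2) :
    blockValues (u * blockPerm k m) k = blockValues u (k + 1) ∧
    blockValues (u * blockPerm k m) (k + 1) = blockValues u k := by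
  obtain ⟨h1, h2⟩ := localPerm_of_class_two m h
  rw [blockValues_mul_left, blockValues_mul_right, blockValues_succ_eq_map u k, blockValues_eq_map u k,
    ← h1, ← h2]
  exact ⟨rfl, rfl⟩

theorem blockValues_mul_of_class_one {u : Equiv.Perm ℕ} {k : ℕ} (hs : Separates u k) {m : Mask}
    (h : maskClass m = 1) :
    ∃ x x' y y' : ℕ, blockValues u k = s(x, x') ∧ blockValues u (k + 1) = s(y, y') ∧
      blockValues (u * blockPerm k m) k = s(x', y) ∧
      blockValues (u * blockPerm k m) (k + 1) = s(x, y') ∧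
      (lowMoves m (blockDescent u k) (blockDescent u (k + 1)) = true ↔ x < x') ∧
      (highMoves m (blockDescent u k) (blockDescent u (k + 1)) = true ↔ y' < y) := by
  obtain ⟨x, x', y, y', h1, h2, h3, h4, h5⟩ := localPerm_of_class_one m h
  refine ⟨u (2 * k + x.val), u (2 * k + x'.val), u (2 * k + y.val), u (2 * k + y'.val),
    ?_, ?_, ?_, ?_, ?_, ?_⟩
  · rw [blockValues_eq_map, ← h1]; rfl
  · rw [blockValues_succ_eq_map, ← h2]; rfl
  · rw [blockValues_mul_left]
    exact congrArg (Sym2.map fun r : Fin 4 => u (2 * k + r.val)) h3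
  · rw [blockValues_mul_right]
    exact congrArg (Sym2.map fun r : Fin 4 => u (2 * k + r.val)) h4
  · rw [hs.pattern]; exact (h5 _ _).1
  · rw [hs.pattern]; exact (h5 _ _).2

theorem Separates.blockValues_lt {u : Equiv.Perm ℕ} {k x x' : ℕ} (h : Separates u k)
    (hx : blockValues u k = s(x, x')) : x < 2 * k + 2 ∧ x' < 2 * k + 2 := by
  have h0 := (h (2 * k)).2 (by omega)
  have h1 := (h (2 * k + 1)).2 (by omega)
  rcases Sym2.eq_iff.1 hx with ⟨rfl, rfl⟩ | ⟨rfl, rfl⟩ <;> exact ⟨by assumption, by assumption⟩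

theorem Separates.le_blockValues {u : Equiv.Perm ℕ} {k y y' : ℕ} (h : Separates u k)
    (hy : blockValues u (k + 1) = s(y, y')) : 2 * k + 2 ≤ y ∧ 2 * k + 2 ≤ y' := by
  have h0 : 2 * k + 2 ≤ u (2 * (k + 1)) := not_lt.1 fun h' => by have := (h _).1 h'; omega
  have h1 : 2 * k + 2 ≤ u (2 * (k + 1) + 1) := not_lt.1 fun h' => by have := (h _).1 h'; omega
  rcases Sym2.eq_iff.1 hy with ⟨rfl, rfl⟩ | ⟨rfl, rfl⟩ <;> exact ⟨by assumption, by assumption⟩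

/-! ### Runs of a word of blocks -/

/-- The descents of the blocks after a word, if those before it are `β`. -/
def runBits (β : ℕ → Bool) (L : List (ℕ × Mask)) : ℕ → Bool :=
  L.foldl (fun β x => stepBits x.1 x.2 β) β

/-- All masks of a word satisfy the constraints. -/
def GoodRun (C : ℕ → Mask → Bool → Bool → Prop) : (ℕ → Bool) → List (ℕ × Mask) → Prop
  | _, [] => True
  | β, x :: t => C x.1 x.2 (β x.1) (β (x.1 + 1)) ∧ GoodRun C (stepBits x.1 x.2 β) t

/-- The number of defects of a word of blocks. -/
def runDefect : (ℕ → Bool) → List (ℕ × Mask) → ℕ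
  | _, [] => 0
  | β, x :: t => localDefect x.2 (β x.1) (β (x.1 + 1)) + runDefect (stepBits x.1 x.2 β) t

/-- The sign of a word of blocks. -/
def runSign (L : List (ℕ × Mask)) : ℤ := (L.map fun x => maskSign x.2).prod

theorem runBits_concat (β : ℕ → Bool) (A : List (ℕ × Mask)) (k : ℕ) (m : Mask) :
    runBits β (A ++ [(k, m)]) = stepBits k m (runBits β A) := by
  simp [runBits]

theorem goodRun_append {C : ℕ → Mask → Bool → Bool → Prop} {β : ℕ → Bool}
    {A B : List (ℕ × Mask)} :
    GoodRun C β (A ++ B) ↔ GoodRun C β A ∧ GoodRun C (runBits β A) B := by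
  induction A generalizing β with
  | nil => simp [GoodRun, runBits]
  | cons x t ih => simp only [List.cons_append, GoodRun, ih, and_assoc]; rfl

theorem goodRun_concat {C : ℕ → Mask → Bool → Bool → Prop} {β : ℕ → Bool}
    {A : List (ℕ × Mask)} {k : ℕ} {m : Mask} :
    GoodRun C β (A ++ [(k, m)]) ↔
      GoodRun C β A ∧ C k m (runBits β A k) (runBits β A (k + 1)) := by
  simp [goodRun_append, GoodRun]

open Classical in
theorem transferWord_eq_sum (C : ℕ → Mask → Bool → Bool → Prop) {l : ℕ} (j : Fin l → ℕ)
    (β : ℕ → Bool) :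
    transferWord C (List.ofFn j) (fun _ => 1) β =
      ∑ y : Fin l → Mask, if GoodRun C β (List.ofFn fun i => (j i, y i)) then
        Polynomial.C (runSign (List.ofFn fun i => (j i, y i))) *
          Polynomial.X ^ runDefect β (List.ofFn fun i => (j i, y i)) else 0 := by
  induction l generalizing β with
  | zero => simp [transferWord, GoodRun, runSign, runDefect]
  | succ l ih =>
    rw [List.ofFn_succ]
    unfold transferWord at ih ⊢
    rw [List.foldr_cons, transfer, ← (Fin.consEquiv fun _ : Fin (l + 1) => Mask).sum_comp,
      Fintype.sum_prod_type]
    refine Finset.sum_congr rfl fun m _ => ?_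
    rw [ih, Finset.mul_sum]
    refine Finset.sum_congr rfl fun y _ => ?_
    simp only [Fin.consEquiv_apply, List.ofFn_succ, Fin.cons_zero, Fin.cons_succ, GoodRun,
      runSign, runDefect, List.map_cons, List.prod_cons, blockWeight]
    by_cases h1 : C (j 0) m (β (j 0)) (β (j 0 + 1))
    · by_cases h2 : GoodRun C (stepBits (j 0) m β) (List.ofFn fun i => (j i.succ, y i))
      · simp only [h1, h2, if_true, and_self, map_mul, pow_add]
        ring
      · simp [h2]
    · simp [h1]

theorem separates_wordPerm {k : ℕ} {A : List (ℕ × Mask)} (h : k ∉ A.map Prod.fst) :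
    Separates (wordPerm A) k := by
  have := preservesBelow_wordPerm (r := k + 1) (L := A) fun x hx hk =>
    h (List.mem_map.2 ⟨x, hx, by omega⟩)
  rwa [show 2 * (k + 1) = 2 * k + 2 by ring] at this

theorem nodup_concat {A : List (ℕ × Mask)} {k : ℕ} {m : Mask}
    (h : ((A ++ [(k, m)]).map Prod.fst).Nodup) :
    (A.map Prod.fst).Nodup ∧ k ∉ A.map Prod.fst := by
  rw [List.map_append, List.map_singleton, List.nodup_append] at h
  exact ⟨h.1, fun hk => h.2.2 k hk k (by simp) rfl⟩

/-- Each letter is new when it occurs, so the product of the earlier blocks separates its two pairs,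
and the formal update of the bits is the actual one. -/
theorem runBits_eq_blockDescent {A : List (ℕ × Mask)} (h : (A.map Prod.fst).Nodup) (b : ℕ) :
    runBits (fun _ => false) A b = blockDescent (wordPerm A) b := by
  induction A using List.reverseRecOn generalizing b with
  | nil => simp [runBits, blockDescent, wordPerm]
  | append_singleton A x ih =>
    obtain ⟨k, m⟩ := x
    obtain ⟨h1, h2⟩ := nodup_concat h
    rw [runBits_concat, wordPerm_concat, blockDescent_mul_blockPerm (separates_wordPerm h2)]
    congr 1
    exact funext fun b => ih h1 b

/-! ### Blocks between two letters of which only one has occurred -/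

/-- The two values come from a single block. -/
def SameLabel (z : Sym2 ℕ) : Prop := ∃ x y, z = s(x, y) ∧ x / 2 = y / 2

/-- One of the values comes from a block up to `k`, the other from the block `k + 1`. -/
def CarriesLow (z : Sym2 ℕ) (k : ℕ) : Prop := ∃ x y, z = s(x, y) ∧ x < 2 * k + 2 ∧ y / 2 = k + 1

/-- One of the values comes from the block `s`, the other from a block after it. -/
def CarriesHigh (z : Sym2 ℕ) (s : ℕ) : Prop := ∃ x y, z = s(x, y) ∧ x / 2 = s ∧ 2 * s + 2 ≤ y

theorem blockValues_of_untouched {A : List (ℕ × Mask)} {b : ℕ} (h1 : b ∉ A.map Prod.fst)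
    (h2 : ∀ t, b = t + 1 → t ∉ A.map Prod.fst) :
    blockValues (wordPerm A) b = s(2 * b, 2 * b + 1) := by
  have h : ∀ x ∈ A, x.1 + 1 ≠ b ∧ x.1 ≠ b := fun x hx =>
    ⟨fun hb => h2 x.1 hb.symm (List.mem_map.2 ⟨x, hx, rfl⟩),
      fun hb => h1 (List.mem_map.2 ⟨x, hx, hb⟩)⟩
  rw [blockValues, wordPerm_apply_of_untouched h (by omega), wordPerm_apply_of_untouched h (by omega)]

theorem before_of_prefix {ks : List ℕ} (hnd : ks.Nodup) {A : List (ℕ × Mask)} {k : ℕ} {m : Mask}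
    (h : (A ++ [(k, m)]).map Prod.fst <+: ks) (r : ℕ) :
    Before ks r k ↔ r ∈ A.map Prod.fst := by
  obtain ⟨B, rfl⟩ := h
  rw [List.map_append, List.map_singleton, List.append_assoc, List.singleton_append] at hnd ⊢
  exact before_append_cons hnd r

theorem prefix_of_concat {ks : List ℕ} {A : List (ℕ × Mask)} {k : ℕ} {m : Mask}
    (h : (A ++ [(k, m)]).map Prod.fst <+: ks) : A.map Prod.fst <+: ks := by
  rw [List.map_append] at h
  exact (List.prefix_append _ _).trans h

section Open

variable {ks : List ℕ} {c : ℕ → ℕ}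

/-- Before the letter `b`, only the letter `b-1` can have touched the block `b`. In class zero it
leaves the original values there. In class one it brings in one value from below and starts a chain.
In class two it hands over the values that the block `b-1` had before, and the argument is repeated
there. -/
theorem rightOpen (hnd : ks.Nodup) {A : List (ℕ × Mask)} (hA : A.map Prod.fst <+: ks)
    (hcls : ∀ x ∈ A, maskClass x.2 = c x.1) {b : ℕ} (hb : b ∉ A.map Prod.fst) :
    (∃ k, RightChain ks c k b ∧ b - 1 ∈ A.map Prod.fst ∧
      CarriesLow (blockValues (wordPerm A) b) k) ∨
    ((b - 1 ∈ A.map Prod.fst → ∀ k, ¬ RightChain ks c k b) ∧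
      SameLabel (blockValues (wordPerm A) b)) := by
  induction A using List.reverseRecOn generalizing b with
  | nil => exact Or.inr ⟨by simp, 2 * b, 2 * b + 1, rfl, by omega⟩
  | append_singleton A x ih =>
    obtain ⟨k, m⟩ := x
    obtain ⟨hndA, hkA⟩ := nodup_concat (hnd.sublist hA.sublist)
    have ih := fun b hb => ih (b := b) (prefix_of_concat hA)
      (fun x hx => hcls x (List.mem_append_left _ hx)) hb
    have hm : maskClass m = c k := hcls (k, m) (by simp)
    have hbef := before_of_prefix hnd hA (k - 1)
    simp only [List.map_append, List.map_singleton, List.mem_append, List.mem_singleton,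
      not_or] at hb ⊢
    rw [wordPerm_concat]
    by_cases hbk : b = k + 1
    swap
    · rw [blockValues_mul_of_ne _ _ hb.2 hbk]
      -- Subtraction is truncated: `b - 1 = k` with `b ≠ k + 1` means `b = k = 0`, which `b ≠ k`
      -- excludes.
      have : b - 1 ≠ k ∨ b = 0 ∧ k = 0 := by omega
      rcases this with h | h
      · simpa [h] using ih b hb.1
      · omega
    subst hbk
    have hold : blockValues (wordPerm A) (k + 1) = s(2 * (k + 1), 2 * (k + 1) + 1) :=
      blockValues_of_untouched hb.1 fun t ht => by
        obtain rfl : k = t := by omega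
        exact hkA
    rcases (show maskClass m = 0 ∨ maskClass m = 1 ∨ maskClass m = 2 by
      unfold maskClass; split_ifs <;> omega) with h0 | h1 | h2
    · right
      rw [(blockValues_mul_of_class_zero _ _ h0).2, hold]
      refine ⟨fun _ k' hk' => ?_, _, _, rfl, by omega⟩
      rcases rightChain_succ_iff.1 hk' with h | h <;> omega
    · left
      obtain ⟨x, x', y, y', e1, e2, e3, e4, -⟩ :=
        blockValues_mul_of_class_one (separates_wordPerm hkA) h1
      have := ((separates_wordPerm hkA).blockValues_lt e1).1
      refine ⟨k, rightChain_succ_iff.2 (Or.inl ⟨rfl, hm ▸ h1⟩), Or.inr (by omega), x, y', e4, this, ?_⟩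
      rw [hold] at e2
      rcases Sym2.eq_iff.1 e2 with ⟨rfl, rfl⟩ | ⟨rfl, rfl⟩ <;> omega
    · rw [(blockValues_mul_of_class_two _ _ h2).2]
      rcases ih k hkA with ⟨k', hk', hmem, hlow⟩ | ⟨hno, hsame⟩
      · left
        exact ⟨k', rightChain_succ_iff.2 (Or.inr ⟨hm ▸ h2, hk', hbef.2 hmem⟩),
          Or.inr (by omega), hlow⟩
      · right
        refine ⟨fun _ k' hk' => ?_, hsame⟩
        rcases rightChain_succ_iff.1 hk' with h | h
        · omega
        · exact hno (hbef.1 h.2.2) k' h.2.1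

/-- Mirror image of `rightOpen`: before the letter `t`, only the letter `t+1` can have touched the
block `t+1`. -/
theorem leftOpen (hnd : ks.Nodup) {A : List (ℕ × Mask)} (hA : A.map Prod.fst <+: ks)
    (hcls : ∀ x ∈ A, maskClass x.2 = c x.1) {t : ℕ} (ht : t ∉ A.map Prod.fst) :
    (∃ s, LeftChain ks c (t + 1) s ∧ t + 1 ∈ A.map Prod.fst ∧
      CarriesHigh (blockValues (wordPerm A) (t + 1)) s) ∨
    ((t + 1 ∈ A.map Prod.fst → ∀ s, ¬ LeftChain ks c (t + 1) s) ∧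
      SameLabel (blockValues (wordPerm A) (t + 1))) := by
  induction A using List.reverseRecOn generalizing t with
  | nil => exact Or.inr ⟨by simp, 2 * (t + 1), 2 * (t + 1) + 1, rfl, by omega⟩
  | append_singleton A x ih =>
    obtain ⟨k, m⟩ := x
    obtain ⟨hndA, hkA⟩ := nodup_concat (hnd.sublist hA.sublist)
    have ih := fun t ht => ih (t := t) (prefix_of_concat hA)
      (fun x hx => hcls x (List.mem_append_left _ hx)) ht
    have hm : maskClass m = c k := hcls (k, m) (by simp)
    have hbef := before_of_prefix hnd hA (k + 1)
    simp only [List.map_append, List.map_singleton, List.mem_append, List.mem_singleton,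
      not_or] at ht ⊢
    rw [wordPerm_concat]
    by_cases htk : t + 1 = k
    swap
    · rw [blockValues_mul_of_ne _ _ htk (by omega)]
      simpa [htk] using ih t ht.1
    subst htk
    have hold : blockValues (wordPerm A) (t + 1) = s(2 * (t + 1), 2 * (t + 1) + 1) :=
      blockValues_of_untouched hkA fun t' ht' => by
        obtain rfl : t = t' := by omega
        exact ht.1
    rcases (show maskClass m = 0 ∨ maskClass m = 1 ∨ maskClass m = 2 by
      unfold maskClass; split_ifs <;> omega) with h0 | h1 | h2
    · right
      rw [(blockValues_mul_of_class_zero _ _ h0).1, hold]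
      refine ⟨fun _ k' hk' => ?_, _, _, rfl, by omega⟩
      rcases leftChain_iff.1 hk' with h | h <;> omega
    · left
      obtain ⟨x, x', y, y', e1, e2, e3, e4, -⟩ :=
        blockValues_mul_of_class_one (separates_wordPerm hkA) h1
      have := ((separates_wordPerm hkA).le_blockValues e2).1
      refine ⟨t + 1, leftChain_iff.2 (Or.inl ⟨rfl, hm ▸ h1⟩), Or.inr rfl, x', y, e3, ?_, this⟩
      rw [hold] at e1
      rcases Sym2.eq_iff.1 e1 with ⟨rfl, rfl⟩ | ⟨rfl, rfl⟩ <;> omega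
    · rw [(blockValues_mul_of_class_two _ _ h2).1]
      rcases ih (t + 1) hkA with ⟨k', hk', hmem, hlow⟩ | ⟨hno, hsame⟩
      · left
        exact ⟨k', leftChain_iff.2 (Or.inr ⟨hm ▸ h2, hk', hbef.2 hmem⟩), Or.inr rfl, hlow⟩
      · right
        refine ⟨fun _ k' hk' => ?_, hsame⟩
        rcases leftChain_iff.1 hk' with h | h
        · omega
        · exact hno (hbef.1 h.2.2) k' h.2.1

end Open

/-! ### Points that cross -/

/-- Some point `p ≥ a` has `g p < b`. -/
def CrossOne (g : Equiv.Perm ℕ) (a b : ℕ) : Prop := ∃ p, a ≤ p ∧ g p < b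

/-- Two points `p ≥ a` have `g p < b`. -/
def CrossTwo (g : Equiv.Perm ℕ) (a b : ℕ) : Prop :=
  ∃ p q, p ≠ q ∧ a ≤ p ∧ a ≤ q ∧ g p < b ∧ g q < b

theorem PreservesBelow.inv {a : ℕ} {g : Equiv.Perm ℕ} (h : PreservesBelow a g) :
    PreservesBelow a g⁻¹ := fun p => by
  rw [← h, Equiv.Perm.inv_def, Equiv.apply_symm_apply]

theorem crossOne_mul_right {g h : Equiv.Perm ℕ} {a : ℕ} (hh : PreservesBelow a h) (b : ℕ) :
    CrossOne (g * h) a b ↔ CrossOne g a b := by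
  constructor
  · rintro ⟨p, h1, h2⟩
    exact ⟨h p, not_lt.1 fun h' => by have := (hh p).1 h'; omega, h2⟩
  · rintro ⟨p, h1, h2⟩
    refine ⟨h⁻¹ p, not_lt.1 fun h' => by have := (hh.inv p).1 h'; omega, ?_⟩
    rwa [Equiv.Perm.mul_apply, Equiv.Perm.inv_def, Equiv.apply_symm_apply]

theorem crossTwo_mul_right {g h : Equiv.Perm ℕ} {a : ℕ} (hh : PreservesBelow a h) (b : ℕ) :
    CrossTwo (g * h) a b ↔ CrossTwo g a b := by
  constructor
  · rintro ⟨p, q, h0, h1, h1', h2⟩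
    exact ⟨h p, h q, h.injective.ne h0, not_lt.1 fun h' => by have := (hh p).1 h'; omega,
      not_lt.1 fun h' => by have := (hh q).1 h'; omega, h2⟩
  · rintro ⟨p, q, h0, h1, h1', h2⟩
    refine ⟨h⁻¹ p, h⁻¹ q, h⁻¹.injective.ne h0,
      not_lt.1 fun h' => by have := (hh.inv p).1 h'; omega,
      not_lt.1 fun h' => by have := (hh.inv q).1 h'; omega, ?_⟩
    rwa [Equiv.Perm.mul_apply, Equiv.Perm.inv_def, Equiv.apply_symm_apply, Equiv.Perm.mul_apply,
      Equiv.apply_symm_apply]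

theorem crossOne_mul_left {g h : Equiv.Perm ℕ} {b : ℕ} (hg : PreservesBelow b g) (a : ℕ) :
    CrossOne (g * h) a b ↔ CrossOne h a b :=
  exists_congr fun p => and_congr_right fun _ => hg (h p)

theorem crossTwo_mul_left {g h : Equiv.Perm ℕ} {b : ℕ} (hg : PreservesBelow b g) (a : ℕ) :
    CrossTwo (g * h) a b ↔ CrossTwo h a b :=
  exists_congr fun p => exists_congr fun q => and_congr_right fun _ => and_congr_right fun _ =>
    and_congr_right fun _ => and_congr (hg (h p)) (hg (h q))

theorem localPerm_low_iff : ∀ m : Mask,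
    ((∃ r : Fin 4, 2 ≤ r.val ∧ (localPerm m 4 r).val < 2) ↔ 1 ≤ maskClass m) ∧
    ((∃ r s : Fin 4, r ≠ s ∧ 2 ≤ r.val ∧ 2 ≤ s.val ∧ (localPerm m 4 r).val < 2 ∧
      (localPerm m 4 s).val < 2) ↔ 2 ≤ maskClass m) := by decide +kernel

theorem exists_of_blockPerm_lt {k : ℕ} {m : Mask} {p : ℕ} (h1 : 2 * k + 2 ≤ p)
    (h2 : blockPerm k m p < 2 * k + 2) :
    ∃ r : Fin 4, p = 2 * k + r.val ∧ 2 ≤ r.val ∧ (localPerm m 4 r).val < 2 := by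
  by_cases hp : p < 2 * k ∨ 2 * k + 4 ≤ p
  · rw [blockPerm_apply_of_not _ _ hp] at h2
    omega
  · obtain ⟨i, rfl⟩ : ∃ i : Fin 4, p = 2 * k + i.val := ⟨⟨p - 2 * k, by omega⟩, by simp; omega⟩
    rw [blockPerm_apply] at h2
    exact ⟨i, rfl, by omega, by omega⟩

theorem crossOne_blockPerm (k : ℕ) (m : Mask) :
    CrossOne (blockPerm k m) (2 * k + 2) (2 * k + 2) ↔ 1 ≤ maskClass m := by
  rw [← (localPerm_low_iff m).1]
  constructor
  · rintro ⟨p, h1, h2⟩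
    obtain ⟨r, -, h3, h4⟩ := exists_of_blockPerm_lt h1 h2
    exact ⟨r, h3, h4⟩
  · rintro ⟨r, h3, h4⟩
    exact ⟨2 * k + r.val, by omega, by rw [blockPerm_apply]; omega⟩

theorem crossTwo_blockPerm (k : ℕ) (m : Mask) :
    CrossTwo (blockPerm k m) (2 * k + 2) (2 * k + 2) ↔ 2 ≤ maskClass m := by
  rw [← (localPerm_low_iff m).2]
  constructor
  · rintro ⟨p, q, h0, h1, h1', h2, h2'⟩
    obtain ⟨r, rfl, h3, h4⟩ := exists_of_blockPerm_lt h1 h2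
    obtain ⟨s, rfl, h5, h6⟩ := exists_of_blockPerm_lt h1' h2'
    exact ⟨r, s, fun h => h0 (by rw [h]), h3, h5, h4, h6⟩
  · rintro ⟨r, s, h0, h3, h5, h4, h6⟩
    exact ⟨2 * k + r.val, 2 * k + s.val, fun h => h0 (Fin.ext (by omega)), by omega, by omega,
      by rw [blockPerm_apply]; omega, by rw [blockPerm_apply]; omega⟩

/-- Some point `p < a` has `b ≤ g p`. -/
def RiseOne (g : Equiv.Perm ℕ) (a b : ℕ) : Prop := ∃ p, p < a ∧ b ≤ g p

/-- Two points `p < a` have `b ≤ g p`. -/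
def RiseTwo (g : Equiv.Perm ℕ) (a b : ℕ) : Prop :=
  ∃ p q, p ≠ q ∧ p < a ∧ q < a ∧ b ≤ g p ∧ b ≤ g q

theorem riseOne_iff {g : Equiv.Perm ℕ} {a b : ℕ} : RiseOne g a b ↔ CrossOne g⁻¹ b a := by
  constructor
  · rintro ⟨p, h1, h2⟩
    exact ⟨g p, h2, by rwa [Equiv.Perm.inv_def, Equiv.symm_apply_apply]⟩
  · rintro ⟨p, h1, h2⟩
    exact ⟨g⁻¹ p, h2, by rwa [Equiv.Perm.inv_def, Equiv.apply_symm_apply]⟩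

theorem riseTwo_iff {g : Equiv.Perm ℕ} {a b : ℕ} : RiseTwo g a b ↔ CrossTwo g⁻¹ b a := by
  constructor
  · rintro ⟨p, q, h0, h1, h1', h2, h2'⟩
    exact ⟨g p, g q, g.injective.ne h0, h2, h2', by rwa [Equiv.Perm.inv_def, Equiv.symm_apply_apply],
      by rwa [Equiv.Perm.inv_def, Equiv.symm_apply_apply]⟩
  · rintro ⟨p, q, h0, h1, h1', h2, h2'⟩
    exact ⟨g⁻¹ p, g⁻¹ q, g⁻¹.injective.ne h0, h2, h2',
      by rwa [Equiv.Perm.inv_def, Equiv.apply_symm_apply],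
      by rwa [Equiv.Perm.inv_def, Equiv.apply_symm_apply]⟩

theorem riseOne_mul_right {g h : Equiv.Perm ℕ} {a : ℕ} (hh : PreservesBelow a h) (b : ℕ) :
    RiseOne (g * h) a b ↔ RiseOne g a b := by
  rw [riseOne_iff, riseOne_iff, mul_inv_rev, crossOne_mul_left hh.inv]

theorem riseTwo_mul_right {g h : Equiv.Perm ℕ} {a : ℕ} (hh : PreservesBelow a h) (b : ℕ) :
    RiseTwo (g * h) a b ↔ RiseTwo g a b := by
  rw [riseTwo_iff, riseTwo_iff, mul_inv_rev, crossTwo_mul_left hh.inv]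

/-! ### Crossing points of the products of the masks -/

section Crossing

variable {ks : List ℕ} {c : ℕ → ℕ} {A B : List (ℕ × Mask)} {k : ℕ} {m : Mask}

theorem map_fst_split (hks : (A ++ (k, m) :: B).map Prod.fst = ks) (hnd : ks.Nodup) :
    (A ++ [(k, m)]).map Prod.fst <+: ks ∧ A.map Prod.fst <+: ks ∧ k ∉ A.map Prod.fst ∧
      k ∉ B.map Prod.fst ∧ ∀ r ∈ A.map Prod.fst, r ∉ B.map Prod.fst := by
  subst hks
  have h1 : (A ++ [(k, m)]).map Prod.fst <+: (A ++ (k, m) :: B).map Prod.fst :=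
    ⟨B.map Prod.fst, by simp⟩
  rw [List.map_append, List.map_cons] at hnd
  obtain ⟨h2, h3, h4⟩ := List.nodup_append.1 hnd
  exact ⟨h1, prefix_of_concat h1, fun h => h4 k h k (by simp) rfl, (List.nodup_cons.1 h3).1,
    fun r hr hr' => h4 r hr r (by simp [hr']) rfl⟩

theorem wordPerm_split : wordPerm (A ++ (k, m) :: B) = wordPerm A * blockPerm k m * wordPerm B := by
  rw [wordPerm_append, wordPerm_cons, mul_assoc]

theorem preservesBelow_of_notMem {r : ℕ} {L : List (ℕ × Mask)} (h : r ∉ L.map Prod.fst) :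
    PreservesBelow (2 * r + 2) (wordPerm L) := separates_wordPerm h

/-- All blocks other than that of `k` preserve the cut `2k+2`, so the crossings of the whole product
are those of the mask of `k`. -/
theorem crossing_class (hks : (A ++ (k, m) :: B).map Prod.fst = ks) (hnd : ks.Nodup) :
    (CrossOne (wordPerm (A ++ (k, m) :: B)) (2 * k + 2) (2 * k + 2) ↔ 1 ≤ maskClass m) ∧
    (CrossTwo (wordPerm (A ++ (k, m) :: B)) (2 * k + 2) (2 * k + 2) ↔ 2 ≤ maskClass m) := by
  obtain ⟨-, -, hkA, hkB, -⟩ := map_fst_split hks hnd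
  rw [wordPerm_split, crossOne_mul_right (preservesBelow_of_notMem hkB),
    crossOne_mul_left (preservesBelow_of_notMem hkA), crossOne_blockPerm,
    crossTwo_mul_right (preservesBelow_of_notMem hkB),
    crossTwo_mul_left (preservesBelow_of_notMem hkA), crossTwo_blockPerm]
  exact ⟨Iff.rfl, Iff.rfl⟩

theorem carriesLow_of_rightLink (hks : (A ++ (k, m) :: B).map Prod.fst = ks) (hnd : ks.Nodup)
    (hcls : ∀ x ∈ A, maskClass x.2 = c x.1) {k' : ℕ} (hch : RightChain ks c k' k)
    (hb : Before ks (k - 1) k) :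
    k - 1 ∈ A.map Prod.fst ∧ CarriesLow (blockValues (wordPerm A) k) k' := by
  obtain ⟨h1, h2, hkA, -, -⟩ := map_fst_split hks hnd
  have hmem := (before_of_prefix hnd h1 (k - 1)).1 hb
  rcases rightOpen hnd h2 hcls hkA with ⟨k'', h3, -, h4⟩ | ⟨h3, -⟩
  · rw [hch.source_unique h3]
    exact ⟨hmem, h4⟩
  · exact absurd hch (h3 hmem k')

theorem carriesHigh_of_leftLink (hks : (A ++ (k, m) :: B).map Prod.fst = ks) (hnd : ks.Nodup)
    (hcls : ∀ x ∈ A, maskClass x.2 = c x.1) {s : ℕ} (hch : LeftChain ks c (k + 1) s)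
    (hb : Before ks (k + 1) k) :
    k + 1 ∈ A.map Prod.fst ∧ CarriesHigh (blockValues (wordPerm A) (k + 1)) s := by
  obtain ⟨h1, h2, hkA, -, -⟩ := map_fst_split hks hnd
  have hmem := (before_of_prefix hnd h1 (k + 1)).1 hb
  rcases leftOpen hnd h2 hcls hkA with ⟨s', h3, -, h4⟩ | ⟨h3, -⟩
  · rw [hch.source_unique h3]
    exact ⟨hmem, h4⟩
  · exact absurd hch (h3 hmem s)

/-- Just before `k`, the block `k` carries a value below `2k'+2` and one from the block `k'+1`. Both
are below `2k'+4`, and `k` and the later letters keep them at positions from `2k` on; this makes the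
second count in the Bruhat condition automatic. The letter `k` takes one of the two past the cut
`2k+2`, and later letters preserve that cut; it is the low one exactly if the smallest of the four
values moves. -/
theorem crossing_right (hks : (A ++ (k, m) :: B).map Prod.fst = ks) (hnd : ks.Nodup)
    (hcls : ∀ x ∈ A, maskClass x.2 = c x.1) (hm : maskClass m = 1) {k' : ℕ}
    (hch : RightChain ks c k' k) (hb : Before ks (k - 1) k) :
    CrossTwo (wordPerm (A ++ (k, m) :: B)) (2 * k) (2 * k' + 4) ∧
    (CrossOne (wordPerm (A ++ (k, m) :: B)) (2 * k + 2) (2 * k' + 2) ↔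
      lowMoves m (runBits (fun _ => false) A k) (runBits (fun _ => false) A (k + 1)) = true) := by
  obtain ⟨h1, h2, hkA, hkB, hAB⟩ := map_fst_split hks hnd
  obtain ⟨hmem, z, w, hzw, hz, hw⟩ := carriesLow_of_rightLink hks hnd hcls hch hb
  have hlt := hch.lt
  have hsep := separates_wordPerm hkA
  have hndA : (A.map Prod.fst).Nodup := hnd.sublist h2.sublist
  rw [runBits_eq_blockDescent hndA, runBits_eq_blockDescent hndA, wordPerm_split]
  constructor
  · rw [mul_assoc, crossTwo_mul_right]
    · refine ⟨2 * k, 2 * k + 1, by omega, le_rfl, by omega, ?_⟩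
      rcases Sym2.eq_iff.1 hzw with ⟨rfl, rfl⟩ | ⟨rfl, rfl⟩ <;> omega
    · have h3 := preservesBelow_of_notMem (hAB _ hmem)
      rw [show 2 * (k - 1) + 2 = 2 * k by omega] at h3
      exact (preservesBelow_blockPerm m (by omega)).mul h3
  · rw [crossOne_mul_right (preservesBelow_of_notMem hkB)]
    obtain ⟨x, x', y, y', e1, e2, e3, e4, e5, -⟩ := blockValues_mul_of_class_one hsep hm
    rw [e5]
    have hy := hsep.le_blockValues e2
    have hx : x = z ∧ x' = w ∨ x = w ∧ x' = z := by
      rw [e1] at hzw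
      exact Sym2.eq_iff.1 hzw
    constructor
    · rintro ⟨p, hp1, hp2⟩
      by_cases hp : 2 * k + 4 ≤ p
      · rw [Equiv.Perm.mul_apply, blockPerm_apply_of_not _ _ (Or.inr hp)] at hp2
        have := (hsep p).1 (by omega)
        omega
      · have hp' : p = 2 * (k + 1) ∨ p = 2 * (k + 1) + 1 := by omega
        rcases hp' with rfl | rfl <;> rcases Sym2.eq_iff.1 e4 with ⟨f1, f2⟩ | ⟨f1, f2⟩ <;> omega
    · intro hlow
      have hx' : x < 2 * k' + 2 := by omega
      rcases Sym2.eq_iff.1 e4 with ⟨f1, f2⟩ | ⟨f1, f2⟩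
      · exact ⟨2 * (k + 1), by omega, by omega⟩
      · exact ⟨2 * (k + 1) + 1, by omega, by omega⟩

/-- Mirror image of `crossing_right`, with high values that move to the left. Stated for rising
points, it becomes the condition on `u⁻¹` by `riseOne_iff` and `riseTwo_iff`. -/
theorem crossing_left (hks : (A ++ (k, m) :: B).map Prod.fst = ks) (hnd : ks.Nodup)
    (hcls : ∀ x ∈ A, maskClass x.2 = c x.1) (hm : maskClass m = 1) {s : ℕ}
    (hch : LeftChain ks c (k + 1) s) (hb : Before ks (k + 1) k) :
    RiseTwo (wordPerm (A ++ (k, m) :: B)) (2 * k + 4) (2 * s) ∧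
    (RiseOne (wordPerm (A ++ (k, m) :: B)) (2 * k + 2) (2 * s + 2) ↔
      highMoves m (runBits (fun _ => false) A k) (runBits (fun _ => false) A (k + 1)) = true) := by
  obtain ⟨h1, h2, hkA, hkB, hAB⟩ := map_fst_split hks hnd
  obtain ⟨hmem, z, w, hzw, hz, hw⟩ := carriesHigh_of_leftLink hks hnd hcls hch hb
  have hlt := hch.le
  have hsep := separates_wordPerm hkA
  have hndA : (A.map Prod.fst).Nodup := hnd.sublist h2.sublist
  rw [runBits_eq_blockDescent hndA, runBits_eq_blockDescent hndA, wordPerm_split]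
  constructor
  · rw [mul_assoc, riseTwo_mul_right]
    · refine ⟨2 * (k + 1), 2 * (k + 1) + 1, by omega, by omega, by omega, ?_⟩
      rcases Sym2.eq_iff.1 hzw with ⟨rfl, rfl⟩ | ⟨rfl, rfl⟩ <;> omega
    · have h3 := preservesBelow_of_notMem (hAB _ hmem)
      exact (preservesBelow_blockPerm (r := k + 2) m (by omega)).mul h3
  · rw [riseOne_mul_right (preservesBelow_of_notMem hkB)]
    obtain ⟨x, x', y, y', e1, e2, e3, e4, -, e5⟩ := blockValues_mul_of_class_one hsep hm
    rw [e5]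
    have hy := hsep.blockValues_lt e1
    have hx : y = z ∧ y' = w ∨ y = w ∧ y' = z := by
      rw [e2] at hzw
      exact Sym2.eq_iff.1 hzw
    constructor
    · rintro ⟨p, hp1, hp2⟩
      by_cases hp : p < 2 * k
      · rw [Equiv.Perm.mul_apply, blockPerm_apply_of_not _ _ (Or.inl hp)] at hp2
        have := (hsep p).2 (by omega)
        omega
      · have hp' : p = 2 * k ∨ p = 2 * k + 1 := by omega
        rcases hp' with rfl | rfl <;> rcases Sym2.eq_iff.1 e3 with ⟨f1, f2⟩ | ⟨f1, f2⟩ <;> omega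
    · intro hlow
      have hx' : 2 * s + 2 ≤ y := by omega
      rcases Sym2.eq_iff.1 e3 with ⟨f1, f2⟩ | ⟨f1, f2⟩
      · exact ⟨2 * k + 1, by omega, by omega⟩
      · exact ⟨2 * k, by omega, by omega⟩

end Crossing

/-! ### Labels -/

theorem GoodRun.maskClass_eq {ks : List ℕ} {c : ℕ → ℕ} {I : ℕ → Prop} {β : ℕ → Bool}
    {L : List (ℕ × Mask)} (h : GoodRun (Constraint ks c I) β L) :
    ∀ x ∈ L, maskClass x.2 = c x.1 := by
  induction L generalizing β with
  | nil => simp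
  | cons y t ih =>
    intro x hx
    rcases List.mem_cons.1 hx with rfl | hx
    · exact h.1.cls
    · exact ih h.2 x hx

/-- The blocks from which the two values on a block come are determined by the constraints. -/
theorem labels_eq {ks : List ℕ} {c : ℕ → ℕ} {I : ℕ → Prop} (hnd : ks.Nodup)
    {Z : List (ℕ × Mask × Mask)} (hZ : Z.map Prod.fst <+: ks)
    (h1 : GoodRun (Constraint ks c I) (fun _ => false) (Z.map fun z => (z.1, z.2.1)))
    (h2 : GoodRun (Constraint ks c I) (fun _ => false) (Z.map fun z => (z.1, z.2.2))) (b : ℕ) :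
    (blockValues (wordPerm (Z.map fun z => (z.1, z.2.1))) b).map (· / 2) =
      (blockValues (wordPerm (Z.map fun z => (z.1, z.2.2))) b).map (· / 2) := by
  induction Z using List.reverseRecOn generalizing b with
  | nil => rfl
  | append_singleton Z z ih =>
    obtain ⟨k, m, m'⟩ := z
    have e1 : (Z.map fun z => (z.1, z.2.1)).map Prod.fst = Z.map Prod.fst := by simp
    have e2 : (Z.map fun z => (z.1, z.2.2)).map Prod.fst = Z.map Prod.fst := by simp
    rw [List.map_append, List.map_singleton] at h1 h2
    obtain ⟨g1, g1'⟩ := goodRun_concat.1 h1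
    obtain ⟨g2, g2'⟩ := goodRun_concat.1 h2
    have hZ1 : ((Z.map fun z => (z.1, z.2.1)) ++ [(k, m)]).map Prod.fst <+: ks := by
      simpa [Function.comp_def] using hZ
    have hZ2 : ((Z.map fun z => (z.1, z.2.2)) ++ [(k, m')]).map Prod.fst <+: ks := by
      simpa [Function.comp_def] using hZ
    have hpre := prefix_of_concat hZ1
    obtain ⟨hndA, hkA⟩ := nodup_concat (hnd.sublist hZ1.sublist)
    obtain ⟨hndA', hkA'⟩ := nodup_concat (hnd.sublist hZ2.sublist)
    rw [e1] at hpre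
    have ih := fun b => ih hpre g1 g2 b
    rw [List.map_append, List.map_append, List.map_singleton, List.map_singleton,
      wordPerm_concat, wordPerm_concat]
    by_cases hb : b = k ∨ b = k + 1
    swap
    · rw [blockValues_mul_of_ne _ _ (by omega) (by omega),
        blockValues_mul_of_ne _ _ (by omega) (by omega), ih]
    rcases (show maskClass m = 0 ∨ maskClass m = 1 ∨ maskClass m = 2 by
      unfold maskClass; split_ifs <;> omega) with c0 | c1 | c2
    · have c0' : maskClass m' = 0 := by rw [g2'.cls, ← g1'.cls, c0]
      rcases hb with rfl | rfl
      · rw [(blockValues_mul_of_class_zero _ _ c0).1, (blockValues_mul_of_class_zero _ _ c0').1, ih]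
      · rw [(blockValues_mul_of_class_zero _ _ c0).2, (blockValues_mul_of_class_zero _ _ c0').2, ih]
    swap
    · have c2' : maskClass m' = 2 := by rw [g2'.cls, ← g1'.cls, c2]
      rcases hb with rfl | rfl
      · rw [(blockValues_mul_of_class_two _ _ c2).1, (blockValues_mul_of_class_two _ _ c2').1, ih]
      · rw [(blockValues_mul_of_class_two _ _ c2).2, (blockValues_mul_of_class_two _ _ c2').2, ih]
    have c1' : maskClass m' = 1 := by rw [g2'.cls, ← g1'.cls, c1]
    obtain ⟨x, x', y, y', a1, a2, a3, a4, a5, a6⟩ :=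
      blockValues_mul_of_class_one (separates_wordPerm hkA) c1
    obtain ⟨u, u', v, v', b1, b2, b3, b4, b5, b6⟩ :=
      blockValues_mul_of_class_one (separates_wordPerm hkA') c1'
    rw [runBits_eq_blockDescent hndA, runBits_eq_blockDescent hndA] at g1'
    rw [runBits_eq_blockDescent hndA', runBits_eq_blockDescent hndA'] at g2'
    have l1 := ih k
    have l2 := ih (k + 1)
    rw [a1, b1, Sym2.map_mk, Sym2.map_mk, Sym2.eq_iff] at l1
    rw [a2, b2, Sym2.map_mk, Sym2.map_mk, Sym2.eq_iff] at l2
    -- Either both values on the block come from one block, and it does not matter which of them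
    -- moves, or a right link ends at `k` and its flag says which one moves. The right pair is
    -- treated in the same way with left links.
    have hx : x / 2 = u / 2 ∧ x' / 2 = u' / 2 := by
      rcases rightOpen hnd (prefix_of_concat hZ1) g1.maskClass_eq hkA with
        ⟨k', h3, h4, -⟩ | ⟨-, z, w, h3, h4⟩
      · have hlink : RightLink ks c k' k :=
          ⟨h3, (before_of_prefix hnd hZ1 (k - 1)).2 h4, g1'.cls ▸ c1⟩
        have i1 := a5.symm.trans (g1'.low k' hlink)
        have i2 := b5.symm.trans (g2'.low k' hlink)
        have i3 := i1.trans i2.symm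
        omega
      · rw [a1] at h3
        have := Sym2.eq_iff.1 h3
        have h5 : x / 2 = x' / 2 := by rcases this with ⟨rfl, rfl⟩ | ⟨rfl, rfl⟩ <;> omega
        omega
    have hy : y / 2 = v / 2 ∧ y' / 2 = v' / 2 := by
      rcases leftOpen hnd (prefix_of_concat hZ1) g1.maskClass_eq hkA with
        ⟨k', h3, h4, -⟩ | ⟨-, z, w, h3, h4⟩
      · have hlink : LeftLink ks c k k' :=
          ⟨h3, (before_of_prefix hnd hZ1 (k + 1)).2 h4, g1'.cls ▸ c1⟩
        have i1 := a6.symm.trans (g1'.high k' hlink)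
        have i2 := b6.symm.trans (g2'.high k' hlink)
        have i3 := i1.trans i2.symm
        omega
      · rw [a2] at h3
        have := Sym2.eq_iff.1 h3
        have h5 : y / 2 = y' / 2 := by rcases this with ⟨rfl, rfl⟩ | ⟨rfl, rfl⟩ <;> omega
        omega
    rcases hb with rfl | rfl
    · rw [a3, b3, Sym2.map_mk, Sym2.map_mk]
      rw [hx.2, hy.1]
    · rw [a4, b4, Sym2.map_mk, Sym2.map_mk]
      rw [hx.1, hy.2]

/-! ### Neighbors and links -/

theorem before_ofFn {l : ℕ} {j : Fin l → ℕ} (hj : Function.Injective j) {i i' : Fin l} :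
    Before (List.ofFn j) (j i) (j i') ↔ i < i' := by
  have h : ∀ i i' : Fin l, i < i' → Before (List.ofFn j) (j i) (j i') := by
    have : (List.ofFn j).Pairwise (Before (List.ofFn j)) :=
      List.pairwise_iff_forall_sublist.2 fun h => h
    exact List.pairwise_ofFn.1 this
  refine ⟨fun hb => ?_, h i i'⟩
  rcases lt_trichotomy i i' with hlt | rfl | hlt
  · exact hlt
  · exact absurd rfl (hb.ne (List.nodup_ofFn.2 hj))
  · exact absurd (h _ _ hlt) (hb.asymm (List.nodup_ofFn.2 hj))

open Classical in
/-- The class of a letter according to a triplet. -/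
noncomputable def letterClass {l : ℕ} (j : Fin l → ℕ) (Q : Triplet l) (k : ℕ) : ℕ :=
  if ∃ i ∈ Q.If, j i = k then 2 else if ∃ i ∈ Q.Ie, j i = k then 1 else 0

/-- The letter belongs to an index in the middle component of a triplet. -/
def letterFlag {l : ℕ} (j : Fin l → ℕ) (Q : Triplet l) (k : ℕ) : Prop := ∃ i ∈ Q.I, j i = k

section Neighbors

variable {l : ℕ} {j : Fin l → ℕ} {Q : Triplet l}

theorem letterClass_apply (hj : Function.Injective j) (i : Fin l) :
    letterClass j Q (j i) = if i ∈ Q.If then 2 else if i ∈ Q.Ie then 1 else 0 := by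
  classical
  have h : ∀ S : Finset (Fin l), (∃ i' ∈ S, j i' = j i) ↔ i ∈ S := fun S =>
    ⟨fun ⟨i', h1, h2⟩ => hj h2 ▸ h1, fun h => ⟨i, h, rfl⟩⟩
  unfold letterClass
  simp only [h]

theorem letterFlag_apply (hj : Function.Injective j) (i : Fin l) :
    letterFlag j Q (j i) ↔ i ∈ Q.I :=
  ⟨fun ⟨_, h1, h2⟩ => hj h2 ▸ h1, fun h => ⟨i, h, rfl⟩⟩

theorem letterClass_le (k : ℕ) : letterClass j Q k ≤ 2 := by
  unfold letterClass
  split_ifs <;> omega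

theorem letterClass_eq_one (hj : Function.Injective j) {i : Fin l} :
    letterClass j Q (j i) = 1 ↔ i ∈ Q.Ie \ Q.If := by
  rw [letterClass_apply hj, Finset.mem_sdiff]
  split_ifs <;> simp_all

theorem letterClass_eq_two (hj : Function.Injective j) {i : Fin l} :
    letterClass j Q (j i) = 2 ↔ i ∈ Q.If := by
  rw [letterClass_apply hj]
  split_ifs <;> simp_all

theorem exists_index {k : ℕ} (h : k ∈ List.ofFn j) : ∃ i, j i = k := by
  rwa [List.mem_ofFn] at h

theorem isRightNeighbor_iff (hj : Function.Injective j) {i i' : Fin l} :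
    IsRightNeighbor j Q.If Q.Ie i i' ↔
      RightLink (List.ofFn j) (letterClass j Q) (j i) (j i') := by
  constructor
  · rintro ⟨hi, hi', t, c, ht, rfl, rfl, hc, hmid, hjc⟩
    have hbef : ∀ k < t, Before (List.ofFn j) (j (c 0) + k) (j (c 0) + k + 1) := fun k hk => by
      rw [add_assoc, ← hjc k hk.le, ← hjc (k + 1) hk, before_ofFn hj]
      exact hc k hk
    have hend := hjc t le_rfl
    refine ⟨⟨by omega, (letterClass_eq_one hj).2 hi, fun r h1 h2 => ?_, fun r h1 h2 => ?_⟩, ?_,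
      (letterClass_eq_one hj).2 hi'⟩
    · have h3 := hjc (r - j (c 0)) (by omega)
      rw [show j (c 0) + (r - j (c 0)) = r by omega] at h3
      rw [← h3, letterClass_eq_two hj]
      exact hmid _ (by omega) (by omega)
    · have h3 := hbef (r - j (c 0)) (by omega)
      rwa [show j (c 0) + (r - j (c 0)) = r by omega] at h3
    · have h3 := hbef (t - 1) (by omega)
      rwa [show j (c 0) + (t - 1) + 1 = j (c t) by omega,
        show j (c 0) + (t - 1) = j (c t) - 1 by omega] at h3
  · rintro ⟨⟨hlt, hs, hmid, hbef⟩, hb, ht⟩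
    refine ⟨(letterClass_eq_one hj).1 hs, (letterClass_eq_one hj).1 ht, ?_⟩
    obtain ⟨t, hjt⟩ := Nat.exists_eq_add_of_lt hlt
    have hbef' : ∀ r < t + 1, Before (List.ofFn j) (j i + r) (j i + r + 1) := fun r hr => by
      by_cases hrt : r = t
      · subst hrt
        rwa [hjt, Nat.add_sub_cancel] at hb
      · exact hbef (j i + r) (by omega) (by omega)
    have hex : ∀ r, ∃ x : Fin l, r ≤ t + 1 → j x = j i + r := fun r => by
      by_cases hr : r ≤ t + 1
      · rcases Nat.lt_or_ge r (t + 1) with h | h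
        · obtain ⟨x, hx⟩ := exists_index (hbef' r h).left_mem
          exact ⟨x, fun _ => hx⟩
        · exact ⟨i', fun _ => by omega⟩
      · exact ⟨i, fun h => absurd h hr⟩
    choose c hc using hex
    refine ⟨t + 1, c, by omega, hj (by rw [hc 0 (by omega), add_zero]),
      hj (by rw [hc (t + 1) le_rfl]; omega), fun k hk => ?_, fun k h1 h2 => ?_, fun k hk => hc k hk⟩
    · rw [← before_ofFn hj, hc k hk.le, hc (k + 1) hk]
      exact hbef' k hk
    · rw [← letterClass_eq_two hj, hc k h2.le]
      exact hmid _ (by omega) (by omega)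

theorem isLeftNeighbor_iff (hj : Function.Injective j) {i i' : Fin l} :
    IsLeftNeighbor j Q.If Q.Ie i i' ↔
      LeftLink (List.ofFn j) (letterClass j Q) (j i) (j i') := by
  constructor
  · rintro ⟨hi, hi', t, c, ht, rfl, rfl, hc, hmid, hjc⟩
    have hbef : ∀ k < t, Before (List.ofFn j) (j (c 0) + k + 1) (j (c 0) + k) := fun k hk => by
      rw [add_assoc, ← hjc k hk.le, ← hjc (k + 1) hk, before_ofFn hj]
      exact hc k hk
    have hend := hjc t le_rfl
    refine ⟨⟨by omega, (letterClass_eq_one hj).2 hi', fun r h1 h2 => ?_, fun r h1 h2 => ?_⟩,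
      hbef 0 ht, (letterClass_eq_one hj).2 hi⟩
    · have h3 := hjc (r - j (c 0)) (by omega)
      rw [show j (c 0) + (r - j (c 0)) = r by omega] at h3
      rw [← h3, letterClass_eq_two hj]
      exact hmid _ (by omega) (by omega)
    · have h3 := hbef (r - j (c 0)) (by omega)
      rwa [show j (c 0) + (r - j (c 0)) = r by omega] at h3
  · rintro ⟨⟨hlt, hs, hmid, hbef⟩, hb, ht⟩
    refine ⟨(letterClass_eq_one hj).1 ht, (letterClass_eq_one hj).1 hs, ?_⟩
    obtain ⟨t, hjt⟩ := Nat.exists_eq_add_of_lt (show j i < j i' by omega)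
    have hbef' : ∀ r < t + 1, Before (List.ofFn j) (j i + r + 1) (j i + r) := fun r hr => by
      by_cases hrt : r = 0
      · subst hrt
        exact hb
      · exact hbef (j i + r) (by omega) (by omega)
    have hex : ∀ r, ∃ x : Fin l, r ≤ t + 1 → j x = j i + r := fun r => by
      by_cases hr : r ≤ t + 1
      · rcases Nat.lt_or_ge r (t + 1) with h | h
        · obtain ⟨x, hx⟩ := exists_index (hbef' r h).right_mem
          exact ⟨x, fun _ => hx⟩
        · exact ⟨i', fun _ => by omega⟩
      · exact ⟨i, fun h => absurd h hr⟩
    choose c hc using hex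
    refine ⟨t + 1, c, by omega, hj (by rw [hc 0 (by omega), add_zero]),
      hj (by rw [hc (t + 1) le_rfl]; omega), fun k hk => ?_, fun k h1 h2 => ?_, fun k hk => hc k hk⟩
    · rw [← before_ofFn hj, hc k hk.le, hc (k + 1) hk]
      exact hbef' k hk
    · rw [← letterClass_eq_two hj, hc k h2.le]
      exact hmid _ (by omega) (by omega)

theorem RightLink.exists_index {ks : List ℕ} {c : ℕ → ℕ} {k b : ℕ} (h : RightLink ks c k b) :
    k ∈ ks ∧ b ∈ ks := by
  refine ⟨?_, h.before.right_mem⟩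
  have := h.chain.lt
  by_cases hb : b = k + 1
  · subst hb
    exact h.before.left_mem
  · exact (h.chain.before k le_rfl (by omega)).left_mem

theorem LeftLink.exists_index {ks : List ℕ} {c : ℕ → ℕ} {k s : ℕ} (h : LeftLink ks c k s) :
    k ∈ ks ∧ s ∈ ks := by
  refine ⟨h.before.right_mem, ?_⟩
  have := h.chain.le
  by_cases hb : s = k + 1
  · subst hb
    exact h.before.left_mem
  · have := (h.chain.before (s - 1) (by omega) (by omega)).left_mem
    rwa [show s - 1 + 1 = s by omega] at this

theorem mem_nbrs_iff (hj : Function.Injective j) {i : Fin l} :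
    i ∈ nbrs j Q.If Q.Ie ↔ Linked (List.ofFn j) (letterClass j Q) (j i) := by
  unfold nbrs rightNbrs leftNbrs Linked
  simp only [Finset.mem_union, Finset.mem_filter, Finset.mem_univ, true_and]
  refine or_congr ⟨fun ⟨i', h⟩ => ⟨j i', (isRightNeighbor_iff hj).1 h⟩, fun ⟨b, h⟩ => ?_⟩
    ⟨fun ⟨i', h⟩ => ⟨j i', (isLeftNeighbor_iff hj).1 h⟩, fun ⟨b, h⟩ => ?_⟩
  · obtain ⟨i', rfl⟩ := exists_index h.exists_index.2
    exact ⟨i', (isRightNeighbor_iff hj).2 h⟩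
  · obtain ⟨i', rfl⟩ := exists_index h.exists_index.2
    exact ⟨i', (isLeftNeighbor_iff hj).2 h⟩

theorem IsRightNeighbor.lt {A B : Finset (Fin l)} {i i' : Fin l}
    (h : IsRightNeighbor j A B i i') : j i < j i' := by
  obtain ⟨-, -, t, c, ht, rfl, rfl, -, -, hjc⟩ := h
  have := hjc t le_rfl
  omega

theorem IsLeftNeighbor.lt {A B : Finset (Fin l)} {i i' : Fin l}
    (h : IsLeftNeighbor j A B i i') : j i < j i' := by
  obtain ⟨-, -, t, c, ht, rfl, rfl, -, -, hjc⟩ := h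
  have := hjc t le_rfl
  omega

theorem IsRightNeighbor.restrict {A B : Finset (Fin l)} {i i' : Fin l}
    (h : IsRightNeighbor j A Finset.univ i i') (hi : i ∈ B) (hi' : i' ∈ B) :
    IsRightNeighbor j A B i i' := by
  obtain ⟨h1, h2, h3⟩ := h
  rw [Finset.mem_sdiff] at h1 h2
  exact ⟨Finset.mem_sdiff.2 ⟨hi, h1.2⟩, Finset.mem_sdiff.2 ⟨hi', h2.2⟩, h3⟩

theorem IsLeftNeighbor.restrict {A B : Finset (Fin l)} {i i' : Fin l}
    (h : IsLeftNeighbor j A Finset.univ i i') (hi : i ∈ B) (hi' : i' ∈ B) :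
    IsLeftNeighbor j A B i i' := by
  obtain ⟨h1, h2, h3⟩ := h
  rw [Finset.mem_sdiff] at h1 h2
  exact ⟨Finset.mem_sdiff.2 ⟨hi, h1.2⟩, Finset.mem_sdiff.2 ⟨hi', h2.2⟩, h3⟩

theorem IsRightNeighbor.extend {A B : Finset (Fin l)} {i i' : Fin l}
    (h : IsRightNeighbor j A B i i') : IsRightNeighbor j A Finset.univ i i' := by
  obtain ⟨h1, h2, h3⟩ := h
  rw [Finset.mem_sdiff] at h1 h2
  exact ⟨Finset.mem_sdiff.2 ⟨Finset.mem_univ _, h1.2⟩,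
    Finset.mem_sdiff.2 ⟨Finset.mem_univ _, h2.2⟩, h3⟩

theorem IsLeftNeighbor.extend {A B : Finset (Fin l)} {i i' : Fin l}
    (h : IsLeftNeighbor j A B i i') : IsLeftNeighbor j A Finset.univ i i' := by
  obtain ⟨h1, h2, h3⟩ := h
  rw [Finset.mem_sdiff] at h1 h2
  exact ⟨Finset.mem_sdiff.2 ⟨Finset.mem_univ _, h1.2⟩,
    Finset.mem_sdiff.2 ⟨Finset.mem_univ _, h2.2⟩, h3⟩

end Neighbors

/-! ### The parameter of a permutation in terms of its crossing points -/

section Param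

variable {n l : ℕ} {j : Fin l → ℕ}

/-- Points outside the `N` given ones are fixed, and a fixed point does not cross when `b ≤ a`. -/
theorem one_le_crossCount_iff {N : ℕ} (u : Equiv.Perm (Fin N)) {a b : ℕ} (hab : b ≤ a) :
    1 ≤ crossCount u a b ↔ CrossOne (shiftPerm 0 N u) a b := by
  rw [one_le_crossCount]
  constructor
  · rintro ⟨p, h1, h2⟩
    exact ⟨p, h1, by rwa [shiftPerm_zero_apply]⟩
  · rintro ⟨p, h1, h2⟩
    by_cases hp : p < N
    · exact ⟨⟨p, hp⟩, h1, by rwa [← shiftPerm_zero_apply]⟩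
    · rw [shiftPerm_apply_of_not u (by omega)] at h2
      omega

theorem two_le_crossCount_iff {N : ℕ} (u : Equiv.Perm (Fin N)) {a b : ℕ} (hab : b ≤ a) :
    2 ≤ crossCount u a b ↔ CrossTwo (shiftPerm 0 N u) a b := by
  rw [two_le_crossCount]
  constructor
  · rintro ⟨p, q, h0, h1, h2, h3⟩
    have : p.val < q.val := h0
    exact ⟨p, q, by omega, h1, by omega, by rwa [shiftPerm_zero_apply],
      by rwa [shiftPerm_zero_apply]⟩
  · rintro ⟨p, q, h0, h1, h1', h2, h3⟩
    have hp : p < N := by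
      by_contra hp
      rw [shiftPerm_apply_of_not u (by omega)] at h2
      omega
    have hq : q < N := by
      by_contra hq
      rw [shiftPerm_apply_of_not u (by omega)] at h3
      omega
    have h2' := shiftPerm_zero_apply u ⟨p, hp⟩
    have h3' := shiftPerm_zero_apply u ⟨q, hq⟩
    dsimp only at h2' h3'
    rcases lt_or_gt_of_ne h0 with h | h
    · exact ⟨⟨p, hp⟩, ⟨q, hq⟩, h, h1, by omega, by omega⟩
    · exact ⟨⟨q, hq⟩, ⟨p, hp⟩, h, h1', by omega, by omega⟩

/-- The parameter expressed by counting crossing points. -/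
theorem mem_cosetParam (hn : ∀ i, j i + 1 < n) (u : Equiv.Perm (Fin (n * 2))) (i : Fin l) :
    (i ∈ (cosetParam n j u).Ie ↔ 1 ≤ crossCount u (2 * j i + 2) (2 * j i + 2)) ∧
    (i ∈ (cosetParam n j u).If ↔ 2 ≤ crossCount u (2 * j i + 2) (2 * j i + 2)) ∧
    (i ∈ (cosetParam n j u).I ↔
      (∃ i', IsRightNeighbor j (cosetParam n j u).If Finset.univ i i' ∧
        1 ≤ crossCount u (2 * j i' + 2) (2 * j i + 2) ∧
        (j i + 1 < j i' → 2 ≤ crossCount u (2 * j i') (2 * j i + 4))) ∨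
      (∃ i', IsLeftNeighbor j (cosetParam n j u).If Finset.univ i i' ∧
        1 ≤ crossCount u⁻¹ (2 * j i' + 2) (2 * j i + 2) ∧
        (j i + 1 < j i' → 2 ≤ crossCount u⁻¹ (2 * j i') (2 * j i + 4)))) := by
  classical
  refine ⟨?_, ?_, ?_⟩
  · rw [← simpleRefl_bruhatLE_iff (hn i)]
    simp [cosetParam]
  · rw [← double_bruhatLE_iff (hn i)]
    simp [cosetParam]
  · have h1 : ∀ i', (IsRightNeighbor j (cosetParam n j u).If Finset.univ i i' ∧
        1 ≤ crossCount u (2 * j i' + 2) (2 * j i + 2) ∧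
        (j i + 1 < j i' → 2 ≤ crossCount u (2 * j i') (2 * j i + 4))) ↔
        IsRightNeighbor j (cosetParam n j u).If Finset.univ i i' ∧
          BruhatLE (ascendingChain n (j i) (j i')) u := fun i' =>
      and_congr_right fun h => (ascendingChain_bruhatLE_iff h.lt (hn i') u).symm
    have h2 : ∀ i', (IsLeftNeighbor j (cosetParam n j u).If Finset.univ i i' ∧
        1 ≤ crossCount u⁻¹ (2 * j i' + 2) (2 * j i + 2) ∧
        (j i + 1 < j i' → 2 ≤ crossCount u⁻¹ (2 * j i') (2 * j i + 4))) ↔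
        IsLeftNeighbor j (cosetParam n j u).If Finset.univ i i' ∧
          BruhatLE (descendingChain n (j i) (j i')) u := fun i' =>
      and_congr_right fun h => (descendingChain_bruhatLE_iff h.lt (hn i') u).symm
    simp only [h1, h2]
    simp [cosetParam]

theorem crossCount_mono {N : ℕ} (u : Equiv.Perm (Fin N)) {a a' b b' : ℕ} (ha : a' ≤ a)
    (hb : b ≤ b') : crossCount u a b ≤ crossCount u a' b' := by
  refine Finset.sum_le_sum fun p _ => ?_
  split_ifs <;> omega

/-- As many points cross a cut downwards as upwards. -/
theorem crossCount_inv_self {N : ℕ} (u : Equiv.Perm (Fin N)) (a : ℕ) :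
    crossCount u⁻¹ a a = crossCount u a a := by
  have h1 := lowCount_add_crossCount u a a
  have h2 := lowCount_add_crossCount u⁻¹ a a
  rw [lowCount_inv] at h2
  omega

/-- The conditions on the crossing points that amount to having the parameter `Q`. -/
structure HasParam (j : Fin l → ℕ) (Q : Triplet l) (g : Equiv.Perm ℕ) (L : List (ℕ × Mask)) :
    Prop where
  cls : ∀ x ∈ L, maskClass x.2 = letterClass j Q x.1
  right : ∀ k b, RightLink (List.ofFn j) (letterClass j Q) k b →
    (CrossOne g (2 * b + 2) (2 * k + 2) ↔ letterFlag j Q k)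
  left : ∀ k s, LeftLink (List.ofFn j) (letterClass j Q) k s →
    (RiseOne g (2 * k + 2) (2 * s + 2) ↔ letterFlag j Q k)

theorem goodRun_iff_splits {C : ℕ → Mask → Bool → Bool → Prop} {β : ℕ → Bool}
    {L : List (ℕ × Mask)} :
    GoodRun C β L ↔ ∀ A k m B, L = A ++ (k, m) :: B →
      C k m (runBits β A k) (runBits β A (k + 1)) := by
  constructor
  · rintro h A k m B rfl
    exact (goodRun_append.1 h).2.1
  · intro h
    induction L using List.reverseRecOn with
    | nil => trivial
    | append_singleton L x ih =>
      obtain ⟨k, m⟩ := x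
      refine goodRun_concat.2 ⟨ih fun A k' m' B hL => ?_, h L k m [] rfl⟩
      exact h A k' m' (B ++ [(k, m)]) (by simp [hL])

theorem exists_split {L : List (ℕ × Mask)} {k : ℕ} (h : k ∈ L.map Prod.fst) :
    ∃ A m B, L = A ++ (k, m) :: B := by
  obtain ⟨⟨k', m⟩, hx, rfl⟩ := List.mem_map.1 h
  obtain ⟨A, B, rfl⟩ := List.append_of_mem hx
  exact ⟨A, m, B, rfl⟩

/-- The constraint at the last letter of a link depends on the run up to that letter. By
`crossing_right` and `crossing_left`, once the classes are right, it is equivalent to a condition on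
the complete product. -/
theorem goodRun_iff_hasParam (hj : Function.Injective j) {Q : Triplet l} {L : List (ℕ × Mask)}
    (hL : L.map Prod.fst = List.ofFn j) :
    GoodRun (Constraint (List.ofFn j) (letterClass j Q) (letterFlag j Q)) (fun _ => false) L ↔
      HasParam j Q (wordPerm L) L := by
  have hnd : (List.ofFn j).Nodup := List.nodup_ofFn.2 hj
  constructor
  · intro h
    have hcls := h.maskClass_eq
    refine ⟨hcls, fun k b hl => ?_, fun k s hl => ?_⟩
    · obtain ⟨A, m, B, rfl⟩ := exists_split (hL ▸ hl.exists_index.2)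
      have hm : maskClass m = 1 := (hcls (b, m) (by simp)).trans hl.target
      rw [(crossing_right hL hnd (fun x hx => hcls x (by simp [hx])) hm hl.chain hl.before).2]
      exact (goodRun_iff_splits.1 h _ _ _ _ rfl).low k hl
    · obtain ⟨A, m, B, rfl⟩ := exists_split (hL ▸ hl.exists_index.1)
      have hm : maskClass m = 1 := (hcls (k, m) (by simp)).trans hl.target
      rw [(crossing_left hL hnd (fun x hx => hcls x (by simp [hx])) hm hl.chain hl.before).2]
      exact (goodRun_iff_splits.1 h _ _ _ _ rfl).high s hl
  · rintro ⟨hcls, hr, hl⟩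
    refine goodRun_iff_splits.2 ?_
    rintro A k m B rfl
    have hm := hcls (k, m) (by simp)
    have hclsA : ∀ x ∈ A, maskClass x.2 = letterClass j Q x.1 := fun x hx => hcls x (by simp [hx])
    refine ⟨hm, fun k' hk' => ?_, fun s hs => ?_⟩
    · rw [← (crossing_right hL hnd hclsA (hm.trans hk'.target) hk'.chain hk'.before).2]
      exact hr _ _ hk'
    · rw [← (crossing_left hL hnd hclsA (hm.trans hs.target) hs.chain hs.before).2]
      exact hl _ _ hs

theorem RightLink.target_unique {ks : List ℕ} {c : ℕ → ℕ} {k b b' : ℕ} (h : RightLink ks c k b)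
    (h' : RightLink ks c k b') : b = b' := by
  have h1 := h.chain.lt
  have h2 := h'.chain.lt
  have h3 := h.target
  have h4 := h'.target
  rcases lt_trichotomy b b' with hlt | heq | hlt
  · have := h'.chain.mid b h1 hlt
    omega
  · exact heq
  · have := h.chain.mid b' h2 hlt
    omega

theorem LeftLink.source_unique {ks : List ℕ} {c : ℕ → ℕ} {k s s' : ℕ} (h : LeftLink ks c k s)
    (h' : LeftLink ks c k s') : s = s' := h.chain.source_unique h'.chain

theorem RightLink.before_succ {ks : List ℕ} {c : ℕ → ℕ} {k b : ℕ} (h : RightLink ks c k b) :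
    Before ks k (k + 1) := by
  have := h.chain.lt
  by_cases hb : b = k + 1
  · subst hb
    exact h.before
  · exact h.chain.before k le_rfl (by omega)

/-- Two discrepancies between `p` and the crossing conditions disappear. Neighbors in `p` are taken
among all indices, but the Bruhat inequality puts both ends into `I_e`. The second count in that
inequality holds automatically for products of masks with the right classes. -/
theorem cosetParam_eq_iff (hj : Function.Injective j) (hn : ∀ i, j i + 1 < n) {Q : Triplet l}
    (hQ : Q ∈ triplets j) {L : List (ℕ × Mask)} (hL : L.map Prod.fst = List.ofFn j)
    {u : Equiv.Perm (Fin (n * 2))} (hu : shiftPerm 0 (n * 2) u = wordPerm L) :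
    cosetParam n j u = Q ↔ HasParam j Q (wordPerm L) L := by
  have hnd : (List.ofFn j).Nodup := List.nodup_ofFn.2 hj
  have hle : ∀ m : Mask, maskClass m ≤ 2 := fun m => by unfold maskClass; split_ifs <;> omega
  have hmem := mem_cosetParam hn u
  have hE : ∀ A i m B, L = A ++ (j i, m) :: B → (i ∈ (cosetParam n j u).Ie ↔ 1 ≤ maskClass m) ∧
      (i ∈ (cosetParam n j u).If ↔ 2 ≤ maskClass m) := by
    rintro A i m B rfl
    rw [(hmem i).1, (hmem i).2.1, one_le_crossCount_iff u le_rfl, two_le_crossCount_iff u le_rfl, hu]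
    exact crossing_class hL hnd
  -- the middle component, once the other two are known
  have hI : (cosetParam n j u).Ie = Q.Ie → (cosetParam n j u).If = Q.If →
      (∀ x ∈ L, maskClass x.2 = letterClass j Q x.1) → ∀ i, (i ∈ (cosetParam n j u).I ↔
      (∃ b, RightLink (List.ofFn j) (letterClass j Q) (j i) b ∧
        CrossOne (wordPerm L) (2 * b + 2) (2 * j i + 2)) ∨
      ∃ s, LeftLink (List.ofFn j) (letterClass j Q) (j i) s ∧
        RiseOne (wordPerm L) (2 * j i + 2) (2 * s + 2)) := by
    intro hIe hIf hcls i
    rw [(hmem i).2.2, hIf]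
    refine or_congr ⟨?_, ?_⟩ ⟨?_, ?_⟩
    · rintro ⟨i', h1, h2, -⟩
      have hlt := h1.lt
      -- A point that gets from beyond the larger cut to below the smaller one crosses both, so both
      -- ends of the link lie in `I_e`.
      have hi : i ∈ Q.Ie := by
        rw [← hIe, (hmem i).1]
        exact h2.trans (crossCount_mono u (by omega) le_rfl)
      have hi' : i' ∈ Q.Ie := by
        rw [← hIe, (hmem i').1]
        exact h2.trans (crossCount_mono u le_rfl (by omega))
      refine ⟨j i', (isRightNeighbor_iff hj).1 (h1.restrict hi hi'), ?_⟩
      rwa [one_le_crossCount_iff u (by omega), hu] at h2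
    · rintro ⟨b, h1, h2⟩
      obtain ⟨i', rfl⟩ := exists_index h1.exists_index.2
      have h3 := (isRightNeighbor_iff hj).2 h1
      have hlt := h3.lt
      refine ⟨i', h3.extend, by rwa [one_le_crossCount_iff u (by omega), hu], fun h4 => ?_⟩
      rw [two_le_crossCount_iff u (by omega), hu]
      -- The second count is supplied by the chain itself.
      obtain ⟨A, m, B, rfl⟩ := exists_split (hL ▸ h1.exists_index.2)
      exact (crossing_right hL hnd (fun x hx => hcls x (by simp [hx]))
        ((hcls (j i', m) (by simp)).trans h1.target) h1.chain h1.before).1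
    · rintro ⟨i', h1, h2, -⟩
      have hlt := h1.lt
      have hi : i ∈ Q.Ie := by
        rw [← hIe, (hmem i).1, ← crossCount_inv_self]
        exact h2.trans (crossCount_mono _ (by omega) le_rfl)
      have hi' : i' ∈ Q.Ie := by
        rw [← hIe, (hmem i').1, ← crossCount_inv_self]
        exact h2.trans (crossCount_mono _ le_rfl (by omega))
      refine ⟨j i', (isLeftNeighbor_iff hj).1 (h1.restrict hi hi'), ?_⟩
      rwa [one_le_crossCount_iff _ (by omega), map_inv, hu, ← riseOne_iff] at h2
    · rintro ⟨b, h1, h2⟩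
      obtain ⟨i', rfl⟩ := exists_index h1.exists_index.2
      have h3 := (isLeftNeighbor_iff hj).2 h1
      have hlt := h3.lt
      refine ⟨i', h3.extend, by rwa [one_le_crossCount_iff _ (by omega), map_inv, hu,
        ← riseOne_iff], fun h4 => ?_⟩
      rw [two_le_crossCount_iff _ (by omega), map_inv, hu, ← riseTwo_iff]
      obtain ⟨A, m, B, rfl⟩ := exists_split (hL ▸ h1.exists_index.1)
      exact (crossing_left hL hnd (fun x hx => hcls x (by simp [hx]))
        ((hcls (j i, m) (by simp)).trans h1.target) h1.chain h1.before).1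
  constructor
  · intro hcp
    have hIe : (cosetParam n j u).Ie = Q.Ie := by rw [hcp]
    have hIf : (cosetParam n j u).If = Q.If := by rw [hcp]
    have hcls : ∀ x ∈ L, maskClass x.2 = letterClass j Q x.1 := by
      rintro ⟨k, m⟩ hx
      obtain ⟨i, rfl⟩ := exists_index (hL ▸ List.mem_map.2 ⟨_, hx, rfl⟩)
      obtain ⟨A, B, rfl⟩ := List.append_of_mem hx
      obtain ⟨h1, h2⟩ := hE A i m B rfl
      rw [hIe] at h1
      rw [hIf] at h2
      have := hle m
      dsimp only
      rw [letterClass_apply hj]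
      simp only [h1, h2]
      split_ifs <;> omega
    have hI := hI hIe hIf hcls
    refine ⟨hcls, fun k b hl => ?_, fun k s hl => ?_⟩
    · obtain ⟨i, rfl⟩ := exists_index hl.exists_index.1
      rw [letterFlag_apply hj, ← hcp, hI]
      constructor
      · exact fun h => Or.inl ⟨b, hl, h⟩
      · rintro (⟨b', h1, h2⟩ | ⟨s, h1, -⟩)
        · rwa [hl.target_unique h1]
        -- No letter has links in both directions: a right link puts `k` before `k+1`, a left link
        -- after it.
        · exact absurd hl.before_succ (h1.before.asymm hnd)
    · obtain ⟨i, rfl⟩ := exists_index hl.exists_index.1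
      rw [letterFlag_apply hj, ← hcp, hI]
      constructor
      · exact fun h => Or.inr ⟨s, hl, h⟩
      · rintro (⟨b', h1, h2⟩ | ⟨s', h1, h2⟩)
        · exact absurd h1.before_succ (hl.before.asymm hnd)
        · rwa [hl.source_unique h1]
  · rintro ⟨hcls, hr, hl⟩
    have hE' : ∀ i, ∃ m, maskClass m = letterClass j Q (j i) ∧
        (i ∈ (cosetParam n j u).Ie ↔ 1 ≤ maskClass m) ∧
        (i ∈ (cosetParam n j u).If ↔ 2 ≤ maskClass m) := fun i => by
      obtain ⟨A, m, B, rfl⟩ := exists_split (L := L) (k := j i) (hL ▸ List.mem_ofFn.2 ⟨i, rfl⟩)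
      exact ⟨m, hcls (j i, m) (by simp), hE A i m B rfl⟩
    have hIe : (cosetParam n j u).Ie = Q.Ie := by
      ext i
      obtain ⟨m, h1, h2, -⟩ := hE' i
      rw [h2, h1, letterClass_apply hj]
      have : i ∈ Q.If → i ∈ Q.Ie := fun h => hQ.1 h
      split_ifs <;> simp_all
    have hIf : (cosetParam n j u).If = Q.If := by
      ext i
      obtain ⟨m, h1, -, h2⟩ := hE' i
      rw [h2, h1, letterClass_apply hj]
      split_ifs <;> simp_all
    refine Triplet.ext hIe ?_ hIf
    ext i
    rw [hI hIe hIf hcls]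
    constructor
    · rintro (⟨b, h1, h2⟩ | ⟨s, h1, h2⟩)
      · exact (letterFlag_apply hj i).1 ((hr _ _ h1).1 h2)
      · exact (letterFlag_apply hj i).1 ((hl _ _ h1).1 h2)
    · intro h
      have h' := (letterFlag_apply hj i).2 h
      rcases (mem_nbrs_iff hj).1 (hQ.2 h) with ⟨b, hb⟩ | ⟨s, hs⟩
      · exact Or.inl ⟨b, hb, (hr _ _ hb).2 h'⟩
      · exact Or.inr ⟨s, hs, (hl _ _ hs).2 h'⟩

end Param

/-! ### The masks of the representatives -/

section Canonical

variable {ks : List ℕ} {c : ℕ → ℕ} {I : ℕ → Prop}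

open Classical in
/-- The mask of the letter `k` in the word of a representative. -/
noncomputable def canonicalMask (ks : List ℕ) (c : ℕ → ℕ) (I : ℕ → Prop) (k : ℕ) : Mask :=
  if c k = 0 then ![false, false, false, false]
  else if c k = 2 then ![true, true, true, true]
  else if I k then
    if Before ks k (k + 1) then ![true, false, true, false] else ![false, false, true, true]
  else ![true, false, false, false]

theorem canonicalMask_cases (hc : ∀ k, c k ≤ 2) (k : ℕ) :
    (c k = 0 ∧ canonicalMask ks c I k = ![false, false, false, false]) ∨
    (c k = 2 ∧ canonicalMask ks c I k = ![true, true, true, true]) ∨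
    (c k = 1 ∧ I k ∧ Before ks k (k + 1) ∧
      canonicalMask ks c I k = ![true, false, true, false]) ∨
    (c k = 1 ∧ I k ∧ ¬ Before ks k (k + 1) ∧
      canonicalMask ks c I k = ![false, false, true, true]) ∨
    (c k = 1 ∧ ¬ I k ∧ canonicalMask ks c I k = ![true, false, false, false]) := by
  have := hc k
  unfold canonicalMask
  by_cases h0 : c k = 0
  · simp [h0]
  by_cases h2 : c k = 2
  · simp [h2]
  have h1 : c k = 1 := by omega
  by_cases hI : I k <;> by_cases hb : Before ks k (k + 1) <;> simp [h1, hI, hb]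

theorem mask_none : ∀ a b, maskClass ![false, false, false, false] = 0 ∧
    outLeft ![false, false, false, false] a b = a ∧
    outRight ![false, false, false, false] a b = b := by decide +kernel

theorem mask_all : ∀ a b, maskClass ![true, true, true, true] = 2 ∧
    outLeft ![true, true, true, true] a b = b ∧
    outRight ![true, true, true, true] a b = a := by decide +kernel

theorem mask_right : ∀ a, maskClass ![true, false, true, false] = 1 ∧
    outLeft ![true, false, true, false] false a = false ∧
    outRight ![true, false, true, false] a false = true ∧
    lowMoves ![true, false, true, false] a false = a ∧
    highMoves ![true, false, true, false] a false = false := by decide +kernel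

theorem mask_left : ∀ a, maskClass ![false, false, true, true] = 1 ∧
    outLeft ![false, false, true, true] false a = false ∧
    outRight ![false, false, true, true] a false = false ∧
    lowMoves ![false, false, true, true] a false = a ∧
    highMoves ![false, false, true, true] a false = true := by decide +kernel

theorem mask_single : ∀ a, maskClass ![true, false, false, false] = 1 ∧
    outLeft ![true, false, false, false] false a = false ∧
    outRight ![true, false, false, false] a false = false ∧
    lowMoves ![true, false, false, false] a false = a ∧
    highMoves ![true, false, false, false] a false = false := by decide +kernel

/-- Along the word of the representative the bits can be followed exactly: where the next letter is
still to come, a descent marks an open chain whose source is flagged and points to the right. Each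
of the three masks of class one moves the smallest value exactly if the incoming left bit is set,
which is the constraint of a right link; among them only the mask of a left flag moves the largest
value. -/
theorem goodRun_canonicalMask (hnd : ks.Nodup) (hc : ∀ k, c k ≤ 2) {A : List ℕ} (hA : A <+: ks) :
    GoodRun (Constraint ks c I) (fun _ => false) (A.map fun k => (k, canonicalMask ks c I k)) ∧
    (∀ b ∉ A, runBits (fun _ => false) (A.map fun k => (k, canonicalMask ks c I k)) b = true ↔
      ∃ k, RightChain ks c k b ∧ b - 1 ∈ A ∧ I k ∧ Before ks k (k + 1)) ∧
    (∀ t ∉ A, runBits (fun _ => false) (A.map fun k => (k, canonicalMask ks c I k)) (t + 1) =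
      false) := by
  induction A using List.reverseRecOn with
  | nil => simp [GoodRun, runBits]
  | append_singleton A k ih =>
    obtain ⟨ih1, ih2, ih3⟩ := ih ((List.prefix_append _ _).trans hA)
    have hbef : ∀ r, Before ks r k ↔ r ∈ A := by
      obtain ⟨B, rfl⟩ := hA
      rw [List.append_assoc, List.singleton_append] at hnd ⊢
      exact before_append_cons hnd
    have hkA : k ∉ A := fun h => ((hbef k).2 h).ne hnd rfl
    rw [List.map_append, List.map_singleton, goodRun_concat, runBits_concat]
    set m := canonicalMask ks c I k with hm
    set β := runBits (fun _ => false) (A.map fun k => (k, canonicalMask ks c I k)) with hβ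
    have hβk : β (k + 1) = false := ih3 k hkA
    have hβk' := ih2 k hkA
    have hout : ∀ b, b ≠ k → b ∉ A → b ≠ k + 1 → (b - 1 ∈ A ++ [k] ↔ b - 1 ∈ A) := by
      intro b h1 h2 h3
      have h4 : b - 1 ≠ k := fun h => by
        rcases Nat.eq_zero_or_pos b with h0 | h0 <;> omega
      simp [h4]
    refine ⟨⟨ih1, ?_⟩, fun b hb => ?_, fun t ht => ?_⟩
    · rw [hβk]
      have hR : ∀ k', RightLink ks c k' k → (β k = true ↔ I k') := fun k' h => by
        rw [hβk']
        constructor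
        · rintro ⟨k'', h1, -, h2, -⟩
          rwa [h.chain.source_unique h1]
        · exact fun hI => ⟨k', h.chain, (hbef _).1 h.before, hI, h.before_succ⟩
      rcases canonicalMask_cases (ks := ks) (I := I) hc k with ⟨h1, h2⟩ | ⟨h1, h2⟩ | ⟨h1, h3, h4, h2⟩ |
        ⟨h1, h3, h4, h2⟩ | ⟨h1, h3, h2⟩ <;> rw [← hm] at h2 <;> rw [h2]
      · exact (constraint_iff_of_ne_one (by omega) _ _ _).2 (by rw [(mask_none true true).1, h1])
      · exact (constraint_iff_of_ne_one (by omega) _ _ _).2 (by rw [(mask_all true true).1, h1])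
      · obtain ⟨e1, -, -, e2, e3⟩ := mask_right (β k)
        refine ⟨e1.trans h1.symm, fun k' h => by rw [e2]; exact hR k' h, fun s h => ?_⟩
        exact absurd h4 (h.before.asymm hnd)
      · obtain ⟨e1, -, -, e2, e3⟩ := mask_left (β k)
        refine ⟨e1.trans h1.symm, fun k' h => by rw [e2]; exact hR k' h, fun s h => ?_⟩
        rw [e3]
        exact ⟨fun _ => h3, fun _ => rfl⟩
      · obtain ⟨e1, -, -, e2, e3⟩ := mask_single (β k)
        refine ⟨e1.trans h1.symm, fun k' h => by rw [e2]; exact hR k' h, fun s h => ?_⟩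
        rw [e3]
        exact ⟨fun h => absurd h (by simp), fun h => absurd h h3⟩
    · simp only [List.mem_append, List.mem_singleton, not_or] at hb
      by_cases hbk : b = k + 1
      swap
      · rw [stepBits_of_ne _ _ hb.2 hbk, ih2 b hb.1]
        simp only [hout b hb.2 hb.1 hbk]
      subst hbk
      rw [stepBits_right, hβk]
      have hmem : k + 1 - 1 ∈ A ++ [k] := by simp
      rcases canonicalMask_cases (ks := ks) (I := I) hc k with ⟨h1, h2⟩ | ⟨h1, h2⟩ | ⟨h1, h3, h4, h2⟩ |
        ⟨h1, h3, h4, h2⟩ | ⟨h1, h3, h2⟩ <;> rw [← hm] at h2 <;> rw [h2]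
      · rw [(mask_none _ _).2.2]
        refine ⟨fun h => absurd h (by simp), ?_⟩
        rintro ⟨k', h, -⟩
        rcases rightChain_succ_iff.1 h with h | h <;> omega
      · rw [(mask_all _ _).2.2, hβk']
        constructor
        · rintro ⟨k', h3, h4, h5⟩
          exact ⟨k', rightChain_succ_iff.2 (Or.inr ⟨h1, h3, (hbef _).2 h4⟩), hmem, h5⟩
        · rintro ⟨k', h3, -, h5⟩
          rcases rightChain_succ_iff.1 h3 with h | h
          · omega
          · exact ⟨k', h.2.1, (hbef _).1 h.2.2, h5⟩
      · rw [(mask_right _).2.2.1]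
        exact ⟨fun _ => ⟨k, rightChain_succ_iff.2 (Or.inl ⟨rfl, h1⟩), hmem, h3, h4⟩, fun _ => rfl⟩
      · rw [(mask_left _).2.2.1]
        refine ⟨fun h => absurd h (by simp), ?_⟩
        rintro ⟨k', h, -, h5⟩
        rcases rightChain_succ_iff.1 h with h | h
        · exact absurd (h.1 ▸ h5.2) h4
        · omega
      · rw [(mask_single _).2.2.1]
        refine ⟨fun h => absurd h (by simp), ?_⟩
        rintro ⟨k', h, -, h5⟩
        rcases rightChain_succ_iff.1 h with h | h
        · exact absurd (h.1 ▸ h5.1) h3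
        · omega
    · simp only [List.mem_append, List.mem_singleton, not_or] at ht
      by_cases htk : t + 1 = k
      swap
      · rw [stepBits_of_ne _ _ htk (by omega), ih3 t ht.1]
      have hβt : β k = false := htk ▸ ih3 t ht.1
      rw [htk, stepBits_left, hβk, hβt]
      rcases canonicalMask_cases (ks := ks) (I := I) hc k with ⟨h1, h2⟩ | ⟨h1, h2⟩ | ⟨h1, h3, h4, h2⟩ |
        ⟨h1, h3, h4, h2⟩ | ⟨h1, h3, h2⟩ <;> rw [← hm] at h2 <;> rw [h2]
      · rw [(mask_none _ _).2.1]
      · rw [(mask_all _ _).2.1]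
      · rw [(mask_right _).2.1]
      · rw [(mask_left _).2.1]
      · rw [(mask_single _).2.1]

end Canonical

/-! ### The word of a representative as a word of masks -/

theorem localPerm_four (m : Mask) : localPerm m 4 =
    (if m 0 then simpleRefl 4 1 else 1) * (if m 1 then simpleRefl 4 0 else 1) *
      (if m 2 then simpleRefl 4 2 else 1) * (if m 3 then simpleRefl 4 1 else 1) := by
  simp [localPerm, partialProd, doubleLetter, List.ofFn_succ, mul_assoc]

theorem blockPerm_eq (k : ℕ) (m : Mask) : blockPerm k m =
    (if m 0 then Equiv.swap (2 * k + 1) (2 * k + 2) else 1) *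
      (if m 1 then Equiv.swap (2 * k) (2 * k + 1) else 1) *
      (if m 2 then Equiv.swap (2 * k + 2) (2 * k + 3) else 1) *
      (if m 3 then Equiv.swap (2 * k + 1) (2 * k + 2) else 1) := by
  have h1 := shiftPerm_simpleRefl (2 * k) (show 1 + 1 < 4 by norm_num)
  have h0 := shiftPerm_simpleRefl (2 * k) (show 0 + 1 < 4 by norm_num)
  have h2 := shiftPerm_simpleRefl (2 * k) (show 2 + 1 < 4 by norm_num)
  rw [blockPerm, localPerm_four, map_mul, map_mul, map_mul]
  simp only [apply_ite (shiftPerm (2 * k) 4), map_one, h0, h1, h2, add_zero]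

/-- The factors of the word distinguish right from left neighbors, the canonical masks ask whether
`k` precedes `k+1`. For flagged letters the two agree, because a flagged letter is linked. -/
theorem cosetRep_eq {n l : ℕ} {j : Fin l → ℕ} (hj : Function.Injective j)
    (hn : ∀ i, j i + 1 < n) {Q : Triplet l} (hQ : Q ∈ triplets j) :
    shiftPerm 0 (n * 2) (cosetRep n j Q) = wordPerm ((List.ofFn j).map fun k =>
      (k, canonicalMask (List.ofFn j) (letterClass j Q) (letterFlag j Q) k)) := by
  classical
  have hprod : ∀ Ls : List (List ℕ), wordProd (n * 2) Ls.flatten =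
      (Ls.map (wordProd (n * 2))).prod := fun Ls => by
    induction Ls with
    | nil => rfl
    | cons a t ih => rw [List.flatten_cons, List.map_cons, List.prod_cons, ← ih]; simp [wordProd]
  rw [cosetRep, hprod, map_list_prod, wordPerm, List.map_map, List.map_ofFn, List.map_ofFn,
    List.map_ofFn]
  congr 2
  funext i
  simp only [Function.comp_apply]
  have hi := hn i
  have hnd : (List.ofFn j).Nodup := List.nodup_ofFn.2 hj
  have e1 := shiftPerm_simpleRefl 0 (show (2 * j i + 1) + 1 < n * 2 by omega)
  have e0 := shiftPerm_simpleRefl 0 (show (2 * j i) + 1 < n * 2 by omega)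
  have e2 := shiftPerm_simpleRefl 0 (show (2 * j i + 2) + 1 < n * 2 by omega)
  rw [zero_add] at e0 e1 e2
  rw [blockPerm_eq]
  unfold omegaFactor
  have hFE : i ∈ Q.If → i ∈ Q.Ie := fun h => hQ.1 h
  have hflag : letterFlag j Q (j i) ↔ i ∈ Q.I := letterFlag_apply hj i
  rcases canonicalMask_cases (ks := List.ofFn j) (c := letterClass j Q) (I := letterFlag j Q)
    letterClass_le (j i) with ⟨h1, h2⟩ | ⟨h1, h2⟩ | ⟨h1, h3, h4, h2⟩ |
      ⟨h1, h3, h4, h2⟩ | ⟨h1, h3, h2⟩ <;> rw [h2]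
  · have : i ∉ Q.Ie := by
      rw [letterClass_apply hj] at h1
      split_ifs at h1
      assumption
    simp [this, wordProd]
  · have hF := (letterClass_eq_two hj).1 h1
    simp [hF, hFE hF, wordProd, doubleLetter, List.ofFn_succ, e0, e1, e2, mul_assoc]
  all_goals
    have hEF := Finset.mem_sdiff.1 ((letterClass_eq_one hj).1 h1)
  · have hI := hflag.1 h3
    have hr : i ∈ rightNbrs j Q.If Finset.univ := by
      rcases (mem_nbrs_iff hj).1 (hQ.2 hI) with ⟨b, hb⟩ | ⟨s, hs⟩
      · obtain ⟨i', rfl⟩ := exists_index hb.exists_index.2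
        simp only [rightNbrs, Finset.mem_filter, Finset.mem_univ, true_and]
        exact ⟨i', ((isRightNeighbor_iff hj).2 hb).extend⟩
      · exact absurd h4 (hs.before.asymm hnd)
    simp [hEF.1, hEF.2, hI, hr, wordProd, e1, e2]
  · have hI := hflag.1 h3
    have hr : i ∉ rightNbrs j Q.If Finset.univ := fun hr => by
      simp only [rightNbrs, Finset.mem_filter, Finset.mem_univ, true_and] at hr
      obtain ⟨i', -, -, t, c, ht, rfl, -, hc, -, hjc⟩ := hr
      apply h4
      have := hjc 1 ht
      rw [← this, before_ofFn hj]
      exact hc 0 ht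
    have hl : i ∈ leftNbrs j Q.If Finset.univ := by
      rcases (mem_nbrs_iff hj).1 (hQ.2 hI) with ⟨b, hb⟩ | ⟨s, hs⟩
      · exact absurd hb.before_succ h4
      · obtain ⟨i', rfl⟩ := exists_index hs.exists_index.2
        simp only [leftNbrs, Finset.mem_filter, Finset.mem_univ, true_and]
        exact ⟨i', ((isLeftNeighbor_iff hj).2 hs).extend⟩
    simp [hEF.1, hEF.2, hI, hr, hl, wordProd, e1, e2]
  · have hI : i ∉ Q.I := fun h => h3 (hflag.2 h)
    simp [hEF.1, hEF.2, hI, wordProd, e1]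

/-! ### Double cosets -/

theorem exists_block_flip {n : ℕ} (T : ℕ → Prop) : ∃ h ∈ blockSubgroup n,
    ∀ p : Fin (n * 2), (T (p.val / 2) → h p = p) ∧
      (¬ T (p.val / 2) → (h p).val = if p.val % 2 = 0 then p.val + 1 else p.val - 1) := by
  classical
  let f : Fin (n * 2) → Fin (n * 2) := fun p =>
    if T (p.val / 2) then p else ⟨if p.val % 2 = 0 then p.val + 1 else p.val - 1, by split_ifs <;> omega⟩
  have hf1 : ∀ p : Fin (n * 2), T (p.val / 2) → f p = p := fun p hp => by simp only [f, hp, if_true]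
  have hf2 : ∀ p : Fin (n * 2), ¬ T (p.val / 2) →
      (f p).val = if p.val % 2 = 0 then p.val + 1 else p.val - 1 := fun p hp => by
    simp only [f, hp, if_false]
  have hf3 : ∀ p : Fin (n * 2), (f p).val / 2 = p.val / 2 := fun p => by
    by_cases hp : T (p.val / 2)
    · rw [hf1 p hp]
    · rw [hf2 p hp]; split_ifs <;> omega
  have hinv : Function.Involutive f := fun p => by
    by_cases hp : T (p.val / 2)
    · rw [hf1 p hp, hf1 p hp]
    · have hp' : ¬ T ((f p).val / 2) := by rwa [hf3]
      apply Fin.ext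
      rw [hf2 _ hp', hf2 _ hp]
      split_ifs <;> omega
  exact ⟨hinv.toPerm, hf3, fun p => ⟨hf1 p, hf2 p⟩⟩

/-- An element `f` of `H` exchanges positions within pairs until `v f` and `u` send each point to
the same pair. Then `v f u⁻¹` preserves all pairs, and `v = (v f u⁻¹) u f⁻¹`. -/
theorem mem_doubleCoset_of_labels {n : ℕ} {u v : Equiv.Perm (Fin (n * 2))}
    (h : ∀ b, (blockValues (shiftPerm 0 (n * 2) u) b).map (· / 2) =
      (blockValues (shiftPerm 0 (n * 2) v) b).map (· / 2)) :
    v ∈ DoubleCoset.doubleCoset u (blockSubgroup n : Set (Equiv.Perm (Fin (n * 2))))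
      (blockSubgroup n : Set (Equiv.Perm (Fin (n * 2)))) := by
  obtain ⟨f, hf, hf'⟩ := exists_block_flip (n := n) fun b =>
    shiftPerm 0 (n * 2) u (2 * b) / 2 = shiftPerm 0 (n * 2) v (2 * b) / 2
  have key : ∀ p, (v (f p)).val / 2 = (u p).val / 2 := by
    intro p
    rw [← shiftPerm_zero_apply v, ← shiftPerm_zero_apply u]
    have hb := h (p.val / 2)
    rw [blockValues, blockValues, Sym2.map_mk, Sym2.map_mk, Sym2.eq_iff] at hb
    obtain ⟨h1, h2⟩ := hf' p
    have hp2 : p.val = 2 * (p.val / 2) ∨ p.val = 2 * (p.val / 2) + 1 := by omega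
    by_cases hT : shiftPerm 0 (n * 2) u (2 * (p.val / 2)) / 2 =
        shiftPerm 0 (n * 2) v (2 * (p.val / 2)) / 2
    · rw [h1 hT]
      rcases hp2 with e | e <;> rw [e] <;> omega
    · rw [h2 hT]
      rcases hp2 with e | e
      · rw [if_pos (by omega), e]
        omega
      · rw [if_neg (by omega), e]
        simp only [Nat.add_sub_cancel]
        omega
  rw [DoubleCoset.mem_doubleCoset]
  refine ⟨v * f * u⁻¹, fun q => ?_, f⁻¹, inv_mem hf, by group⟩
  rw [Equiv.Perm.mul_apply, Equiv.Perm.mul_apply, key, Equiv.Perm.inv_def, Equiv.apply_symm_apply]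

/-- Even cuts do not split a pair, so permuting within pairs does not change on which side a point
or a value lies. -/
theorem crossCount_block_mul {n : ℕ} (u : Equiv.Perm (Fin (n * 2)))
    {h h' : Equiv.Perm (Fin (n * 2))} (hh : h ∈ blockSubgroup n) (hh' : h' ∈ blockSubgroup n)
    (a b : ℕ) : crossCount (h * u * h') (2 * a) (2 * b) = crossCount u (2 * a) (2 * b) := by
  unfold crossCount
  rw [← Equiv.sum_comp h' fun p => if 2 * a ≤ p.val ∧ (u p).val < 2 * b then 1 else 0]
  refine Finset.sum_congr rfl fun p _ => ?_
  have h1 := hh' p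
  have h2 := hh (u (h' p))
  rw [Equiv.Perm.mul_apply, Equiv.Perm.mul_apply]
  split_ifs <;> omega

/-- Every count that enters the parameter is taken at even cuts. -/
theorem cosetParam_congr {n l : ℕ} {j : Fin l → ℕ} (hn : ∀ i, j i + 1 < n)
    {u v : Equiv.Perm (Fin (n * 2))}
    (h : ∀ a b, crossCount u (2 * a) (2 * b) = crossCount v (2 * a) (2 * b))
    (h' : ∀ a b, crossCount u⁻¹ (2 * a) (2 * b) = crossCount v⁻¹ (2 * a) (2 * b)) :
    cosetParam n j u = cosetParam n j v := by
  have hu := mem_cosetParam hn u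
  have hv := mem_cosetParam hn v
  have e2 : ∀ k, 2 * k + 2 = 2 * (k + 1) := fun k => by ring
  have e4 : ∀ k, 2 * k + 4 = 2 * (k + 2) := fun k => by ring
  have hIf : (cosetParam n j u).If = (cosetParam n j v).If := by
    ext i
    rw [(hu i).2.1, (hv i).2.1, e2, h]
  refine Triplet.ext ?_ ?_ hIf
  · ext i
    rw [(hu i).1, (hv i).1, e2, h]
  · ext i
    rw [(hu i).2.2, (hv i).2.2, hIf]
    simp only [e2, e4, h, h']

theorem cosetParam_of_mem_doubleCoset {n l : ℕ} {j : Fin l → ℕ} (hn : ∀ i, j i + 1 < n)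
    {u v : Equiv.Perm (Fin (n * 2))}
    (h : v ∈ DoubleCoset.doubleCoset u (blockSubgroup n : Set (Equiv.Perm (Fin (n * 2))))
      (blockSubgroup n : Set (Equiv.Perm (Fin (n * 2))))) :
    cosetParam n j v = cosetParam n j u := by
  obtain ⟨x, hx, y, hy, rfl⟩ := DoubleCoset.mem_doubleCoset.1 h
  refine cosetParam_congr hn (fun a b => crossCount_block_mul u hx hy a b) fun a b => ?_
  rw [mul_inv_rev, mul_inv_rev, ← mul_assoc]
  exact crossCount_block_mul _ (inv_mem hy) (inv_mem hx) a b

/-- A product of masks has the parameter `Q` if and only if it lies in the double coset of the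
representative of `Q`. -/
theorem mem_doubleCoset_iff {n l : ℕ} {j : Fin l → ℕ} (hj : Function.Injective j)
    (hn : ∀ i, j i + 1 < n) {Q : Triplet l} (hQ : Q ∈ triplets j) (y : Fin l → Mask)
    {u : Equiv.Perm (Fin (n * 2))}
    (hu : shiftPerm 0 (n * 2) u = wordPerm (List.ofFn fun i => (j i, y i))) :
    u ∈ DoubleCoset.doubleCoset (cosetRep n j Q)
      (blockSubgroup n : Set (Equiv.Perm (Fin (n * 2))))
      (blockSubgroup n : Set (Equiv.Perm (Fin (n * 2)))) ↔ cosetParam n j u = Q := by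
  have hnd : (List.ofFn j).Nodup := List.nodup_ofFn.2 hj
  have hgood := (goodRun_canonicalMask (c := letterClass j Q) (I := letterFlag j Q) hnd letterClass_le
    (List.prefix_refl _)).1
  have hmap : ((List.ofFn j).map fun k =>
      (k, canonicalMask (List.ofFn j) (letterClass j Q) (letterFlag j Q) k)).map Prod.fst =
      List.ofFn j := by simp [Function.comp_def]
  have hrep := (cosetParam_eq_iff hj hn hQ hmap (cosetRep_eq hj hn hQ)).2
    ((goodRun_iff_hasParam hj hmap).1 hgood)
  have hmapu : (List.ofFn fun i => (j i, y i)).map Prod.fst = List.ofFn j := by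
    simp [Function.comp_def]
  constructor
  · intro h
    rw [cosetParam_of_mem_doubleCoset hn h, hrep]
  · intro h
    have hgu := (goodRun_iff_hasParam hj hmapu).2 ((cosetParam_eq_iff hj hn hQ hmapu hu).1 h)
    refine mem_doubleCoset_of_labels fun b => ?_
    have hZ := labels_eq (I := letterFlag j Q) hnd (Z := List.ofFn fun i => (j i,
      canonicalMask (List.ofFn j) (letterClass j Q) (letterFlag j Q) (j i), y i))
      (by simp [Function.comp_def])
      (by simpa [Function.comp_def] using hgood) (by simpa [Function.comp_def] using hgu) b
    rw [hu, cosetRep_eq hj hn hQ]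
    simpa [Function.comp_def] using hZ

/-! ### Reduced words of Boolean permutations -/

theorem wordProd_lt_iff {N k : ℕ} {L : List ℕ} (hL : ∀ r ∈ L, r + 1 < N) (hk : k ∉ L)
    (p : Fin N) : (wordProd N L p).val < k + 1 ↔ p.val < k + 1 := by
  induction L with
  | nil => rfl
  | cons r t ih =>
    have hr : r ≠ k := fun h => hk (h ▸ List.mem_cons_self)
    have ht := ih (fun s hs => hL s (List.mem_cons_of_mem _ hs))
      fun h => hk (List.mem_cons_of_mem _ h)
    have : wordProd N (r :: t) = simpleRefl N r * wordProd N t := by simp [wordProd]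
    rw [this, Equiv.Perm.mul_apply, simpleRefl_val (hL r List.mem_cons_self)]
    split_ifs <;> omega

/-- A word that contains `k` exactly once moves a point across the cut `k+1`; a word without `k`
preserves that cut. -/
theorem mem_of_wordProd_eq {N k : ℕ} {L L' : List ℕ} (hL : ∀ r ∈ L, r + 1 < N)
    (hL' : ∀ r ∈ L', r + 1 < N) (hnd : L.Nodup) (h : wordProd N L = wordProd N L')
    (hk : k ∈ L) : k ∈ L' := by
  by_contra hk'
  obtain ⟨A, B, rfl⟩ := List.append_of_mem hk
  have hkN : k + 1 < N := hL k hk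
  obtain ⟨-, h1, h2⟩ := List.nodup_append.1 hnd
  have hkA : k ∉ A := fun hA => h2 k hA k List.mem_cons_self rfl
  have hkB : k ∉ B := (List.nodup_cons.1 h1).1
  have hA : ∀ r ∈ A, r + 1 < N := fun r hr => hL r (by simp [hr])
  have hB : ∀ r ∈ B, r + 1 < N := fun r hr => hL r (by simp [hr])
  have hprod : ∀ q, wordProd N (A ++ k :: B) q =
      wordProd N A (simpleRefl N k (wordProd N B q)) := fun q => by
    simp [wordProd, Equiv.Perm.mul_apply]
  -- The point that `B` sends to `k`: it starts below the cut, the reflection takes it across, and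
  -- `A` keeps it there.
  have hp := wordProd_lt_iff hB hkB ((wordProd N B)⁻¹ ⟨k, by omega⟩)
  have hq := wordProd_lt_iff hL' hk' ((wordProd N B)⁻¹ ⟨k, by omega⟩)
  rw [← h, hprod, wordProd_lt_iff hA hkA, simpleRefl_val hkN] at hq
  rw [Equiv.Perm.inv_def, Equiv.apply_symm_apply] at hp hq
  simp only [if_true] at hp hq
  omega

/-- All letters of a word with distinct letters for `w` occur in the reduced word, which is not
longer. So each word is a rearrangement of the other. -/
theorem IsReducedWord.injective {n l : ℕ} {w : Equiv.Perm (Fin n)} {j : Fin l → ℕ}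
    (hj : IsReducedWord j w) (hw : IsBoolean w) : Function.Injective j := by
  obtain ⟨L, hnd, hL, rfl⟩ := hw
  obtain ⟨h1, h2, h3⟩ := hj
  have h4 : L ⊆ List.ofFn j := fun k hk => by
    refine mem_of_wordProd_eq hL (fun r hr => ?_) hnd h2.symm hk
    obtain ⟨i, rfl⟩ := exists_index hr
    exact h1 i
  have h5 := (List.subperm_of_subset hnd h4).perm_of_length_le
    (by rw [List.length_ofFn]; exact h3 L hL rfl)
  exact List.nodup_ofFn.1 (h5.nodup_iff.1 hnd)

/-! ### Masks of the doubled word -/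

/-- A mask of the doubled word, as a family of masks of the blocks. -/
def blockMasks (l : ℕ) : (Fin (l * 4) → Bool) ≃ (Fin l → Mask) :=
  (finProdFinEquiv.symm.arrowCongr (Equiv.refl Bool)).trans (Equiv.curry (Fin l) (Fin 4) Bool)

theorem blockMasks_apply {l : ℕ} (x : Fin (l * 4) → Bool) (i : Fin l) (r : Fin 4) :
    blockMasks l x i r = x (finProdFinEquiv (i, r)) := rfl

theorem doubleWord_apply {l : ℕ} (j : Fin l → ℕ) (i : Fin l) (r : Fin 4) :
    doubleWord j (finProdFinEquiv (i, r)) = 2 * j i + doubleLetter 0 r := by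
  unfold doubleWord
  rw [Equiv.symm_apply_apply]
  fin_cases r <;> simp [doubleLetter]

theorem doubleLetter_lt (r : Fin 4) : doubleLetter 0 r + 1 < 4 := by
  fin_cases r <;> simp [doubleLetter]

theorem partialProd_add_one (N : ℕ) {L : ℕ} (word : Fin L → ℕ) (x : Fin L → Bool) (p : Fin L) :
    partialProd N word x (p.val + 1) =
      partialProd N word x p.val * if x p then simpleRefl N (word p) else 1 := by
  unfold partialProd
  rw [List.prod_take_succ _ _ (by simp)]
  simp

theorem shiftPerm_letter (a : ℕ) {N k : ℕ} (hk : k + 1 < N) (b : Bool) :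
    shiftPerm a N (if b then simpleRefl N k else 1) =
      if b then Equiv.swap (a + k) (a + k + 1) else 1 := by
  cases b
  · simp
  · simpa using shiftPerm_simpleRefl a hk

section DoubledWord

variable {n l : ℕ} {j : Fin l → ℕ} (x : Fin (l * 4) → Bool)

/-- The word of blocks of a mask. -/
abbrev blockWord (j : Fin l → ℕ) (x : Fin (l * 4) → Bool) : List (ℕ × Mask) :=
  List.ofFn fun i => (j i, blockMasks l x i)

theorem shiftPerm_partialProd_add (hn : ∀ i, j i + 1 < n) (i : Fin l) {r : ℕ} (hr : r ≤ 4) :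
    shiftPerm 0 (n * 2) (partialProd (n * 2) (doubleWord j) x (i.val * 4 + r)) =
      shiftPerm 0 (n * 2) (partialProd (n * 2) (doubleWord j) x (i.val * 4)) *
        shiftPerm (2 * j i) 4 (localPerm (blockMasks l x i) r) := by
  induction r with
  | zero => simp [localPerm, partialProd]
  | succ r ih =>
    have hi := hn i
    have hd := doubleLetter_lt ⟨r, hr⟩
    have hp : i.val * 4 + r = (finProdFinEquiv (i, (⟨r, hr⟩ : Fin 4))).val := by
      rw [finProdFinEquiv_apply_val]
      ring
    have h1 := partialProd_add_one (n * 2) (doubleWord j) x (finProdFinEquiv (i, ⟨r, hr⟩))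
    have h2 := partialProd_add_one 4 (doubleLetter 0) (blockMasks l x i) ⟨r, hr⟩
    rw [← hp, doubleWord_apply] at h1
    rw [← add_assoc, h1, localPerm, h2, map_mul, map_mul, ih (by omega), ← mul_assoc,
      shiftPerm_letter _ (by omega), shiftPerm_letter _ (by omega), blockMasks_apply]
    rw [Nat.zero_add]
    rfl

theorem shiftPerm_partialProd (hn : ∀ i, j i + 1 < n) {i : ℕ} (hi : i ≤ l) :
    shiftPerm 0 (n * 2) (partialProd (n * 2) (doubleWord j) x (i * 4)) =
      wordPerm ((blockWord j x).take i) := by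
  induction i with
  | zero => simp [partialProd, wordPerm]
  | succ i ih =>
    rw [add_mul, one_mul, shiftPerm_partialProd_add x hn ⟨i, hi⟩ le_rfl, ih (by omega),
      List.take_succ_eq_append_getElem (by simpa using hi), List.getElem_ofFn, wordPerm_concat]
    rfl

theorem shiftPerm_maskProd (hn : ∀ i, j i + 1 < n) :
    shiftPerm 0 (n * 2) (maskProd (n * 2) (doubleWord j) x) = wordPerm (blockWord j x) := by
  have := shiftPerm_partialProd x hn le_rfl
  rwa [List.take_of_length_le (by simp)] at this

theorem shiftPerm_lt_iff {N : ℕ} (u : Equiv.Perm (Fin N)) (k : ℕ) (hk : k + 1 < N) :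
    SendsToNegative u k ↔ shiftPerm 0 N u (k + 1) < shiftPerm 0 N u k := by
  have h1 := shiftPerm_zero_apply u ⟨k + 1, hk⟩
  have h2 := shiftPerm_zero_apply u ⟨k, by omega⟩
  dsimp only at h1 h2
  rw [h1, h2]
  exact ⟨fun ⟨_, h⟩ => h, fun h => ⟨hk, h⟩⟩

/-- The two values compared are values of the product before the block, at two of its four points
moved by the letters chosen so far within the block. As that product separates the two pairs, the
comparison depends only on the bits. -/
theorem sendsToNegative_iff (hj : Function.Injective j) (hn : ∀ i, j i + 1 < n) (i : Fin l)
    (r : Fin 4) :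
    SendsToNegative (partialProd (n * 2) (doubleWord j) x (finProdFinEquiv (i, r)).val)
        (doubleWord j (finProdFinEquiv (i, r))) ↔
      blockPattern (runBits (fun _ => false) ((blockWord j x).take i) (j i))
          (runBits (fun _ => false) ((blockWord j x).take i) (j i + 1))
          (localPerm (blockMasks l x i) r (![2, 1, 3, 2] r)) <
        blockPattern (runBits (fun _ => false) ((blockWord j x).take i) (j i))
          (runBits (fun _ => false) ((blockWord j x).take i) (j i + 1))
          (localPerm (blockMasks l x i) r (![1, 0, 2, 1] r)) := by
  have hi := hn i
  have hd := doubleLetter_lt r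
  have hmap : (blockWord j x).map Prod.fst = List.ofFn j := by simp [Function.comp_def]
  have hnd : (List.ofFn j).Nodup := List.nodup_ofFn.2 hj
  have hsub : ((blockWord j x).take (i.val + 1)).map Prod.fst <+: List.ofFn j :=
    hmap ▸ (List.take_prefix _ _).map Prod.fst
  rw [List.take_succ_eq_append_getElem (by simp), List.getElem_ofFn] at hsub
  obtain ⟨hndA, hkA⟩ := nodup_concat (hnd.sublist hsub.sublist)
  rw [doubleWord_apply, shiftPerm_lt_iff _ _ (by omega), finProdFinEquiv_apply_val,
    show r.val + 4 * i.val = i.val * 4 + r.val by ring,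
    shiftPerm_partialProd_add x hn i r.isLt.le, shiftPerm_partialProd x hn i.isLt.le,
    runBits_eq_blockDescent hndA, runBits_eq_blockDescent hndA,
    ← (separates_wordPerm hkA).pattern]
  rw [← shiftPerm_apply, ← shiftPerm_apply, Equiv.Perm.mul_apply, Equiv.Perm.mul_apply]
  have e1 : 2 * j i + doubleLetter 0 r + 1 = 2 * j i + ((![2, 1, 3, 2] r : Fin 4)).val := by
    fin_cases r <;> rfl
  have e2 : 2 * j i + doubleLetter 0 r = 2 * j i + ((![1, 0, 2, 1] r : Fin 4)).val := by
    fin_cases r <;> rfl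
  rw [e1, e2]

theorem runDefect_ofFn {l : ℕ} (j : Fin l → ℕ) (y : Fin l → Mask) (β : ℕ → Bool) :
    runDefect β (List.ofFn fun i => (j i, y i)) =
      ∑ i : Fin l, localDefect (y i) (runBits β ((List.ofFn fun i => (j i, y i)).take i) (j i))
        (runBits β ((List.ofFn fun i => (j i, y i)).take i) (j i + 1)) := by
  induction l generalizing β with
  | zero => simp [runDefect]
  | succ l ih =>
    rw [Fin.sum_univ_succ, List.ofFn_succ, runDefect, ih]
    simp [runBits]

theorem defect_doubleWord (hj : Function.Injective j) (hn : ∀ i, j i + 1 < n) :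
    defect (n * 2) (doubleWord j) x = runDefect (fun _ => false) (blockWord j x) := by
  classical
  rw [runDefect_ofFn, defect, defectSet, Finset.card_filter, ← finProdFinEquiv.sum_comp,
    Fintype.sum_prod_type]
  refine Finset.sum_congr rfl fun i _ => Finset.sum_congr rfl fun r _ => ?_
  simp only [sendsToNegative_iff x hj hn]

theorem maskSign_doubleWord : maskSign x = runSign (blockWord j x) := by
  unfold maskSign runSign
  rw [← finProdFinEquiv.prod_comp, Fintype.prod_prod_type, List.map_ofFn, List.prod_ofFn]
  rfl

theorem sign_partialProd {N L : ℕ} {word : Fin L → ℕ} (hw : ∀ p, word p + 1 < N)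
    (x : Fin L → Bool) :
    ((Equiv.Perm.sign (maskProd N word x) : ℤˣ) : ℤ) = maskSign x := by
  unfold maskProd partialProd maskSign
  rw [List.take_of_length_le (by simp), map_list_prod, List.map_ofFn, List.prod_ofFn,
    Units.coe_prod]
  refine Finset.prod_congr rfl fun p _ => ?_
  dsimp only [Function.comp_apply]
  split_ifs
  · rw [simpleRefl, dif_pos (hw p), Equiv.Perm.sign_swap (by simp)]
    rfl
  · simp

theorem doubleWord_lt (hn : ∀ i, j i + 1 < n) (p : Fin (l * 4)) :
    doubleWord j p + 1 < n * 2 := by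
  obtain ⟨⟨i, r⟩, rfl⟩ := finProdFinEquiv.surjective p
  have := hn i
  have := doubleLetter_lt r
  rw [doubleWord_apply]
  omega

end DoubledWord

/-! ### The sums -/

/-- Each chosen letter is a transposition, so the sign of a mask is the sign of its product, and
masks can be grouped by their products. -/
theorem sum_sign_deodharPoly {N L : ℕ} {word : Fin L → ℕ} (hw : ∀ p, word p + 1 < N)
    (S : Finset (Equiv.Perm (Fin N))) :
    ∑ u ∈ S, Polynomial.C ((Equiv.Perm.sign u : ℤˣ) : ℤ) * deodharPoly N word u =
      ∑ x : Fin L → Bool with maskProd N word x ∈ S,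
        Polynomial.C (maskSign x) * Polynomial.X ^ defect N word x := by
  classical
  rw [← Finset.sum_fiberwise_of_maps_to (g := maskProd N word) (t := S)
    fun x hx => (Finset.mem_filter.1 hx).2]
  refine Finset.sum_congr rfl fun u hu => ?_
  rw [deodharPoly, Finset.mul_sum, Finset.filter_filter]
  refine Finset.sum_congr ?_ fun x hx => ?_
  · ext x
    simp only [Finset.mem_filter, Finset.mem_univ, true_and]
    exact ⟨fun h => ⟨h ▸ hu, h⟩, fun h => h.2⟩
  · rw [← (Finset.mem_filter.1 hx).2.2, sign_partialProd hw]

section Sums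

variable {n l : ℕ} {j : Fin l → ℕ} {Q : Triplet l}

theorem sum_cosetOf_eq (hj : Function.Injective j) (hn : ∀ i, j i + 1 < n) (hQ : Q ∈ triplets j) :
    ∑ u ∈ cosetOf n j Q,
        Polynomial.C ((Equiv.Perm.sign u : ℤˣ) : ℤ) * deodharPoly (n * 2) (doubleWord j) u =
      ∑ x ∈ masksOver n j Q,
        Polynomial.C (maskSign x) * Polynomial.X ^ defect (n * 2) (doubleWord j) x := by
  classical
  rw [sum_sign_deodharPoly (doubleWord_lt hn)]
  refine Finset.sum_congr ?_ fun _ _ => rfl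
  ext x
  simp only [cosetOf, masksOver, Finset.mem_filter, Finset.mem_univ, true_and]
  exact mem_doubleCoset_iff hj hn hQ (blockMasks l x) (shiftPerm_maskProd x hn)

theorem mem_masksOver_iff (hj : Function.Injective j) (hn : ∀ i, j i + 1 < n)
    (hQ : Q ∈ triplets j) (x : Fin (l * 4) → Bool) :
    x ∈ masksOver n j Q ↔
      GoodRun (Constraint (List.ofFn j) (letterClass j Q) (letterFlag j Q)) (fun _ => false)
        (blockWord j x) := by
  have hmap : (blockWord j x).map Prod.fst = List.ofFn j := by simp [Function.comp_def]
  rw [goodRun_iff_hasParam hj hmap, ← cosetParam_eq_iff hj hn hQ hmap (shiftPerm_maskProd x hn)]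
  simp [masksOver]

theorem sum_masksOver_eq_prod (hj : Function.Injective j) (hn : ∀ i, j i + 1 < n)
    (hQ : Q ∈ triplets j) :
    ∑ x ∈ masksOver n j Q,
        Polynomial.C (maskSign x) * Polynomial.X ^ defect (n * 2) (doubleWord j) x =
      ∏ i, letterWeight (List.ofFn j) (letterClass j Q) (letterFlag j Q) (j i) := by
  classical
  have h : (List.ofFn j).toFinset = Finset.univ.image j := by
    ext k
    simp [List.mem_ofFn]
  rw [← Finset.prod_image fun a _ b _ hab => hj hab, ← h,
    ← transferWord_constraint (List.nodup_ofFn.2 hj) letterClass_le, transferWord_eq_sum,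
    ← (blockMasks l).sum_comp, ← Finset.sum_filter]
  refine Finset.sum_congr ?_ fun x _ => ?_
  · ext x
    simp only [Finset.mem_filter, Finset.mem_univ, true_and]
    exact mem_masksOver_iff hj hn hQ x
  · rw [defect_doubleWord x hj hn, maskSign_doubleWord]

theorem pow_card_eq_prod {R : Type*} [CommMonoid R] (a : R) (S : Finset (Fin l)) :
    a ^ S.card = ∏ i, if i ∈ S then a else 1 := by
  rw [Finset.prod_ite_mem, Finset.univ_inter, Finset.prod_const]

theorem nbrs_subset {A B : Finset (Fin l)} : nbrs j A B ⊆ B \ A := by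
  intro i hi
  simp only [nbrs, rightNbrs, leftNbrs, Finset.mem_union, Finset.mem_filter, Finset.mem_univ,
    true_and] at hi
  rcases hi with ⟨i', h⟩ | ⟨i', h⟩ <;> exact h.1

/-- Both sides are products over all indices. Each index of `I_e \ I_f` gives one sign, together
with `1` or `q` if it has a neighbor and with `q + 1` otherwise. -/
theorem prod_letterWeight (hj : Function.Injective j) (hQ : Q ∈ triplets j) :
    ∏ i, letterWeight (List.ofFn j) (letterClass j Q) (letterFlag j Q) (j i) =
      (-1) ^ (Q.Ie \ Q.If).card *
        Polynomial.X ^ (Q.Ieᶜ.card + (nbrs j Q.If Q.Ie \ Q.I).card) *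
        (Polynomial.X + 1) ^ (Q.Ie \ (Q.If ∪ nbrs j Q.If Q.Ie)).card := by
  rw [pow_add]
  simp only [pow_card_eq_prod, ← Finset.prod_mul_distrib]
  refine Finset.prod_congr rfl fun i _ => ?_
  have h1 : i ∈ Q.If → i ∈ Q.Ie := fun h => hQ.1 h
  have h2 : i ∈ nbrs j Q.If Q.Ie → i ∈ Q.Ie ∧ i ∉ Q.If := fun h =>
    Finset.mem_sdiff.1 (nbrs_subset h)
  rw [letterWeight, letterClass_apply hj, ← mem_nbrs_iff hj, linkWeight]
  simp only [letterFlag_apply hj, Finset.mem_sdiff, Finset.mem_union, Finset.mem_compl,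
    decide_eq_true_eq]
  by_cases hf : i ∈ Q.If
  · have := h1 hf
    simp_all
  · by_cases he : i ∈ Q.Ie
    · by_cases hN : i ∈ nbrs j Q.If Q.Ie
      · by_cases hI : i ∈ Q.I <;> simp [hf, he, hN, hI]
      · simp [hf, he, hN]
    · have : i ∉ nbrs j Q.If Q.Ie := fun h => he (h2 h).1
      simp [hf, he, this]

end Sums

end BooleanWord

theorem mainTheorem2 {n l : ℕ} (w : Equiv.Perm (Fin n)) (hw : IsBoolean w)
    (j : Fin l → ℕ) (hj : IsReducedWord j w) (Q : Triplet l) (hQ : Q ∈ triplets j) :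
    (∑ u ∈ cosetOf n j Q,
        Polynomial.C ((Equiv.Perm.sign u : ℤˣ) : ℤ) * deodharPoly (n * 2) (doubleWord j) u =
      ∑ x ∈ masksOver n j Q,
        Polynomial.C (maskSign x) * Polynomial.X ^ defect (n * 2) (doubleWord j) x) ∧
    (∑ x ∈ masksOver n j Q,
        Polynomial.C (maskSign x) * Polynomial.X ^ defect (n * 2) (doubleWord j) x =
      (-1) ^ (Q.Ie \ Q.If).card *
        Polynomial.X ^ (Q.Ieᶜ.card + (nbrs j Q.If Q.Ie \ Q.I).card) *
        (Polynomial.X + 1) ^ (Q.Ie \ (Q.If ∪ nbrs j Q.If Q.Ie)).card) ∧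
    (∑ x ∈ masksOver n j Q, maskSign x =
      2 ^ (Q.Ie \ (Q.If ∪ nbrs j Q.If Q.Ie)).card * (-1) ^ (Q.Ie \ Q.If).card) := by
  have hinj := hj.injective hw
  have hn := hj.1
  have hsum := (sum_masksOver_eq_prod hinj hn hQ).trans (prod_letterWeight hinj hQ)
  refine ⟨sum_cosetOf_eq hinj hn hQ, hsum, ?_⟩
  -- The unweighted count is the specialization `q = 1`.
  have h := congrArg (Polynomial.eval 1) hsum
  simp only [Polynomial.eval_finsetSum, Polynomial.eval_mul, Polynomial.eval_C,
    Polynomial.eval_pow, Polynomial.eval_X, Polynomial.eval_add, Polynomial.eval_neg,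
    Polynomial.eval_one, one_pow, mul_one] at h
  rw [h, mul_comm, one_add_one_eq_two]
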